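/- For a sequence $\alpha=(\alpha(i))_{i\in\mathbb N}$ of integers $\alpha(i)\ge 2$, let $T_\alpha$ be the rooted tree in which every vertex on level $n$ (that is, at distance $n$ from the root) has exactly $\alpha(n)$ children, and let $\mathrm{Aut}(T_\alpha)$ be its group of rooted tree automorphisms, with its profinite topology (pointwise convergence on vertices). For a vertex $v$ let $T_\alpha^v$ be the set of vertices $w$ such that $v$ lies on the path from the root to $w$. For a subgroup $H\le\mathrm{Aut}(T_\alpha)$, let $\mathrm{rist}_H(v)$ be the group of all $h\in H$ fixing every vertex outside $T_\alpha^v$, and let $\mathrm{rist}_H(n)$ be the subgroup generated by the groups $\mathrm{rist}_H(v)$ with $v$ on level $n$. A profinite group $G$ is a \emph{profinite branch group} if it is isomorphic, as a topological group, to a closed subgroup $H$ of some such $\mathrm{Aut}(T_\alpha)$ which acts transitively on each level of $T_\alpha$ and for which $\mathrm{rist}_H(n)$ has finite index in $H$ for every $n$. \textbf{Theorem.} Let $G$ be a profinite branch group. Then the following are equivalent: \begin{enumerate} \item $G$ is strongly just infinite: every non-trivial normal subgroup of $G$ is open with finite index. \item Every commensurated subgroup of $G$ is either finite or open. (A subgroup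 $C\le G$ is commensurated if for every $g\in G$ the intersection $C\cap gCg^{-1}$ has finite index in both $C$ and $gCg^{-1}$.) \item $G$ has the normal countable index property: every normal subgroup of countable index in $G$ is open. \item $G$ has the countable index property: every subgroup of countable index in $G$ is open. \item $G$ has the weak Steinhaus property: for every symmetric set $A\subseteq G$ such that $G=\bigcup_{n\in\mathbb N}g_nA$ for some sequence $(g_n)_{n\in\mathbb N}$ in $G$, there is $n\in\mathbb N$ such that $A^n$ contains a neighbourhood of $1$. \item $G$ has uncountable cofinality: $G$ is not the union of an increasing sequence $(G_n)_{n\in\mathbb N}$ of proper subgroups. \item $G$ is Cayley bounded: for every (possibly infinite) symmetric generating set $U$ of $G$ containing $1$ there is $n\ge 1$ with $U^n=G$. \item $G$ has property (FA): every action of $G$ on a tree without edge inversions fixes a vertex. \item $G$ has the Bergman property: every action of $G$ by isometries on a metric space has bounded orbits. \end{enumerate} Here "countable" means finite or countably infinite, subgroups in (1)-(4), (6) and sets in (5), (7) are not assumed closed or measurable, and actions in (8), (9) are not assumed continuous. -/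

import Mathlib

open scoped Pointwise Topology

universe u v w

namespace ProfiniteBranch

section Trees

/-- Vertices of the spherically homogeneous rooted tree `T_α`: a vertex on level `n` is a sequence
`(x_0, …, x_{n-1})` with `x_i ∈ {0, …, α i - 1}`, so that a vertex on level `n` has exactly `α n`
children. -/
abbrev Vertex (α : ℕ → ℕ) : Type := Σ n : ℕ, ∀ i : Fin n, Fin (α i)

/-- The root, the empty sequence. -/
def root (α : ℕ → ℕ) : Vertex α := ⟨0, fun i => i.elim0⟩

/-- The level of a vertex, i.e. its distance from the root. -/
def level {α : ℕ → ℕ} (v : Vertex α) : ℕ := v.1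

/-- `Below v w`: the vertex `w` belongs to the subtree `T_α^v` hanging at `v`
(`v` lies on the path from `w` to the root); in terms of sequences, `v` is a prefix of `w`. -/
def Below {α : ℕ → ℕ} (v w : Vertex α) : Prop :=
  ∃ h : v.1 ≤ w.1, ∀ i : Fin v.1, w.2 (Fin.castLE h i) = v.2 i

/-- `w` is a child of `v`. -/
def IsChild {α : ℕ → ℕ} (v w : Vertex α) : Prop :=
  Below v w ∧ level w = level v + 1

/-- The tree `T_α` as a graph: edges join each vertex to its children. -/
def treeGraph (α : ℕ → ℕ) : SimpleGraph (Vertex α) where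
  Adj v w := IsChild v w ∨ IsChild w v
  symm := ⟨fun _ _ h => h.symm⟩
  loopless := ⟨fun v h => by
    rcases h with h | h <;> exact absurd h.2 (by omega)⟩

/-- The graph automorphisms of `T_α` that fix the root. -/
def rootStabilizer (α : ℕ → ℕ) : Subgroup (treeGraph α ≃g treeGraph α) :=
  MulAction.stabilizer (treeGraph α ≃g treeGraph α) (root α)

/-- `Aut(T_α)`, the group of rooted tree automorphisms of `T_α`. -/
abbrev TreeAut (α : ℕ → ℕ) : Type := rootStabilizer α

/-- The canonical topology of the vertex set is the discrete one. -/
theorem discreteTopology_vertex (α : ℕ → ℕ) : DiscreteTopology (Vertex α) := inferInstance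

/-- The profinite topology of `Aut(T_α)`: the topology of pointwise convergence on the discrete
vertex set. -/
instance (α : ℕ → ℕ) : TopologicalSpace (TreeAut α) :=
  TopologicalSpace.induced (fun (g : TreeAut α) (v : Vertex α) => g • v) inferInstance

variable {α : ℕ → ℕ}

/-- The rigid stabilizer of the vertex `v` in `H ≤ Aut(T_α)`: the elements of `H` that fix every
vertex outside `T_α^v`. -/
def rist (H : Subgroup (TreeAut α)) (v : Vertex α) : Subgroup H where
  carrier := {g | ∀ w, ¬ Below v w → g • w = w}
  one_mem' := fun w _ => one_smul _ w
  mul_mem' := fun {a b} ha hb w hw => by rw [mul_smul, hb w hw, ha w hw]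
  inv_mem' := fun {a} ha w hw => by rw [inv_smul_eq_iff, ha w hw]

/-- The `n`-th rigid level stabilizer: the subgroup generated by the rigid stabilizers of the
vertices on level `n`. -/
def ristLevel (H : Subgroup (TreeAut α)) (n : ℕ) : Subgroup H :=
  ⨆ v : {v : Vertex α // level v = n}, rist H v.1

/-- `H` acts transitively on each level of `T_α`. -/
def SphericallyTransitive (H : Subgroup (TreeAut α)) : Prop :=
  ∀ v w : Vertex α, level v = level w → ∃ g : H, g • v = w

end Trees

/-- A profinite branch group: a group that is isomorphic, as a topological group, to a closed,
spherically transitive subgroup of some `Aut(T_α)`, `α i ≥ 2` for all `i`, all of whose rigid level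
stabilizers have finite index. -/
def IsProfiniteBranchGroup (G : Type*) [Group G] [TopologicalSpace G] : Prop :=
  ∃ α : ℕ → ℕ, (∀ i, 2 ≤ α i) ∧ ∃ H : Subgroup (TreeAut α),
    IsClosed (H : Set (TreeAut α)) ∧ Nonempty (G ≃ₜ* H) ∧ SphericallyTransitive H ∧
      ∀ n, (ristLevel H n).FiniteIndex

section Properties

/-- Every non-trivial normal subgroup is open with finite index. -/
def StronglyJustInfinite (G : Type u) [Group G] [TopologicalSpace G] : Prop :=
  ∀ N : Subgroup G, N.Normal → N ≠ ⊥ → IsOpen (N : Set G) ∧ N.FiniteIndex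

/-- `C` is commensurate with all its conjugates. -/
def IsCommensurated {G : Type u} [Group G] (C : Subgroup G) : Prop :=
  Subgroup.Commensurable.commensurator C = ⊤

/-- Every commensurated subgroup is either finite or open. -/
def CommensuratedFiniteOrOpen (G : Type u) [Group G] [TopologicalSpace G] : Prop :=
  ∀ C : Subgroup G, IsCommensurated C → (C : Set G).Finite ∨ IsOpen (C : Set G)

/-- Every normal subgroup of countable index is open. -/
def NormalCountableIndexProperty (G : Type u) [Group G] [TopologicalSpace G] : Prop :=
  ∀ N : Subgroup G, N.Normal → Countable (G ⧸ N) → IsOpen (N : Set G)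

/-- Every subgroup of countable index is open. -/
def CountableIndexProperty (G : Type u) [Group G] [TopologicalSpace G] : Prop :=
  ∀ K : Subgroup G, Countable (G ⧸ K) → IsOpen (K : Set G)

/-- Countably many left translates of `A` cover the group. -/
def SigmaSyndetic {G : Type u} [Group G] (A : Set G) : Prop :=
  ∃ g : ℕ → G, ⋃ n, g n • A = Set.univ

/-- For every symmetric `σ`-syndetic set `A`, some power
`A ^ n = {a_1 ⋯ a_n | a_i ∈ A}` is a neighbourhood of the identity. -/
def WeakSteinhausProperty (G : Type u) [Group G] [TopologicalSpace G] : Prop :=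
  ∀ A : Set G, A⁻¹ = A → SigmaSyndetic A → ∃ n : ℕ, A ^ n ∈ 𝓝 (1 : G)

/-- `G` is not the union of an increasing sequence of proper subgroups. -/
def UncountableCofinality (G : Type u) [Group G] : Prop :=
  ¬ ∃ K : ℕ → Subgroup G, Monotone K ∧ (∀ n, K n ≠ ⊤) ∧ ⋃ n, (K n : Set G) = Set.univ

/-- For every (possibly infinite) symmetric generating set `U` containing `1`, some power
`U ^ n`, `n ≥ 1`, is all of `G`. -/
def CayleyBounded (G : Type u) [Group G] : Prop :=
  ∀ U : Set G, U⁻¹ = U → (1 : G) ∈ U → Subgroup.closure U = ⊤ →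
    ∃ n : ℕ, 1 ≤ n ∧ U ^ n = Set.univ

/-- Property (FA): every action of `G` on a tree, by graph automorphisms and without edge
inversions, fixes a vertex. -/
def PropertyFA (G : Type u) [Group G] : Prop :=
  ∀ (V : Type v) (T : SimpleGraph V) [MulAction G V], T.IsTree →
    (∀ (g : G) (x y : V), T.Adj x y → T.Adj (g • x) (g • y)) →
    (∀ (g : G) (x y : V), T.Adj x y → ¬ (g • x = y ∧ g • y = x)) →
    ∃ x : V, ∀ g : G, g • x = x

/-- The Bergman property: every action of `G` by isometries on a metric space has bounded
orbits. -/
def BergmanProperty (G : Type u) [Group G] : Prop :=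
  ∀ (X : Type v) [MetricSpace X] [MulAction G X] [IsIsometricSMul G X] (x : X),
    Bornology.IsBounded (MulAction.orbit G x)

end Properties

end ProfiniteBranch

open ProfiniteBranch

/-! Write R_n for the n-th rigid level stabilizer and R_n' for its commutator subgroup. A nontrivial
normal subgroup N contains an element g moving some vertex v. For a, b in the rigid stabilizer of v,
[[a,g],b] = [a,b] lies in N, so by transitivity N contains R_n' with n the level of v. If R_n' has
finite index, Baire category makes it open and makes every element of it a product of boundedly many
commutators. Hence (1) means that every R_n' has finite index (`stronglyJustInfinite_of_forall`).

Consequences of (1) rest on a diagonal argument. Elements of the rigid stabilizers of infinitely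
many incomparable vertices can be glued by compactness. So for any countable cover of G by sets C_n
there are a vertex w, below any prescribed one, and n, m such that each commutator of two elements
of rist(w) is a commutator of an element of C_n⁻¹C_n with one of C_m⁻¹C_m
(`exists_commutators_in_cover`). Balls of a length function as the cover, together with bounded
commutator width, show that all lengths on G are bounded. This gives (7), (8), (9), and also (2),
since the logarithm of the index between conjugates of a commensurated subgroup is a length, and
uniform commensurability yields a commensurate normal subgroup. Translates of a set A as the cover
give (5), hence (4) and (3).

Conversely, suppose that some R_n' has infinite index. Then G/R_n' is infinite with the abelian
normal subgroup A = R_n/R_n' of finite index. An infinite abelian group has a countably infinite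
quotient, and finite index lets this be made G-invariant, against (3). For (6) and (7): if A/A^k is
infinite for some k, a countable quotient of bounded exponent carries an independent sequence of
finite index subgroups; otherwise A has a nonzero homomorphism to ℚ with a divisibility property.
Both produce an exhausting chain of proper subgroups and an unbounded length. Conditions (8) and (9)
imply (6), and (2) implies (1) because nontrivial normal subgroups are infinite and commensurated.
-/

open scoped commutatorElement

namespace ProfiniteBranch

/-- Every symmetric subadditive real function on `G` is bounded above. -/
def BoundedLengths (G : Type u) [Group G] : Prop :=
  ∀ L : G → ℝ, (∀ g h, L (g * h) ≤ L g + L h) → (∀ g, L g⁻¹ = L g) → ∃ c, ∀ g, L g ≤ c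

/-! ### Length functions, cofinality, word lengths and isometric actions -/

section Lengths

variable {G : Type u} [Group G]

/-- The length of `g` is the first index `n` with `g ∈ K n`; a bound `c` on it puts everything in
one `K n`. -/
theorem BoundedLengths.uncountableCofinality (hG : BoundedLengths G) :
    UncountableCofinality G := by
  classical
  rintro ⟨K, hK, hne, hU⟩
  have hex : ∀ g : G, ∃ n, g ∈ K n := fun g => by
    simpa using hU.symm.subset (Set.mem_univ g)
  have key : ∀ g n, g ∈ K n → Nat.find (hex g) ≤ n := fun g n h => Nat.find_min' _ h
  have hmem : ∀ g n, Nat.find (hex g) ≤ n → g ∈ K n := fun g n h => hK h (Nat.find_spec (hex g))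
  obtain ⟨c, hc⟩ := hG (fun g => (Nat.find (hex g) : ℝ))
    (fun g h => by
      have := key (g * h) (Nat.find (hex g) + Nat.find (hex h))
        (mul_mem (hmem _ _ (Nat.le_add_right _ _)) (hmem _ _ (Nat.le_add_left _ _)))
      exact_mod_cast this)
    (fun g => by
      have h1 := key g⁻¹ _ (inv_mem (Nat.find_spec (hex g)))
      have h2 := key g _ (inv_mem_iff.mp (Nat.find_spec (hex g⁻¹)))
      exact_mod_cast le_antisymm h1 h2)
  refine hne ⌈c⌉₊ (eq_top_iff.mpr fun g _ => hmem g _ ?_)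
  exact_mod_cast (hc g).trans (Nat.le_ceil c)

theorem exists_mem_pow_of_mem_closure {U : Set G} (hinv : U⁻¹ = U) {g : G}
    (hg : g ∈ Subgroup.closure U) : ∃ n : ℕ, g ∈ U ^ n := by
  induction hg using Subgroup.closure_induction with
  | mem x hx => exact ⟨1, by simpa using hx⟩
  | one => exact ⟨0, by simp⟩
  | mul x y _ _ hx hy =>
    obtain ⟨n, hn⟩ := hx
    obtain ⟨m, hm⟩ := hy
    exact ⟨n + m, by rw [pow_add]; exact Set.mul_mem_mul hn hm⟩
  | inv x _ hx =>
    obtain ⟨n, hn⟩ := hx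
    refine ⟨n, ?_⟩
    rw [← hinv, inv_pow]
    simpa using hn

/-- The length here is the word length with respect to `U`. -/
theorem BoundedLengths.cayleyBounded (hG : BoundedLengths G) : CayleyBounded G := by
  classical
  intro U hinv hone hcl
  have hex : ∀ g : G, ∃ n : ℕ, g ∈ U ^ n := fun g =>
    exists_mem_pow_of_mem_closure hinv (hcl ▸ Subgroup.mem_top g)
  have key : ∀ g n, g ∈ U ^ n → Nat.find (hex g) ≤ n := fun g n h => Nat.find_min' _ h
  have hinvmem : ∀ g n, g ∈ U ^ n → g⁻¹ ∈ U ^ n := fun g n h => by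
    rw [← hinv, inv_pow]; simpa using h
  obtain ⟨c, hc⟩ := hG (fun g => (Nat.find (hex g) : ℝ))
    (fun g h => by
      have := key (g * h) (Nat.find (hex g) + Nat.find (hex h))
        (by rw [pow_add]; exact Set.mul_mem_mul (Nat.find_spec (hex g)) (Nat.find_spec (hex h)))
      exact_mod_cast this)
    (fun g => by
      have h1 := key g⁻¹ _ (hinvmem _ _ (Nat.find_spec (hex g)))
      have h2 := key g _ (by simpa using hinvmem _ _ (Nat.find_spec (hex g⁻¹)))
      exact_mod_cast le_antisymm h1 h2)
  refine ⟨⌈c⌉₊ + 1, by omega, Set.eq_univ_of_forall fun g => ?_⟩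
  have : Nat.find (hex g) ≤ ⌈c⌉₊ + 1 :=
    (by exact_mod_cast (hc g).trans (Nat.le_ceil c) : Nat.find (hex g) ≤ ⌈c⌉₊).trans
      (Nat.le_succ _)
  exact Set.pow_subset_pow_right hone this (Nat.find_spec (hex g))

theorem BoundedLengths.bergmanProperty (hG : BoundedLengths G) : BergmanProperty.{u, w} G := by
  intro X _ _ _ x
  obtain ⟨c, hc⟩ := hG (fun g => dist x (g • x))
    (fun g h => by
      calc dist x ((g * h) • x) ≤ dist x (g • x) + dist (g • x) ((g * h) • x) :=
            dist_triangle _ _ _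
        _ = dist x (g • x) + dist x (h • x) := by rw [mul_smul, dist_smul])
    (fun g => by rw [← dist_smul g, smul_inv_smul, dist_comm])
  refine (Metric.isBounded_iff_subset_closedBall x).mpr ⟨c, ?_⟩
  rintro _ ⟨g, rfl⟩
  simpa [dist_comm] using hc g

/-- A length turns into a left-invariant metric: the distance of distinct `x`, `y` is `1 + L (x⁻¹ *
y)`, where the `1` separates points even if `L` vanishes there. Taking `G` in `Type` allows the
metric space to be lifted to any universe. -/
theorem boundedLengths_of_bergmanProperty {G : Type} [Group G]
    (hG : BergmanProperty.{0, w} G) : BoundedLengths G := by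
  classical
  intro L hmul hinv
  have hone : 0 ≤ L 1 := by have := hmul 1 1; rw [mul_one] at this; linarith
  have hpos : ∀ g, 0 ≤ L g := fun g => by
    have := hmul g g⁻¹
    rw [mul_inv_cancel, hinv] at this
    linarith
  let d : ULift.{w} G → ULift.{w} G → ℝ := fun x y =>
    if x = y then 0 else 1 + L (x.down⁻¹ * y.down)
  let : MetricSpace (ULift.{w} G) :=
    { dist := d
      dist_self := fun x => by simp [d]
      dist_comm := fun x y => by
        by_cases h : x = y
        · simp [d, h]
        · simp only [d, h, Ne.symm h, if_false]
          rw [← hinv (x.down⁻¹ * y.down)]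
          simp
      dist_triangle := fun x y z => by
        have h1 := hpos (x.down⁻¹ * y.down)
        have h2 := hpos (y.down⁻¹ * z.down)
        have h3 := hmul (x.down⁻¹ * y.down) (y.down⁻¹ * z.down)
        rw [show x.down⁻¹ * y.down * (y.down⁻¹ * z.down) = x.down⁻¹ * z.down by group] at h3
        by_cases hxz : x = z
        · subst hxz
          simp only [d, if_true]
          split_ifs <;> linarith
        by_cases hxy : x = y
        · subst hxy
          simp [d, hxz]
        by_cases hyz : y = z
        · subst hyz
          simp [d]
        simp only [d, hxz, hxy, hyz, if_false]
        linarith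
      eq_of_dist_eq_zero := fun {x y} h => by
        by_contra hne
        have h' : d x y = 0 := h
        simp only [d, hne, if_false] at h'
        linarith [hpos (x.down⁻¹ * y.down)] }
  have hdist : ∀ x y : ULift.{w} G, dist x y = d x y := fun _ _ => rfl
  let : MulAction G (ULift.{w} G) :=
    { smul := fun g x => ⟨g * x.down⟩
      one_smul := fun x => by change ULift.up _ = _; simp
      mul_smul := fun g h x => by change ULift.up _ = ULift.up (g * (h * x.down)); simp [mul_assoc] }
  have hsmul : ∀ (g : G) (x : ULift.{w} G), g • x = ⟨g * x.down⟩ := fun _ _ => rfl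
  have : IsIsometricSMul G (ULift.{w} G) := ⟨fun g => Isometry.of_dist_eq fun x y => by
    have : (g • x = g • y) ↔ x = y := (MulAction.injective g).eq_iff
    simp only [hdist, d, this]
    simp only [hsmul, mul_inv_rev]
    congr 3
    group⟩
  obtain ⟨c, hc⟩ := (Metric.isBounded_iff_subset_closedBall (ULift.up.{w} (1 : G))).mp
    (hG (ULift.{w} G) ⟨1⟩)
  refine ⟨max c (L 1), fun g => ?_⟩
  by_cases hg : g = 1
  · subst hg; exact le_max_right _ _
  have := hc ⟨g, rfl⟩
  simp only [Metric.mem_closedBall, hsmul, mul_one, hdist, d] at this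
  rw [if_neg (by simpa using hg)] at this
  rw [hinv] at this
  exact le_max_of_le_left (by linarith)

end Lengths

/-! ### Transfer to isomorphic groups and to quotients -/

section Transfer

variable {G : Type u} {G' : Type v} [Group G] [Group G']

theorem BergmanProperty.of_mulEquiv (e : G ≃* G') (h : BergmanProperty.{u, w} G) :
    BergmanProperty.{v, w} G' := by
  intro X _ _ _ x
  let : MulAction G X := MulAction.compHom X e.toMonoidHom
  have hs : ∀ (g : G) (y : X), g • y = e g • y := fun _ _ => rfl
  have : IsIsometricSMul G X := ⟨fun g => isometry_smul X (e g)⟩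
  refine (h X x).subset ?_
  rintro _ ⟨g, rfl⟩
  exact ⟨e.symm g, by simp [hs]⟩

theorem PropertyFA.of_mulEquiv (e : G ≃* G') (h : PropertyFA.{u, w} G) :
    PropertyFA.{v, w} G' := by
  intro V T _ hT hadj hinv
  let : MulAction G V := MulAction.compHom V e.toMonoidHom
  obtain ⟨x, hx⟩ := h V T hT (fun g => hadj (e g)) (fun g => hinv (e g))
  refine ⟨x, fun g => ?_⟩
  have := hx (e.symm g)
  change e (e.symm g) • x = x at this
  simpa using this

theorem UncountableCofinality.of_surjective (f : G →* G') (hf : Function.Surjective f)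
    (h : UncountableCofinality G) : UncountableCofinality G' := by
  rintro ⟨K, hK, hne, hU⟩
  refine h ⟨fun n => (K n).comap f, fun m n hmn => Subgroup.comap_mono (hK hmn), fun n hn => ?_, ?_⟩
  · refine hne n (eq_top_iff.mpr fun y _ => ?_)
    obtain ⟨x, rfl⟩ := hf y
    exact (show x ∈ (K n).comap f by rw [show (K n).comap f = ⊤ from hn]; trivial)
  · refine Set.eq_univ_of_forall fun x => ?_
    have := hU.symm.subset (Set.mem_univ (f x))
    simpa using this

/-- The preimage of `U` contains the kernel, because `1 ∈ U`; hence it generates `G`. -/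
theorem CayleyBounded.of_surjective (f : G →* G') (hf : Function.Surjective f)
    (h : CayleyBounded G) : CayleyBounded G' := by
  intro U hinv hone hcl
  have hker : ((f ⁻¹' U) : Set G)⁻¹ = f ⁻¹' U := by
    ext x
    rw [Set.mem_inv, Set.mem_preimage, Set.mem_preimage, map_inv, ← Set.mem_inv, hinv]
  obtain ⟨n, hn, hpow⟩ := h (f ⁻¹' U) hker (by simpa using hone) (by
    refine eq_top_iff.mpr fun x _ => ?_
    obtain ⟨n, hn⟩ := exists_mem_pow_of_mem_closure hinv (hcl ▸ Subgroup.mem_top (f x))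
    have key : ∀ n x, f x ∈ U ^ n → x ∈ Subgroup.closure (f ⁻¹' U) := by
      intro n
      induction n with
      | zero =>
        intro x hx
        refine Subgroup.subset_closure ?_
        have : f x = 1 := by simpa using hx
        simpa [this] using hone
      | succ n ih =>
        intro x hx
        obtain ⟨a, ha, b, hb, hab⟩ := Set.mem_mul.mp (pow_succ U n ▸ hx)
        obtain ⟨b', rfl⟩ := hf b
        have : x * b'⁻¹ ∈ Subgroup.closure (f ⁻¹' U) := ih _ (by
          rw [map_mul, ← hab, map_inv, mul_inv_cancel_right]; exact ha)
        have h2 : b' ∈ Subgroup.closure (f ⁻¹' U) := Subgroup.subset_closure hb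
        simpa using mul_mem this h2
    exact key n x hn)
  refine ⟨n, hn, Set.eq_univ_of_forall fun y => ?_⟩
  obtain ⟨x, rfl⟩ := hf y
  have hx : x ∈ (f ⁻¹' U) ^ n := hpow ▸ Set.mem_univ x
  have h1 : f x ∈ f '' ((f ⁻¹' U) ^ n) := ⟨x, hx, rfl⟩
  rw [Set.image_pow_of_ne_zero (by omega)] at h1
  exact Set.pow_subset_pow_left (Set.image_preimage_subset f U) h1

end Transfer

/-! ### Bounded orbits on trees -/

section Trees

variable {V : Type v} {T : SimpleGraph V}

/-- In a tree at most one neighbour of `u` is closer to `o` than `u`. -/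
theorem eq_of_adj_of_dist_le (hT : T.IsTree) {u a b o : V} (hua : T.Adj u a) (hub : T.Adj u b)
    (ha : T.dist a o ≤ T.dist u o) (hb : T.dist b o ≤ T.dist u o) : a = b := by
  -- A geodesic from `c` to `o` avoids `u`, since passing through `u` would make `c` farther from
  -- `o` than `u` is. Prefixing `u` therefore gives a path, and paths from `u` to `o` are unique.
  have key : ∀ c, T.Adj u c → T.dist c o ≤ T.dist u o →
      ∃ (p : T.Walk u o), p.IsPath ∧ p.snd = c := by
    intro c huc hc
    obtain ⟨p, hp, hlen⟩ := hT.connected.exists_path_of_dist c o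
    by_cases hmem : u ∈ p.support
    · exfalso
      classical
      have h1 : (p.takeUntil u hmem).length + (p.dropUntil u hmem).length = p.length := by
        rw [← SimpleGraph.Walk.length_append, SimpleGraph.Walk.take_spec]
      have h2 := SimpleGraph.dist_le (p.dropUntil u hmem)
      have h3 : (p.takeUntil u hmem).length ≠ 0 := fun h =>
        huc.ne (SimpleGraph.Walk.eq_of_length_eq_zero h).symm
      omega
    · exact ⟨.cons huc p, hp.cons hmem, by simp⟩
  obtain ⟨p, hp, hpa⟩ := key a hua ha
  obtain ⟨q, hq, hqb⟩ := key b hub hb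
  have : p = q := congrArg Subtype.val
    ((hT.isAcyclic.subsingleton_path u o).elim ⟨p, hp⟩ ⟨q, hq⟩)
  rw [← hpa, ← hqb, this]

/-- The distance to `o` is strictly smaller inside a geodesic than at one of its ends. -/
theorem dist_lt_of_strictly_between (hT : T.IsTree) {k : ℕ} (p : ℕ → V)
    (hp : ∀ i < k, T.Adj (p i) (p (i + 1))) (hne : ∀ i, i + 2 ≤ k → p i ≠ p (i + 2)) (o : V)
    {M : ℕ} (h0 : T.dist (p 0) o ≤ M) (hk : T.dist (p k) o ≤ M) {i : ℕ} (hi0 : 0 < i)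
    (hik : i < k) : T.dist (p i) o < M := by
  by_contra hM
  -- At an interior index of maximal distance both neighbours are no farther from `o`, so they
  -- coincide, which is backtracking.
  obtain ⟨j, hj, hmax⟩ := (Finset.Ioo 0 k).exists_max_image (fun j => T.dist (p j) o)
    ⟨i, Finset.mem_Ioo.mpr ⟨hi0, hik⟩⟩
  rw [Finset.mem_Ioo] at hj
  have hall : ∀ l ≤ k, T.dist (p l) o ≤ T.dist (p j) o := by
    have hMj : M ≤ T.dist (p j) o :=
      (not_lt.mp hM).trans (hmax i (Finset.mem_Ioo.mpr ⟨hi0, hik⟩))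
    intro l hl
    rcases Nat.eq_zero_or_pos l with rfl | hl0
    · omega
    rcases hl.eq_or_lt with rfl | hl1
    · omega
    exact hmax l (Finset.mem_Ioo.mpr ⟨hl0, hl1⟩)
  obtain ⟨j, rfl⟩ : ∃ j', j = j' + 1 := ⟨j - 1, by omega⟩
  exact hne j (by omega) (eq_of_adj_of_dist_le hT (hp j (by omega)).symm (hp (j + 1) (by omega))
    (hall j (by omega)) (hall (j + 2) (by omega)))

variable {G : Type u} [Group G]

/-- The displacement of a vertex is a length, so orbits are bounded. Consider the centres of an
orbit, the vertices minimizing the largest distance to it. Two distinct centres are adjacent,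
because an interior vertex of a longer geodesic between them would be strictly closer to the whole
orbit. If `g` moves a centre `v`, then `v`, `g • v`, `g • g • v` form a triangle, unless `g` inverts
an edge. -/
theorem BoundedLengths.propertyFA (hG : BoundedLengths G) : PropertyFA.{u, v} G := by
  classical
  intro V T _ hT hadj hinv
  obtain ⟨x⟩ := hT.connected.nonempty
  have hadj' : ∀ (g : G) (x y : V), T.Adj (g • x) (g • y) ↔ T.Adj x y := fun g x y =>
    ⟨fun h => by simpa using hadj g⁻¹ _ _ h, hadj g x y⟩
  have hle : ∀ (g : G) (x y : V), T.dist (g • x) (g • y) ≤ T.dist x y := fun g x y => by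
    obtain ⟨p, hp⟩ := hT.connected.exists_walk_length_eq_dist x y
    rw [← hp]
    let f : T →g T := ⟨fun x => g • x, fun h => hadj g _ _ h⟩
    exact (SimpleGraph.dist_le (p.map f)).trans_eq (by simp)
  have hdist : ∀ (g : G) (x y : V), T.dist (g • x) (g • y) = T.dist x y := fun g x y =>
    le_antisymm (hle g x y) (by simpa using hle g⁻¹ (g • x) (g • y))
  obtain ⟨c, hc⟩ := hG (fun g => (T.dist x (g • x) : ℝ))
    (fun g h => by
      have := hT.connected.dist_triangle (u := x) (v := g • x) (w := (g * h) • x)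
      rw [mul_smul, hdist] at this
      rw [mul_smul]
      exact_mod_cast this)
    (fun g => by rw [← hdist g, smul_inv_smul, SimpleGraph.dist_comm])
  let P : ℕ → Prop := fun m => ∃ v, ∀ g : G, T.dist v (g • x) ≤ m
  have hP : ∃ m, P m := ⟨⌈c⌉₊, x, fun g => by exact_mod_cast (hc g).trans (Nat.le_ceil c)⟩
  obtain ⟨v, hv⟩ := Nat.find_spec hP
  have hinvar : ∀ (w : V) (m : ℕ), (∀ g : G, T.dist w (g • x) ≤ m) → ∀ h g : G,
      T.dist (h • w) (g • x) ≤ m := fun w m hw h g => by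
    rw [← hdist h⁻¹, inv_smul_smul, ← mul_smul]
    exact hw _
  have hnear : ∀ w, (∀ g : G, T.dist w (g • x) ≤ Nat.find hP) → w ≠ v → T.Adj v w := by
    intro w hw hne
    by_contra hnadj
    obtain ⟨p, hp, hlen⟩ := hT.connected.exists_path_of_dist v w
    have h2 : 1 < p.length := by
      rw [hlen]
      have h0 : T.dist v w ≠ 0 := fun h => hne (hT.connected.dist_eq_zero_iff.mp h).symm
      have h1 : T.dist v w ≠ 1 := fun h => hnadj (SimpleGraph.dist_eq_one_iff_adj.mp h)
      omega
    have hlt : ∀ g : G, T.dist (p.getVert 1) (g • x) < Nat.find hP := fun g =>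
      dist_lt_of_strictly_between hT (k := p.length) p.getVert
        (fun i hi => p.adj_getVert_succ hi)
        (fun i hi h => by
          have := hp.getVert_injOn (by simp; omega : i ∈ {i | i ≤ p.length}) (by simpa using hi) h
          omega)
        (g • x) (by simpa using hv g) (by simpa using hw g) Nat.one_pos h2
    have hpos : 0 < Nat.find hP := (Nat.zero_le _).trans_lt (hlt 1)
    exact Nat.find_min hP (m := Nat.find hP - 1) (by omega)
      ⟨p.getVert 1, fun g => by have := hlt g; omega⟩
  by_cases hfix : ∀ g : G, g • v = v
  · exact ⟨v, hfix⟩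
  push Not at hfix
  obtain ⟨g, hg⟩ := hfix
  exfalso
  have h1 : T.Adj v (g • v) := hnear _ (hinvar v _ hv g) hg
  have hgg : g • g • v ≠ v := fun h => hinv g v (g • v) h1 ⟨rfl, h⟩
  have h2 : T.Adj v (g • g • v) := hnear _ (hinvar _ _ (hinvar v _ hv g) g) hgg
  have h3 : T.Adj (g • v) (g • g • v) := hadj g _ _ h1
  have h4 := hT.dist_ne_of_adj v h3
  rw [SimpleGraph.dist_eq_one_iff_adj.mpr h1, SimpleGraph.dist_eq_one_iff_adj.mpr h2] at h4
  exact h4 rfl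

end Trees

/-! ### The tree of cosets of an increasing chain of subgroups -/

section ParentGraph

variable {V : Type v}

/-- The graph in which every vertex is joined to its parent. -/
def parentGraph (lev : V → ℕ) (up : V → V) (hup : ∀ v, lev (up v) = lev v + 1) :
    SimpleGraph V where
  Adj x y := up x = y ∨ up y = x
  symm := ⟨fun _ _ h => h.symm⟩
  loopless := ⟨fun v h => by
    have := hup v
    rcases h with h | h <;> rw [h] at this <;> omega⟩

/-- Common ancestors give connectedness. For acyclicity every edge is shown to be a bridge. -/
theorem parentGraph_isTree [Nonempty V] (lev : V → ℕ) (up : V → V)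
    (hup : ∀ v, lev (up v) = lev v + 1) (hmeet : ∀ x y, ∃ m n, up^[m] x = up^[n] y) :
    (parentGraph lev up hup).IsTree := by
  set T := parentGraph lev up hup with hTdef
  have hreach : ∀ n x, T.Reachable x (up^[n] x) := by
    intro n
    induction n with
    | zero => intro x; exact SimpleGraph.Reachable.refl _
    | succ n ih =>
      intro x
      rw [Function.iterate_succ_apply']
      exact (ih x).trans (SimpleGraph.Adj.reachable (Or.inl rfl))
  have hlev : ∀ n x, lev (up^[n] x) = lev x + n := by
    intro n
    induction n with
    | zero => simp
    | succ n ih => intro x; rw [Function.iterate_succ_apply', hup, ih]; omega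
  refine ⟨⟨fun x y => ?_⟩, ?_⟩
  · obtain ⟨m, n, h⟩ := hmeet x y
    exact (hreach m x).trans (h ▸ (hreach n y).symm)
  · have hbridge : ∀ v, T.IsBridge s(v, up v) := by
      intro v
      rw [SimpleGraph.isBridge_iff]
      rintro ⟨p⟩
      -- Walks avoiding the edge from `v` to `up v` stay among the descendants of `v`, and `up v` is
      -- not one, by its level.
      have hinv : ∀ {a b : V}, (T \ SimpleGraph.fromEdgeSet {s(v, up v)}).Walk a b →
          (∃ n, up^[n] a = v) → ∃ n, up^[n] b = v := by
        intro a b p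
        induction p with
        | nil => exact id
        | @cons a c b hac _ ih =>
          rintro ⟨n, hn⟩
          refine ih ?_
          rw [SimpleGraph.sdiff_adj] at hac
          obtain ⟨hac, hnot⟩ := hac
          rcases hac with h | h
          · cases n with
            | zero =>
              exfalso
              apply hnot
              have hav : a = v := hn
              subst hav
              rw [SimpleGraph.fromEdgeSet_adj, ← h]
              refine ⟨rfl, fun he => ?_⟩
              have := hup a
              rw [← he] at this
              omega
            | succ n => exact ⟨n, by rw [← h]; exact hn⟩
          · exact ⟨n + 1, by rw [Function.iterate_succ_apply, h]; exact hn⟩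
      obtain ⟨n, hn⟩ := hinv p ⟨0, rfl⟩
      have h1 := hlev n (up v)
      rw [hn, hup] at h1
      omega
    rw [SimpleGraph.isAcyclic_iff_forall_adj_isBridge]
    rintro a b (h | h)
    · exact h ▸ hbridge a
    · rw [Sym2.eq_swap]; exact h ▸ hbridge b

/-- Serre's construction: the vertices are the cosets of all `K n`, and the parent of `g K n` is `g
K (n + 1)`. Two vertices have a common ancestor because the `K n` exhaust `G`, and the action
preserves levels, so it inverts no edge. A fixed vertex forces some `K n` to be everything. -/
theorem uncountableCofinality_of_propertyFA {G : Type} [Group G] (hG : PropertyFA.{0, v} G) :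
    UncountableCofinality G := by
  rintro ⟨K, hK, hne, hU⟩
  let W : Type := Σ n : ℕ, G ⧸ K n
  let V : Type v := ULift.{v} W
  let step : ∀ n, G ⧸ K n → G ⧸ K (n + 1) := fun n =>
    Quotient.map' id fun a b h => by
      rw [QuotientGroup.leftRel_apply] at h ⊢
      exact hK (Nat.le_succ n) h
  let up : V → V := fun x => ⟨⟨x.down.1 + 1, step x.down.1 x.down.2⟩⟩
  let lev : V → ℕ := fun x => x.down.1
  let mkV : ∀ (n : ℕ) (g : G), V := fun n g => ⟨⟨n, (g : G ⧸ K n)⟩⟩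
  have hmk : ∀ x : V, ∃ n g, x = mkV n g := by
    rintro ⟨n, x⟩
    obtain ⟨g, rfl⟩ := QuotientGroup.mk_surjective x
    exact ⟨n, g, rfl⟩
  have hup : ∀ n g, up (mkV n g) = mkV (n + 1) g := fun _ _ => rfl
  have hiter : ∀ k n g, up^[k] (mkV n g) = mkV (n + k) g := by
    intro k
    induction k with
    | zero => intro n g; rfl
    | succ k ih => intro n g; rw [Function.iterate_succ_apply', ih, hup]; rfl
  have hmkeq : ∀ n g h, g⁻¹ * h ∈ K n → mkV n g = mkV n h := fun n g h hgh => by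
    have : (g : G ⧸ K n) = h := QuotientGroup.eq.mpr hgh
    simp only [mkV, this]
  have hsmul : ∀ (g : G) n h, g • mkV n h = mkV n (g * h) := fun _ _ _ => rfl
  have hsup : ∀ (g : G) (x : V), up (g • x) = g • up x := fun g x => by
    obtain ⟨n, h, rfl⟩ := hmk x
    rfl
  have : Nonempty V := ⟨mkV 0 1⟩
  have hex : ∀ g : G, ∃ n, g ∈ K n := fun g => by
    simpa using hU.symm.subset (Set.mem_univ g)
  have hlev : ∀ (g : G) (x : V), lev (g • x) = lev x := fun _ _ => rfl
  have hupl : ∀ x, lev (up x) = lev x + 1 := fun _ => rfl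
  obtain ⟨x, hx⟩ := hG V (parentGraph lev up hupl)
    (parentGraph_isTree lev up _ fun x y => by
      obtain ⟨n, g, rfl⟩ := hmk x
      obtain ⟨m, h, rfl⟩ := hmk y
      obtain ⟨k, hk⟩ := hex (g⁻¹ * h)
      refine ⟨m + k, n + k, ?_⟩
      rw [hiter, hiter, show n + (m + k) = m + (n + k) by omega]
      exact hmkeq _ _ _ (hK (by omega) hk))
    (fun g x y h => by
      rcases h with h | h
      · exact Or.inl (by rw [hsup, h])
      · exact Or.inr (by rw [hsup, h]))
    (fun g x y h hxy => by
      have h1 := hlev g x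
      rw [hxy.1] at h1
      rcases h with h | h
      · have := hupl x
        rw [h] at this
        omega
      · have := hupl y
        rw [h] at this
        omega)
  obtain ⟨n, g, rfl⟩ := hmk x
  refine hne n (eq_top_iff.mpr fun k _ => ?_)
  have h1 := hx (g * k * g⁻¹)
  rw [hsmul] at h1
  have h2 : (⟨n, (g * k * g⁻¹ * g : G)⟩ : W) = ⟨n, (g : G ⧸ K n)⟩ := ULift.up_injective h1
  have h3 : ((g * k * g⁻¹ * g : G) : G ⧸ K n) = (g : G ⧸ K n) := by simpa using h2
  have h4 := QuotientGroup.eq.mp h3.symm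
  simpa [mul_assoc] using h4

end ParentGraph

/-! ### Commensurated subgroups and commensurate normal subgroups -/

section Commensurated

variable {G : Type u} [Group G]

theorem relIndex_le_mul {H K L : Subgroup G} (hHK : H.relIndex K ≠ 0) (hKL : K.relIndex L ≠ 0) :
    H.relIndex L ≤ H.relIndex K * K.relIndex L := by
  have h1 : (H ⊓ K).relIndex L = H.relIndex (K ⊓ L) * K.relIndex L :=
    (Subgroup.relIndex_inf_mul_relIndex H K L).symm
  have h2 : H.relIndex (K ⊓ L) ≤ H.relIndex K := Subgroup.relIndex_le_of_le_right inf_le_left hHK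
  have h3 : H.relIndex (K ⊓ L) ≠ 0 := fun h =>
    hHK (Subgroup.relIndex_eq_zero_of_le_right inf_le_left h)
  calc H.relIndex L ≤ (H ⊓ K).relIndex L :=
        Subgroup.relIndex_le_of_le_left inf_le_left (by rw [h1]; exact mul_ne_zero h3 hKL)
    _ = H.relIndex (K ⊓ L) * K.relIndex L := h1
    _ ≤ _ := Nat.mul_le_mul_right _ h2

/-- The cosets of `H ⊓ K` in `K` embed into those of `H ⊓ L` in `L`. Finiteness and equality of the
counts make this onto, so every coset of `H` that meets `L` meets `K`. -/
theorem mem_mul_of_relIndex_eq {H K L : Subgroup G} (hKL : K ≤ L) (h : H.relIndex L ≠ 0)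
    (heq : H.relIndex L ≤ H.relIndex K) {x : G} (hx : x ∈ L) :
    x ∈ (K : Set G) * (H : Set G) := by
  let f := Subgroup.quotientSubgroupOfEmbeddingOfLE H hKL
  have : Finite (L ⧸ H.subgroupOf L) := Nat.finite_of_card_ne_zero h
  have hsurj : Function.Surjective f := by
    have hbij := (Nat.bijective_iff_injective_and_card f).mpr
      ⟨f.injective, le_antisymm (Nat.card_le_card_of_injective f f.injective) heq⟩
    exact hbij.2
  obtain ⟨y, hy⟩ := hsurj (QuotientGroup.mk ⟨x, hx⟩)
  obtain ⟨k, rfl⟩ := QuotientGroup.mk_surjective y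
  have h1 : (QuotientGroup.mk (Subgroup.inclusion hKL k) : L ⧸ H.subgroupOf L) =
    QuotientGroup.mk ⟨x, hx⟩ := hy
  have h2 := QuotientGroup.eq.mp h1
  rw [Subgroup.mem_subgroupOf] at h2
  exact ⟨k, k.2, (k : G)⁻¹ * x, by simpa using h2, by group⟩

/-- An element of the normal closure is a product of elements of finitely many conjugates of `K`. A
conjugate that contains `K'` and lies in `K' * H'` preserves `K' * H'` under left multiplication,
because there it can be absorbed into `K'` and `H'` again. -/
theorem exists_absorb_of_mem_normalClosure (K : Subgroup G) {x : G}
    (hx : x ∈ Subgroup.normalClosure (K : Set G)) : ∃ S : Finset G, ∀ K' H' : Subgroup G,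
      (∀ t ∈ S, K' ≤ ConjAct.toConjAct t • K) →
      (∀ t ∈ S, ((ConjAct.toConjAct t • K : Subgroup G) : Set G) ⊆ (K' : Set G) * (H' : Set G)) →
      ∀ y ∈ (K' : Set G) * (H' : Set G),
        x * y ∈ (K' : Set G) * (H' : Set G) ∧ x⁻¹ * y ∈ (K' : Set G) * (H' : Set G) := by
  classical
  induction hx using Subgroup.closure_induction with
  | mem x hx =>
    obtain ⟨k, hk, hc⟩ := Group.mem_conjugatesOfSet_iff.mp hx
    obtain ⟨t, rfl⟩ := isConj_iff.mp hc
    have hmem : t * k * t⁻¹ ∈ ConjAct.toConjAct t • K := by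
      rw [← ConjAct.toConjAct_smul]
      exact Subgroup.smul_mem_pointwise_smul _ _ _ hk
    refine ⟨{t}, fun K' H' h1 h2 => ?_⟩
    have key : ∀ z ∈ ConjAct.toConjAct t • K, ∀ y ∈ (K' : Set G) * (H' : Set G),
        z * y ∈ (K' : Set G) * (H' : Set G) := by
      rintro z hz _ ⟨a, ha, b, hb, rfl⟩
      obtain ⟨a', ha', b', hb', hab⟩ := h2 t (by simp) (mul_mem hz (h1 t (by simp) ha))
      refine ⟨a', ha', b' * b, mul_mem hb' hb, ?_⟩
      simp only at hab ⊢
      rw [← mul_assoc, hab, mul_assoc]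
    exact fun y hy => ⟨key _ hmem y hy, key _ (inv_mem hmem) y hy⟩
  | one => exact ⟨∅, fun K' H' _ _ y hy => by simpa using hy⟩
  | mul a b _ _ iha ihb =>
    obtain ⟨S, hS⟩ := iha
    obtain ⟨S', hS'⟩ := ihb
    refine ⟨S ∪ S', fun K' H' h1 h2 y hy => ?_⟩
    have ha := hS K' H' (fun t ht => h1 t (Finset.mem_union_left _ ht))
      (fun t ht => h2 t (Finset.mem_union_left _ ht))
    have hb := hS' K' H' (fun t ht => h1 t (Finset.mem_union_right _ ht))
      (fun t ht => h2 t (Finset.mem_union_right _ ht))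
    constructor
    · rw [mul_assoc]
      exact (ha _ (hb y hy).1).1
    · rw [mul_inv_rev, mul_assoc]
      exact (hb _ (ha y hy).2).2
  | inv a _ ih =>
    obtain ⟨S, hS⟩ := ih
    exact ⟨S, fun K' H' h1 h2 y hy => by simpa using (hS K' H' h1 h2 y hy).symm⟩

/-- A subgroup uniformly commensurate with its conjugates is commensurate with a normal
subgroup. -/
theorem exists_normal_commensurable (C : Subgroup G) (n : ℕ)
    (h0 : ∀ g h : G, (ConjAct.toConjAct g • C).relIndex (ConjAct.toConjAct h • C) ≠ 0)
    (hn : ∀ g h : G, (ConjAct.toConjAct g • C).relIndex (ConjAct.toConjAct h • C) ≤ n) :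
    ∃ N : Subgroup G, N.Normal ∧ Subgroup.Commensurable N C := by
  classical
  set F : G → Subgroup G := fun g => ConjAct.toConjAct g • C with hF
  let I : Finset G → Subgroup G := fun s => ⨅ g : s, F g
  have hIle : ∀ s : Finset G, ∀ g ∈ s, I s ≤ F g := fun s g hg =>
    iInf_le (fun g : s => F g) ⟨g, hg⟩
  have hIconj : ∀ (t : G) (s : Finset G) (L : Subgroup G),
      (∀ g ∈ s, L ≤ F (t * g)) → L ≤ ConjAct.toConjAct t • I s := by
    intro t s L h x hx
    rw [Subgroup.mem_pointwise_smul_iff_inv_smul_mem, Subgroup.mem_iInf]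
    rintro ⟨g, hg⟩
    have := h g hg hx
    simp only [hF, map_mul, mul_smul] at this
    rwa [Subgroup.mem_pointwise_smul_iff_inv_smul_mem] at this
  have hne : ∀ (s : Finset G) (g : G), s.Nonempty → (F g).relIndex (I s) ≠ 0 := by
    rintro s g ⟨g0, hg0⟩ h
    exact h0 g g0 (Subgroup.relIndex_eq_zero_of_le_right (hIle s g0 hg0) h)
  -- Among finite intersections of conjugates, take one, `K`, for which the bound `m` on its index
  -- over all `F g` is least. By minimality every finite intersection, in particular a smaller one,
  -- still reaches `m` for some `g`.
  let P : ℕ → Prop := fun m => ∃ s : Finset G, s.Nonempty ∧ ∀ g, (F g).relIndex (I s) ≤ m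
  have hP : ∃ m, P m := ⟨n, {1}, by simp, fun g =>
    (Subgroup.relIndex_le_of_le_right (hIle {1} 1 (by simp)) (h0 g 1)).trans (hn g 1)⟩
  set m := Nat.find hP with hm
  obtain ⟨s, ⟨g0, hg0⟩, hs⟩ := Nat.find_spec hP
  have hmax : ∀ s' : Finset G, s'.Nonempty → ∃ g, m ≤ (F g).relIndex (I s') := by
    intro s' hs'
    by_contra! hlt
    have h1 := hlt 1
    have h2 := hne s' 1 hs'
    exact Nat.find_min hP (m := m - 1) (by omega) ⟨s', hs', fun g => by have := hlt g; omega⟩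
  set K := I s with hK
  have hKF : ∀ g, K.relIndex (F g) ≠ 0 ∧ K.relIndex (F g) ≤ n ^ s.card := fun g => by
    refine ⟨Subgroup.relIndex_iInf_ne_zero fun i => h0 _ _, ?_⟩
    refine (Subgroup.relIndex_iInf_le _).trans ?_
    refine (Finset.prod_le_pow_card _ _ n fun i _ => hn _ _).trans_eq ?_
    simp
  have hconj : ∀ t g : G, (F g).relIndex (ConjAct.toConjAct t • K) = (F (t⁻¹ * g)).relIndex K := by
    intro t g
    rw [← Subgroup.relIndex_pointwise_smul (ConjAct.toConjAct t) (F (t⁻¹ * g)) K]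
    congr 1
    simp only [hF, ← mul_smul, ← map_mul, mul_inv_cancel_left]
  let N := Subgroup.normalClosure (K : Set G)
  have hKN : K ≤ N := Subgroup.subset_normalClosure
  have hfin : Finite (N ⧸ K.subgroupOf N) := by
    by_contra hinf
    rw [not_finite_iff_infinite] at hinf
    -- More representatives than `m` cosets of some `F g` can hold when each coset contributes at
    -- most `n ^ s.card` classes modulo `K`.
    obtain ⟨Q, hQ⟩ := Infinite.exists_subset_card_eq (N ⧸ K.subgroupOf N) (m * n ^ s.card + 1)
    let r : N ⧸ K.subgroupOf N → G := fun q => (Quotient.out q : N)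
    choose S hS using fun q : N ⧸ K.subgroupOf N =>
      exists_absorb_of_mem_normalClosure K (Quotient.out q : N).2
    -- Intersecting over `T * s` amounts to intersecting the conjugates of `K` by `T`. For `g`
    -- attaining `m` on `K'`, each such conjugate lies in `K' * F g`, so all the representatives do.
    let T : Finset G := insert 1 (Q.biUnion S)
    let K' := I (T * s)
    obtain ⟨g, hg⟩ := hmax (T * s) ⟨1 * g0, Finset.mul_mem_mul (by simp [T]) hg0⟩
    have hK'le : ∀ t ∈ T, K' ≤ ConjAct.toConjAct t • K := fun t ht =>
      hIconj t s K' fun u hu => hIle _ _ (Finset.mul_mem_mul ht hu)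
    have hsub : ∀ t ∈ T, ((ConjAct.toConjAct t • K : Subgroup G) : Set G) ⊆
        (K' : Set G) * (F g : Set G) := fun t ht x hx =>
      mem_mul_of_relIndex_eq (hK'le t ht) (by rw [hconj]; exact hne s _ ⟨g0, hg0⟩)
        (by rw [hconj]; exact (hs _).trans hg) hx
    have hmem : ∀ q ∈ Q, r q ∈ (K' : Set G) * (F g : Set G) := fun q hq => by
      have := (hS q K' (F g)
        (fun t ht => hK'le t (Finset.mem_insert_of_mem (Finset.mem_biUnion.mpr ⟨q, hq, ht⟩)))
        (fun t ht => hsub t (Finset.mem_insert_of_mem (Finset.mem_biUnion.mpr ⟨q, hq, ht⟩)))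
        1 ⟨1, one_mem _, 1, one_mem _, by simp⟩).1
      simpa using this
    have hfinK' : Finite (K' ⧸ (F g).subgroupOf K') :=
      Nat.finite_of_card_ne_zero (hne (T * s) g ⟨1 * g0, Finset.mul_mem_mul (by simp [T]) hg0⟩)
    let j : K' ⧸ (F g).subgroupOf K' → G ⧸ F g :=
      Quotient.map' Subtype.val fun a b h => by
        rw [QuotientGroup.leftRel_apply] at h ⊢
        exact h
    have := Fintype.ofFinite (K' ⧸ (F g).subgroupOf K')
    let J : Finset (G ⧸ F g) := Finset.univ.image j
    have hJ : J.card ≤ m := by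
      refine Finset.card_image_le.trans ?_
      rw [Finset.card_univ, ← Nat.card_eq_fintype_card]
      change (F g).relIndex K' ≤ m
      have h1 : K' ≤ ConjAct.toConjAct (1 : G) • K := hK'le 1 (by simp [T])
      rw [map_one, one_smul] at h1
      exact (Subgroup.relIndex_le_of_le_right h1 (hne s g ⟨g0, hg0⟩)).trans (hs g)
    obtain ⟨c, -, hc⟩ := Finset.exists_lt_card_fiber_of_mul_lt_card_of_maps_to
      (s := Q) (t := J) (f := fun q => (r q : G ⧸ F g)) (n := n ^ s.card)
      (fun q hq => by
        obtain ⟨k, hk, h, hh, hkh⟩ := hmem q hq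
        refine Finset.mem_image.mpr ⟨QuotientGroup.mk ⟨k, hk⟩, Finset.mem_univ _, ?_⟩
        change (k : G ⧸ F g) = (r q : G ⧸ F g)
        rw [QuotientGroup.eq, ← hkh]
        simpa using hh)
      (by
        rw [hQ]
        exact Nat.lt_succ_of_le (Nat.mul_le_mul_right _ hJ))
    obtain ⟨q0, hq0⟩ := Finset.card_pos.mp ((Nat.zero_le _).trans_lt hc)
    rw [Finset.mem_filter] at hq0
    set Q' := Q.filter fun q => (r q : G ⧸ F g) = c with hQ'
    have hmemF : ∀ q : Q', (r q0)⁻¹ * r q ∈ F g := fun q => by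
      have := (Finset.mem_filter.mp q.2).2
      rw [← hq0.2] at this
      exact QuotientGroup.eq.mp this.symm
    let φ : Q' → (F g) ⧸ K.subgroupOf (F g) := fun q => QuotientGroup.mk ⟨_, hmemF q⟩
    have hφ : Function.Injective φ := by
      intro q q' h
      have h1 := QuotientGroup.eq.mp h
      rw [Subgroup.mem_subgroupOf] at h1
      have h2 : (r q)⁻¹ * r q' ∈ K := by simpa [mul_assoc] using h1
      have h3 : (q : N ⧸ K.subgroupOf N) = q' := by
        rw [← QuotientGroup.out_eq' (q : N ⧸ K.subgroupOf N),
          ← QuotientGroup.out_eq' (q' : N ⧸ K.subgroupOf N), QuotientGroup.eq,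
          Subgroup.mem_subgroupOf]
        exact h2
      exact Subtype.ext h3
    have : Finite ((F g) ⧸ K.subgroupOf (F g)) := Nat.finite_of_card_ne_zero (hKF g).1
    have h5 := Nat.card_le_card_of_injective φ hφ
    have h6 : Nat.card ((F g) ⧸ K.subgroupOf (F g)) ≤ n ^ s.card := (hKF g).2
    rw [Nat.card_eq_fintype_card, Fintype.card_coe] at h5
    omega
  have hCF : F 1 = C := by simp [hF]
  refine ⟨N, Subgroup.normalClosure_normal, ?_⟩
  have hKC : Subgroup.Commensurable K C := by
    refine ⟨?_, ?_⟩
    · have := (hKF 1).1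
      rwa [hCF] at this
    · have := hne s 1 ⟨g0, hg0⟩
      rwa [hCF] at this
  have hNK : Subgroup.Commensurable N K := by
    refine ⟨?_, Nat.card_ne_zero.mpr ⟨⟨QuotientGroup.mk 1⟩, hfin⟩⟩
    rw [Subgroup.relIndex_eq_one.mpr hKN]
    exact one_ne_zero
  exact hNK.trans hKC

/-- The product of the two relative indices of `C` and its conjugate by `g` is submultiplicative and
symmetric in `g`. Its logarithm is thus a length, and a bound for it makes the commensurability
uniform. -/
theorem BoundedLengths.exists_normal_commensurable (hG : BoundedLengths G) (C : Subgroup G)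
    (hC : IsCommensurated C) : ∃ N : Subgroup G, N.Normal ∧ Subgroup.Commensurable N C := by
  set F : G → Subgroup G := fun g => ConjAct.toConjAct g • C with hF
  have h1 : ∀ g, Subgroup.Commensurable (F g) C := fun g =>
    (Subgroup.Commensurable.commensurator_mem_iff C g).mp (hC ▸ Subgroup.mem_top g)
  have hsmul : ∀ g h k, (F (g * h)).relIndex (F (g * k)) = (F h).relIndex (F k) := fun g h k => by
    rw [← Subgroup.relIndex_pointwise_smul (ConjAct.toConjAct g) (F h)]
    simp only [hF, ← mul_smul, ← map_mul]
  have h0 : ∀ g h, (F g).relIndex (F h) ≠ 0 := fun g h => ((h1 g).trans (h1 h).symm).1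
  let q : G → ℕ := fun g => (F 1).relIndex (F g) * (F g).relIndex (F 1)
  have hq : ∀ g, 0 < q g := fun g => Nat.pos_of_ne_zero (mul_ne_zero (h0 _ _) (h0 _ _))
  obtain ⟨c, hc⟩ := hG (fun g => Real.log (q g))
    (fun g h => by
      rw [← Real.log_mul (by exact_mod_cast (hq g).ne') (by exact_mod_cast (hq h).ne')]
      refine Real.log_le_log (by exact_mod_cast hq _) ?_
      have e1 : (F 1).relIndex (F (g * h)) ≤ (F 1).relIndex (F g) * (F 1).relIndex (F h) := by
        have := relIndex_le_mul (h0 1 g) (h0 g (g * h))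
        have h2 := hsmul g 1 h
        rw [mul_one] at h2
        rwa [h2] at this
      have e2 : (F (g * h)).relIndex (F 1) ≤ (F h).relIndex (F 1) * (F g).relIndex (F 1) := by
        have := relIndex_le_mul (h0 (g * h) g) (h0 g 1)
        have h2 := hsmul g h 1
        rw [mul_one] at h2
        rwa [h2] at this
      have e3 : q (g * h) ≤ q g * q h :=
        (Nat.mul_le_mul e1 e2).trans_eq (by simp only [q]; ring)
      exact_mod_cast e3)
    (fun g => by
      have e1 := hsmul g 1 g⁻¹
      have e2 := hsmul g g⁻¹ 1
      rw [mul_inv_cancel, mul_one] at e1 e2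
      simp only [q, ← e1, ← e2]
      rw [mul_comm])
  refine ProfiniteBranch.exists_normal_commensurable C ⌈Real.exp c⌉₊ h0 fun g h => ?_
  have e1 : (F g).relIndex (F h) = (F 1).relIndex (F (g⁻¹ * h)) := by
    have := hsmul g⁻¹ g h
    rw [inv_mul_cancel] at this
    exact this.symm
  have e2 : (F 1).relIndex (F (g⁻¹ * h)) ≤ q (g⁻¹ * h) :=
    Nat.le_mul_of_pos_right _ (Nat.pos_of_ne_zero (h0 _ _))
  have e3 : (q (g⁻¹ * h) : ℝ) ≤ Real.exp c := by
    rw [← Real.exp_log (show (0 : ℝ) < q (g⁻¹ * h) by exact_mod_cast hq _)]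
    exact Real.exp_le_exp.mpr (hc _)
  have e4 : q (g⁻¹ * h) ≤ ⌈Real.exp c⌉₊ := by exact_mod_cast e3.trans (Nat.le_ceil _)
  exact e1.le.trans (e2.trans e4)

end Commensurated

/-! ### Quotients of infinite abelian groups -/

section InfiniteAbelian

/-- Every infinite abelian group has a countably infinite quotient. -/
theorem exists_countable_infinite_quotient (A : Type u) [AddCommGroup A] [Infinite A] :
    ∃ N : AddSubgroup A, Countable (A ⧸ N) ∧ Infinite (A ⧸ N) := by
  classical
  obtain ⟨f, hf⟩ := Infinite.natEmbedding A
  -- A countably infinite subgroup `B` is embedded in a countable divisible group `D`, a quotient of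
  -- the rational vector space on `B`. Divisible groups are injective, so the embedding extends to
  -- `A`; the image is countable and contains a copy of `B`.
  let B : Submodule ℤ A := LinearMap.range (Finsupp.linearCombination ℤ f)
  have hBc : Countable B := (Set.countable_range (Finsupp.linearCombination ℤ f)).to_subtype
  have hBi : Infinite B := Infinite.of_injective
    (fun n => (⟨f n, Finsupp.single n 1, by simp⟩ : B))
    fun m n h => hf (congrArg Subtype.val h)
  let ev : (B →₀ ℤ) →ₗ[ℤ] B := Finsupp.linearCombination ℤ id
  let ι : (B →₀ ℤ) →ₗ[ℤ] (B →₀ ℚ) :=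
    Finsupp.mapRange.linearMap (Int.castAddHom ℚ).toIntLinearMap
  have hι : Function.Injective ι :=
    Finsupp.mapRange_injective _ (by simp) Int.cast_injective
  let R : AddSubgroup (B →₀ ℚ) := (LinearMap.ker ev).toAddSubgroup.map ι.toAddMonoidHom
  let _ : DivisibleBy (B →₀ ℚ) ℕ :=
    { div := fun x n => (n : ℚ)⁻¹ • x
      div_zero := fun x => by simp
      div_cancel := fun {n} x hn => by
        rw [← Nat.cast_smul_eq_nsmul ℚ n, smul_smul, mul_inv_cancel₀ (by exact_mod_cast hn),
          one_smul] }
  let D := (B →₀ ℚ) ⧸ R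
  let _ : DivisibleBy D ℤ := AddGroup.divisibleByIntOfDivisibleByNat D
  have hD : Module.Baer ℤ D := Module.Baer.of_divisible D
  let s : B →+ D := AddMonoidHom.mk' (fun b => QuotientAddGroup.mk (Finsupp.single b (1 : ℚ)))
    fun a b => by
      rw [← QuotientAddGroup.mk_add]
      refine QuotientAddGroup.eq.mpr ⟨Finsupp.single a 1 + Finsupp.single b 1 -
        Finsupp.single (a + b) 1, ?_, ?_⟩
      · change ev _ = 0
        simp [ev]
      · change ι _ = _
        simp only [map_sub, map_add, ι, Finsupp.mapRange.linearMap_apply, Finsupp.mapRange_single]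
        simp
        abel
  have hs : Function.Injective s := by
    rw [injective_iff_map_eq_zero]
    intro b hb
    obtain ⟨k, hk, hkb⟩ := (QuotientAddGroup.eq_zero_iff _).mp
      (show (QuotientAddGroup.mk (Finsupp.single b (1 : ℚ)) : D) = 0 from hb)
    have h1 : k = Finsupp.single b 1 := hι (by
      change ι k = _ at hkb
      rw [hkb]
      simp [ι])
    have h2 : ev k = 0 := hk
    rw [h1] at h2
    simpa [ev] using h2
  obtain ⟨h, hh⟩ := Module.Baer.extension_property hD B.subtype B.subtype_injective
    s.toIntLinearMap
  have hh' : ∀ b : B, h b = s b := fun b => LinearMap.congr_fun hh b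
  have hDc : Countable D := Quotient.countable
  let e := QuotientAddGroup.kerLift h.toAddMonoidHom
  have he : Function.Injective e := QuotientAddGroup.kerLift_injective _
  refine ⟨h.toAddMonoidHom.ker, he.countable, ?_⟩
  refine Infinite.of_injective (fun b : B => (QuotientAddGroup.mk (b : A) :
    A ⧸ h.toAddMonoidHom.ker)) fun a b hab => hs ?_
  have := congrArg e hab
  rw [← hh', ← hh']
  exact this

/-- An element of infinite order is detected by a homomorphism to `ℚ`. -/
theorem exists_hom_rat_eq_one {A : Type u} [AddCommGroup A] (a : A)
    (ha : ∀ n : ℕ, 0 < n → n • a ≠ 0) : ∃ φ : A →+ ℚ, φ a = 1 := by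
  have hinj : Function.Injective (LinearMap.toSpanSingleton ℤ A a) := by
    rw [← LinearMap.ker_eq_bot, LinearMap.ker_eq_bot']
    intro m hm
    by_contra hne
    rw [LinearMap.toSpanSingleton_apply] at hm
    refine ha m.natAbs (Int.natAbs_pos.mpr hne) ?_
    rcases Int.natAbs_eq m with h | h
    · rw [h, natCast_zsmul] at hm
      exact hm
    · rw [h, neg_smul, natCast_zsmul, neg_eq_zero] at hm
      exact hm
  obtain ⟨h, hh⟩ := Module.Baer.extension_property (Module.Baer.of_divisible ℚ)
    (LinearMap.toSpanSingleton ℤ A a) hinj (Int.castAddHom ℚ).toIntLinearMap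
  refine ⟨h.toAddMonoidHom, ?_⟩
  have := LinearMap.congr_fun hh 1
  simpa using this

end InfiniteAbelian

/-! ### Obstructions carried by a finite index subgroup -/

section FiniteIndexNormal

variable {Γ : Type u} [Group Γ] (A : Subgroup Γ) [hAf : A.FiniteIndex]

theorem finite_range_out : (Set.range (Quotient.out : Γ ⧸ A → Γ)).Finite := by
  have : Finite (Γ ⧸ A) := Subgroup.finite_quotient_of_finiteIndex
  exact Set.finite_range _

/-- With a finite transversal `T` of `A`, the subgroups generated by `T` and `K n` exhaust `Γ`. If
one of them is `Γ`, then `Γ ⧸ K n` is finitely generated, hence so is the image of `A`; so some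
later `K M` is all of `A`. -/
theorem not_uncountableCofinality_of_chain (K : ℕ → Subgroup Γ) (hmono : Monotone K)
    (hnorm : ∀ n, (K n).Normal) (hne : ∀ n, K n ≠ A) (hle : ∀ n, K n ≤ A)
    (hunion : ∀ a ∈ A, ∃ n, a ∈ K n) : ¬ UncountableCofinality Γ := by
  classical
  intro hUC
  set T : Set Γ := Set.range (Quotient.out : Γ ⧸ A → Γ) with hT
  have hTfin : T.Finite := finite_range_out A
  have hex : ∃ n, Subgroup.closure T ⊔ K n = ⊤ := by
    by_contra! hcon
    refine hUC ⟨fun n => Subgroup.closure T ⊔ K n,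
      fun m n hmn => sup_le_sup_left (hmono hmn) _, hcon, Set.eq_univ_of_forall fun g => ?_⟩
    obtain ⟨a, ha⟩ := QuotientGroup.mk_out_eq_mul A g
    obtain ⟨n, hn⟩ := hunion a a.2
    have h1 : g = (Quotient.out (g : Γ ⧸ A)) * (a : Γ)⁻¹ := by rw [ha]; group
    refine Set.mem_iUnion.mpr ⟨n, ?_⟩
    rw [h1]
    exact Subgroup.mul_mem_sup (Subgroup.subset_closure ⟨_, rfl⟩) (inv_mem hn)
  obtain ⟨n, hn⟩ := hex
  have := hnorm n
  let π := QuotientGroup.mk' (K n)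
  have hπ : Function.Surjective π := QuotientGroup.mk'_surjective _
  have hfg : Group.FG (Γ ⧸ K n) := by
    rw [Group.fg_iff]
    refine ⟨π '' T, ?_, hTfin.image _⟩
    rw [← MonoidHom.map_closure]
    have h1 := congrArg (Subgroup.map π) hn
    rw [Subgroup.map_sup, Subgroup.map_top_of_surjective _ hπ] at h1
    have h2 : (K n).map π = ⊥ := by
      rw [Subgroup.map_eq_bot_iff]
      simp [π]
    rwa [h2, sup_bot_eq] at h1
  have hidx : (A.map π).FiniteIndex := ⟨fun h => hAf.index_ne_zero (by
    have := Subgroup.index_map_dvd A hπ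
    rw [h] at this
    exact Nat.eq_zero_of_zero_dvd this)⟩
  have hAfg : Group.FG (A.map π) := Subgroup.fg_of_index_ne_zero _
  rw [Group.fg_iff_subgroup_fg] at hAfg
  obtain ⟨S, hS⟩ := hAfg
  have hlift : ∀ s ∈ S, ∃ m, s ∈ (K m).map π := fun s hs => by
    have : s ∈ A.map π := hS ▸ Subgroup.subset_closure hs
    obtain ⟨a, ha, rfl⟩ := this
    obtain ⟨m, hm⟩ := hunion a ha
    exact ⟨m, a, hm, rfl⟩
  choose! m hm using hlift
  let M := S.sup m ⊔ n
  refine hne M (le_antisymm (hle M) fun a ha => ?_)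
  have h1 : A.map π ≤ (K M).map π := by
    rw [← hS, Subgroup.closure_le]
    intro s hs
    exact Subgroup.map_mono (hmono ((Finset.le_sup hs).trans le_sup_left)) (hm s hs)
  obtain ⟨k, hk, hka⟩ := h1 ⟨a, ha, rfl⟩
  have h2 : k⁻¹ * a ∈ K n := QuotientGroup.eq.mp hka
  have h3 : k⁻¹ * a ∈ K M := hmono le_sup_right h2
  simpa using mul_mem hk h3

/-- Writing `g = t g * r g` with `t g` in a finite transversal, `L (r g)` extends `L` up to bounded
error and is subadditive up to a constant. It is bounded on each power of the generating set formed
by the unit ball and the transversal, but unbounded on `A`. -/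
theorem not_cayleyBounded_of_length [hAn : A.Normal] (L : Γ → ℝ) (hmul : ∀ a ∈ A, ∀ b ∈ A, L (a * b) ≤ L a + L b)
    (hinv : ∀ a ∈ A, L a⁻¹ = L a) (hconj : ∀ g, ∀ a ∈ A, L (g * a * g⁻¹) = L a)
    (hgen : ∀ a ∈ A, a ∈ Subgroup.closure {a | a ∈ A ∧ L a ≤ 1}) (hunb : ∀ c, ∃ a ∈ A, c < L a) :
    ¬ CayleyBounded Γ := by
  classical
  intro hCB
  have : Finite (Γ ⧸ A) := Subgroup.finite_quotient_of_finiteIndex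
  let t : Γ → Γ := fun g => Quotient.out (g : Γ ⧸ A)
  let r : Γ → Γ := fun g => (t g)⁻¹ * g
  have hr : ∀ g, r g ∈ A := fun g => QuotientGroup.eq.mp (QuotientGroup.out_eq' (g : Γ ⧸ A))
  have htr : ∀ g, t g * r g = g := fun g => by simp [r]
  have ht : ∀ g h : Γ, g⁻¹ * h ∈ A → t g = t h := fun g h hgh => by
    simp only [t, QuotientGroup.eq.mpr hgh]
  set T : Set Γ := Set.range (Quotient.out : Γ ⧸ A → Γ) with hT
  have hTfin : T.Finite := finite_range_out A
  have htT : ∀ g, t g ∈ T := fun g => ⟨_, rfl⟩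
  let ℓ : Γ → ℝ := fun g => L (r g)
  obtain ⟨c₀, hc₀⟩ : ∃ c₀, ∀ x ∈ T, ∀ y ∈ T, L (r (x * y)) ≤ c₀ := by
    obtain ⟨c, hc⟩ := ((hTfin.mul hTfin).image fun x => L (r x)).bddAbove
    exact ⟨c, fun x hx y hy => hc ⟨x * y, Set.mul_mem_mul hx hy, rfl⟩⟩
  have hℓmul : ∀ g h, ℓ (g * h) ≤ c₀ + ℓ g + ℓ h := by
    intro g h
    have e1 : r (g * h) = r (t g * t h) * ((t h)⁻¹ * r g * (t h)⁻¹⁻¹) * r h := by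
      have e2 : t (g * h) = t (t g * t h) := by
        apply ht
        have h1 := hr g
        have h2 := hr h
        have e3 : (g * h)⁻¹ * (t g * t h) = (r h)⁻¹ * ((t h)⁻¹ * (r g)⁻¹ * (t h)⁻¹⁻¹) := by
          simp only [r]; group
        rw [e3]
        exact mul_mem (inv_mem h2) (hAn.conj_mem _ (inv_mem h1) _)
      simp only [r, e2]
      group
    have h1 := hAn.conj_mem _ (hr g) (t h)⁻¹
    calc ℓ (g * h) = L (r (t g * t h) * ((t h)⁻¹ * r g * (t h)⁻¹⁻¹) * r h) := by
          simp only [ℓ, e1]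
      _ ≤ L (r (t g * t h)) + L ((t h)⁻¹ * r g * (t h)⁻¹⁻¹) + L (r h) :=
          (hmul _ (mul_mem (hr _) h1) _ (hr _)).trans
            (add_le_add_left (hmul _ (hr _) _ h1) _)
      _ ≤ c₀ + ℓ g + ℓ h := by
          rw [hconj _ _ (hr g)]
          have := hc₀ _ (htT g) _ (htT h)
          simp only [ℓ]
          linarith
  let U : Set Γ := {a | a ∈ A ∧ L a ≤ 1} ∪ (T ∪ T⁻¹ ∪ {1})
  have hUinv : U⁻¹ = U := by
    ext g
    simp only [U, Set.mem_inv, Set.mem_union, Set.mem_ofPred_eq, inv_inv, Set.mem_singleton_iff,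
      inv_eq_one, inv_mem_iff]
    constructor
    · rintro (⟨h1, h2⟩ | (h | h) | h)
      · exact Or.inl ⟨h1, by rwa [hinv _ h1] at h2⟩
      · tauto
      · tauto
      · tauto
    · rintro (⟨h1, h2⟩ | (h | h) | h)
      · exact Or.inl ⟨h1, by rwa [hinv _ h1]⟩
      · tauto
      · tauto
      · tauto
  obtain ⟨n, hn, hU⟩ := hCB U hUinv (by simp [U]) (by
    refine eq_top_iff.mpr fun g _ => ?_
    rw [← htr g]
    refine mul_mem (Subgroup.subset_closure ?_)
      (Subgroup.closure_mono Set.subset_union_left (hgen _ (hr g)))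
    exact Or.inr (Or.inl (Or.inl (htT g))))
  obtain ⟨c₁, hc₁⟩ : ∃ c₁, ∀ g ∈ U, ℓ g ≤ c₁ := by
    obtain ⟨c, hc⟩ := (((hTfin.union hTfin.inv).union (Set.finite_singleton (1 : Γ))).image
      ℓ).bddAbove
    obtain ⟨d, hd⟩ := (hTfin.image fun x => L (r x)).bddAbove
    -- The representative `t 1` of `A` itself need not be `1`, which costs `L (t 1)` on elements of
    -- `A`.
    refine ⟨max c (L (t 1) + 1 + 0), ?_⟩
    rintro g (⟨h1, h2⟩ | h)
    · refine le_max_of_le_right ?_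
      have e1 : t g = t 1 := ht _ _ (by simpa using h1)
      have e2 : t 1 ∈ A := by
        have := hr 1
        simp only [r, mul_one] at this
        exact inv_mem_iff.mp this
      have : ℓ g ≤ L (t 1)⁻¹ + L g := by
        simp only [ℓ, r, e1]
        exact hmul _ (inv_mem e2) _ h1
      rw [hinv _ e2] at this
      linarith
    · exact le_max_of_le_left (hc ⟨g, h, rfl⟩)
  have hpow : ∀ k : ℕ, ∃ c, ∀ g ∈ U ^ k, ℓ g ≤ c := by
    intro k
    induction k with
    | zero => exact ⟨ℓ 1, fun g hg => by rw [show g = 1 by simpa using hg]⟩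
    | succ k ih =>
      obtain ⟨c, hc⟩ := ih
      refine ⟨c₀ + c + c₁, fun g hg => ?_⟩
      obtain ⟨a, ha, b, hb, rfl⟩ := Set.mem_mul.mp (pow_succ U k ▸ hg)
      linarith [hℓmul a b, hc a ha, hc₁ b hb]
  obtain ⟨c, hc⟩ := hpow n
  obtain ⟨a, ha, hca⟩ := hunb (L (t 1) + c)
  have e1 : t a = t 1 := ht _ _ (by simpa using ha)
  have e2 : t 1 ∈ A := by
    have := hr 1
    simp only [r, mul_one] at this
    exact inv_mem_iff.mp this
  have h1 : L a ≤ L (t 1) + ℓ a := by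
    conv_lhs => rw [← htr a]
    rw [e1]
    exact hmul _ e2 _ (hr a)
  linarith [hc a (hU ▸ Set.mem_univ a)]

end FiniteIndexNormal

/-! ### Independent layers in virtually abelian groups of bounded exponent -/

section VirtuallyAbelian

variable {Γ : Type u} [Group Γ] (A : Subgroup Γ)

/-- An independent sequence of finite index subgroups of `A`, normal in `Γ`, such that every
element of `A` belongs to all but finitely many of them. -/
structure IndependentLayers (K : ℕ → Subgroup Γ) : Prop where
  normal : ∀ i, (K i).Normal
  lt : ∀ i, K i < A
  eventually_mem : ∀ a ∈ A, ∃ m, ∀ i, m ≤ i → a ∈ K i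
  independent : ∀ m, ∀ a ∈ A, ∃ y ∈ A, (∀ j, j ≠ m → y ∈ K j) ∧ y⁻¹ * a ∈ K m

theorem IndependentLayers.exists_mem {A : Subgroup Γ} {K : ℕ → Subgroup Γ} (hK : IndependentLayers A K) (m : ℕ) :
    ∃ y ∈ A, y ∉ K m ∧ ∀ j, j ≠ m → y ∈ K j := by
  obtain ⟨a, ha, haK⟩ := SetLike.exists_of_lt (hK.lt m)
  obtain ⟨y, hy, hyj, hya⟩ := hK.independent m a ha
  exact ⟨y, hy, fun h => haK (by simpa using mul_mem h hya), hyj⟩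

variable [hAf : A.FiniteIndex]

/-- An element of the abelian group `A` has only finitely many conjugates in `Γ`, one per coset of
`A` at most, and a finitely generated abelian torsion group is finite. -/
theorem exists_finite_normal_of_exponent [hAn : A.Normal]
    (hcomm : ∀ a ∈ A, ∀ b ∈ A, a * b = b * a) {n : ℕ} (hn : 0 < n) (hexp : ∀ a ∈ A, a ^ n = 1) {F : Set Γ} (hF : F.Finite) (hFA : F ⊆ A) :
    ∃ Y : Subgroup Γ, Y.Normal ∧ Y ≤ A ∧ Finite Y ∧ F ⊆ Y := by
  refine ⟨Subgroup.normalClosure F, Subgroup.normalClosure_normal, Subgroup.normalClosure_le_normal hFA,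
    ?_, Subgroup.subset_normalClosure⟩
  have hle : Subgroup.normalClosure F ≤ A := Subgroup.normalClosure_le_normal hFA
  have hfin : (Group.conjugatesOfSet F).Finite := by
    refine ((finite_range_out A).image2 (fun t f => t * f * t⁻¹) hF).subset ?_
    intro x hx
    obtain ⟨f, hf, hc⟩ := Group.mem_conjugatesOfSet_iff.mp hx
    obtain ⟨g, rfl⟩ := isConj_iff.mp hc
    refine ⟨_, ⟨(g : Γ ⧸ A), rfl⟩, f, hf, ?_⟩
    obtain ⟨a, ha⟩ := QuotientGroup.mk_out_eq_mul A g
    have h1 : (a : Γ) * f * (a : Γ)⁻¹ = f := by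
      rw [hcomm _ a.2 _ (hFA hf), mul_inv_cancel_right]
    calc _ = g * (a * f * (a : Γ)⁻¹) * g⁻¹ := by simp only [ha]; group
      _ = _ := by rw [h1]
  let _ : CommGroup (Subgroup.normalClosure F) :=
    { (inferInstance : Group (Subgroup.normalClosure F)) with
      mul_comm := fun a b => Subtype.ext (hcomm _ (hle a.2) _ (hle b.2)) }
  have : Group.FG (Subgroup.normalClosure F) := by
    rw [Group.fg_iff_subgroup_fg, Subgroup.fg_iff]
    exact ⟨_, rfl, hfin⟩
  exact CommGroup.finite_of_fg_isMulTorsion _ fun x => isOfFinOrder_iff_pow_eq_one.mpr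
    ⟨n, hn, Subtype.ext (hexp _ (hle x.2))⟩

/-- A character of `A ⧸ Y` to ℚ/ℤ that is nontrivial at some `a ∉ Y` has finite image because of the
exponent. The normal core of its kernel still contains the normal subgroup `Y`. -/
theorem exists_finiteIndex_normal_of_exponent (hcomm : ∀ a ∈ A, ∀ b ∈ A, a * b = b * a) {n : ℕ}
    (hn : 0 < n) (hexp : ∀ a ∈ A, a ^ n = 1) (Y : Subgroup Γ) [hY : Y.Normal] (hYA : Y < A) :
    ∃ K : Subgroup Γ, K.Normal ∧ Y ≤ K ∧ K < A ∧ K.FiniteIndex := by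
  let _ : CommGroup A :=
    { (inferInstance : Group A) with
      mul_comm := fun a b => Subtype.ext (hcomm _ a.2 _ b.2) }
  obtain ⟨a, ha, haY⟩ := SetLike.exists_of_lt hYA
  have hne : (Additive.ofMul (QuotientGroup.mk ⟨a, ha⟩ : A ⧸ Y.subgroupOf A)) ≠ 0 := fun h =>
    haY ((QuotientGroup.eq_one_iff (N := Y.subgroupOf A) (⟨a, ha⟩ : A)).mp h)
  obtain ⟨χ, hχ⟩ := CharacterModule.exists_character_apply_ne_zero_of_ne_zero hne
  let ψ : A →* Multiplicative (AddCircle (1 : ℚ)) :=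
    (AddMonoidHom.toMultiplicativeRight
      (show Additive (A ⧸ Y.subgroupOf A) →+ AddCircle (1 : ℚ) from χ)).comp
      (QuotientGroup.mk' (Y.subgroupOf A))
  have hψa : ψ ⟨a, ha⟩ ≠ 1 := fun h => hχ h
  have hψY : ∀ y : A, (y : Γ) ∈ Y → ψ y = 1 := fun y hy => by
    have h1 : QuotientGroup.mk' (Y.subgroupOf A) y = 1 := (QuotientGroup.eq_one_iff y).mpr hy
    simp only [ψ, MonoidHom.comp_apply, h1, map_one]
  have hrange : Finite ψ.range := by
    refine Set.Finite.subset (s := Multiplicative.toAdd ⁻¹' {u : AddCircle (1 : ℚ) | n • u = 0})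
      ((AddCircle.finite_torsion 1 hn).preimage Multiplicative.toAdd.injective.injOn) ?_
    rintro _ ⟨x, rfl⟩
    have h1 : ψ x ^ n = 1 := by
      rw [← map_pow, show x ^ n = 1 from Subtype.ext (hexp _ x.2), map_one]
    exact h1
  have hfi : (ψ.ker.map A.subtype).FiniteIndex := ⟨by
    rw [Subgroup.index_map_subtype]
    exact mul_ne_zero (Subgroup.finiteIndex_ker ψ).index_ne_zero hAf.index_ne_zero⟩
  refine ⟨(ψ.ker.map A.subtype).normalCore, Subgroup.normalCore_normal _,
    Subgroup.normal_le_normalCore.mpr fun y hy => ⟨⟨y, hYA.le hy⟩, hψY _ hy, rfl⟩, ?_,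
    Subgroup.finiteIndex_normalCore _⟩
  refine lt_of_le_of_ne ((Subgroup.normalCore_le _).trans (Subgroup.map_subtype_le _)) fun h => ?_
  obtain ⟨b, hb, hba⟩ := Subgroup.normalCore_le _ (h.symm ▸ ha)
  have : b = ⟨a, ha⟩ := Subtype.ext hba
  exact hψa (this ▸ hb)

theorem exists_independentLayers [hAn : A.Normal]
    (hcomm : ∀ a ∈ A, ∀ b ∈ A, a * b = b * a) {n : ℕ} (hn : 0 < n) (hexp : ∀ a ∈ A, a ^ n = 1) (hc : Countable A) (hi : Infinite A) :
    ∃ K : ℕ → Subgroup Γ, IndependentLayers A K := by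
  classical
  obtain ⟨r, hr⟩ := exists_surjective_nat A
  -- A state is a pair `(Y, P)`: a finite normal subgroup `Y`, and the intersection `P` of the
  -- layers chosen so far. The next `Y` absorbs the next element of `A` and representatives of `A`
  -- modulo `P`; the next layer contains this new `Y`.
  let St := {p : Subgroup Γ × Subgroup Γ // (p.1.Normal ∧ p.1 ≤ A ∧ Finite p.1) ∧
    p.2.Normal ∧ p.2 ≤ A ∧ p.2.FiniteIndex}
  have step : ∀ (i : ℕ) (s : St), ∃ (s' : St) (K : Subgroup Γ), K.Normal ∧ K < A ∧ s'.1.1 ≤ K ∧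
      s.1.1 ≤ s'.1.1 ∧ (r i : Γ) ∈ s'.1.1 ∧ (∀ a ∈ A, ∃ y ∈ s'.1.1, y⁻¹ * a ∈ s.1.2) ∧
      s'.1.2 = s.1.2 ⊓ K := by
    rintro i ⟨⟨Y, P⟩, ⟨hYn, hYA, hYf⟩, hPn, hPA, hPf⟩
    have : Finite (Γ ⧸ P) := Subgroup.finite_quotient_of_finiteIndex
    let rep : Γ ⧸ P → Γ := fun c =>
      if h : ∃ a ∈ A, (a : Γ ⧸ P) = c then h.choose else 1
    have hrepA : ∀ c, rep c ∈ A := fun c => by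
      by_cases h : ∃ a ∈ A, (a : Γ ⧸ P) = c
      · simp only [rep, dif_pos h]; exact h.choose_spec.1
      · simp only [rep, dif_neg h]; exact one_mem A
    have hrep : ∀ a ∈ A, ((rep (a : Γ ⧸ P) : Γ) : Γ ⧸ P) = a := fun a ha => by
      have h : ∃ b ∈ A, (b : Γ ⧸ P) = a := ⟨a, ha, rfl⟩
      simp only [rep, dif_pos h]
      exact h.choose_spec.2
    obtain ⟨Y', hY'n, hY'A, hY'f, hsub⟩ := exists_finite_normal_of_exponent A hcomm hn hexp
      (F := (Y : Set Γ) ∪ {(r i : Γ)} ∪ Set.range rep)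
      ((Set.Finite.union (Set.toFinite _) (Set.finite_singleton _)).union (Set.finite_range _))
      (by
        rintro x ((hx | hx) | ⟨c, rfl⟩)
        · exact hYA hx
        · rw [Set.mem_singleton_iff.mp hx]; exact (r i).2
        · exact hrepA c)
    have hlt : Y' < A := lt_of_le_of_ne hY'A fun h => by
      rw [h] at hY'f
      exact not_finite A
    obtain ⟨K, hKn, hYK, hKA, hKf⟩ :=
      exists_finiteIndex_normal_of_exponent A hcomm hn hexp Y' hlt
    refine ⟨⟨(Y', P ⊓ K), ⟨hY'n, hY'A, hY'f⟩, inferInstance, inf_le_left.trans hPA,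
      inferInstance⟩, K, hKn, hKA, hYK, fun x hx => hsub (Or.inl (Or.inl hx)),
      hsub (Or.inl (Or.inr rfl)), fun a ha => ⟨rep a, hsub (Or.inr ⟨_, rfl⟩),
        QuotientGroup.eq.mp (hrep a ha)⟩, rfl⟩
  choose f Kf hKn hKA hYK hYY hrY hrep hP using step
  let s₀ : St := ⟨(⊥, A), ⟨inferInstance, bot_le, inferInstance⟩, hAn, le_rfl, hAf⟩
  let s : ℕ → St := fun i => Nat.rec s₀ (fun i s => f i s) i
  let K : ℕ → Subgroup Γ := fun i => Kf i (s i)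
  have hs : ∀ i, s (i + 1) = f i (s i) := fun _ => rfl
  have hYmono : Monotone fun i => (s i).1.1 := monotone_nat_of_le_succ fun i => hYY i (s i)
  have hYleK : ∀ i j, i ≤ j → (s (i + 1)).1.1 ≤ K j := fun i j hij =>
    (hYmono (Nat.succ_le_succ hij)).trans (hYK j (s j))
  have hPmem : ∀ i x, x ∈ (s i).1.2 → ∀ j, j < i → x ∈ K j := by
    intro i
    induction i with
    | zero => intro x _ j hj; omega
    | succ i ih =>
      intro x hx j hj
      rw [hs, hP] at hx
      rcases Nat.lt_succ_iff_lt_or_eq.mp hj with h | rfl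
      · exact ih x hx.1 j h
      · exact hx.2
  refine ⟨K, fun i => hKn i (s i), fun i => hKA i (s i), fun a ha => ?_, fun m a ha => ?_⟩
  · obtain ⟨i, hi⟩ := hr ⟨a, ha⟩
    refine ⟨i, fun j hij => hYleK i j hij ?_⟩
    have := hrY i (s i)
    rwa [hi] at this
  -- Two corrections are needed. The element `y` agrees with `a` modulo the layers before `m` but
  -- lies in `K m`; then `z` agrees with `y⁻¹ * a` modulo the layers up to `m`. So `z` lies in the
  -- earlier layers, has the class of `a` modulo `K m`, and lies in all later layers by
  -- construction.
  · obtain ⟨y, hy, hya⟩ := hrep m (s m) a ha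
    have hyK : y ∈ K m := hYleK m m le_rfl hy
    have hpA : y⁻¹ * a ∈ A := (s m).2.2.2.1 hya
    obtain ⟨z, hz, hzp⟩ := hrep (m + 1) (s (m + 1)) _ hpA
    have hzA : z ∈ A := (s (m + 2)).2.1.2.1 hz
    have hzj : ∀ j, j < m + 1 → z⁻¹ * (y⁻¹ * a) ∈ K j := hPmem (m + 1) _ hzp
    refine ⟨z, hzA, fun j hj => ?_, ?_⟩
    · rcases Nat.lt_or_gt_of_ne hj with h | h
      · have h1 := hPmem m _ hya j h
        have h2 := hzj j (by omega)
        have h3 := mul_mem h1 (inv_mem h2)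
        simpa [mul_assoc] using h3
      · exact hYleK (m + 1) j h hz
    · have h1 := hzj m (by omega)
      have h2 : z⁻¹ * a = y * (z⁻¹ * (y⁻¹ * a)) := by
        rw [hcomm y ((s (m + 1)).2.1.2.1 hy) _ ((hKA m (s m)).le h1),
          hcomm y⁻¹ (inv_mem ((s (m + 1)).2.1.2.1 hy)) a ha]
        group
      rw [h2]
      exact mul_mem hyK h1

variable {A}

/-- The chain consists of the tail intersections of the layers. -/
theorem IndependentLayers.not_uncountableCofinality {K : ℕ → Subgroup Γ}
    (hK : IndependentLayers A K) : ¬ UncountableCofinality Γ := by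
  let C : ℕ → Subgroup Γ := fun m => ⨅ j : {j // m ≤ j}, K j
  have hC : ∀ m a, a ∈ C m ↔ ∀ j, m ≤ j → a ∈ K j := fun m a => by
    simp [C, Subgroup.mem_iInf]
  refine not_uncountableCofinality_of_chain A C (fun m m' h a ha => ?_) (fun m => ?_)
    (fun m h => ?_) (fun m a ha => (hK.lt m).le ((hC m a).mp ha m le_rfl)) (fun a ha => ?_)
  · exact (hC m' a).mpr fun j hj => (hC m a).mp ha j (h.trans hj)
  · exact Subgroup.normal_iInf_normal fun j => hK.normal j
  · obtain ⟨y, hy, hym, -⟩ := hK.exists_mem m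
    rw [← h] at hy
    exact hym ((hC m y).mp hy m le_rfl)
  · obtain ⟨m, hm⟩ := hK.eventually_mem a ha
    exact ⟨m, (hC m a).mpr hm⟩

/-- The length of `a` is the number of layers that miss `a`. Independence splits any `a` into
factors missed by at most one layer, and also produces elements missed by arbitrarily many. -/
theorem IndependentLayers.not_cayleyBounded [hAn : A.Normal] {K : ℕ → Subgroup Γ}
    (hK : IndependentLayers A K) : ¬ CayleyBounded Γ := by
  classical
  let D : Γ → Set ℕ := fun a => {i | a ∉ K i}
  have hD : ∀ a ∈ A, (D a).Finite := fun a ha => by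
    obtain ⟨m, hm⟩ := hK.eventually_mem a ha
    refine (Set.finite_lt_nat m).subset fun i hi => ?_
    by_contra h
    exact hi (hm i (not_lt.mp h))
  have hL1 : ∀ a ∈ A, ∀ m, (∀ j, j ≠ m → a ∈ K j) → ((D a).ncard : ℝ) ≤ 1 := by
    intro a _ m h
    have : (D a).ncard ≤ ({m} : Set ℕ).ncard := by
      refine Set.ncard_le_ncard (fun i hi => ?_) (Set.finite_singleton m)
      by_contra hne
      exact hi (h i hne)
    rw [Set.ncard_singleton] at this
    exact_mod_cast this
  refine not_cayleyBounded_of_length A (fun a => ((D a).ncard : ℝ)) (fun a ha b hb => ?_)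
    (fun a _ => ?_) (fun g a _ => ?_) (fun a ha => ?_) (fun c => ?_)
  · have h1 : D (a * b) ⊆ D a ∪ D b := fun i hi => by
      by_contra h
      simp only [D, Set.mem_union, Set.mem_ofPred_eq, not_or, not_not] at h
      exact hi (mul_mem h.1 h.2)
    have h2 := (Set.ncard_le_ncard h1 ((hD a ha).union (hD b hb))).trans (Set.ncard_union_le _ _)
    exact_mod_cast h2
  · simp [D]
  · have : D (g * a * g⁻¹) = D a := by
      ext i
      exact not_congr ((hK.normal i).mem_comm_iff.trans (by simp))
    simp only [this]
  · have key : ∀ m, ∀ a ∈ A, (∀ j, m ≤ j → a ∈ K j) →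
        a ∈ Subgroup.closure {a | a ∈ A ∧ ((D a).ncard : ℝ) ≤ 1} := by
      intro m
      induction m with
      | zero =>
        intro a ha h
        exact Subgroup.subset_closure ⟨ha, hL1 a ha 0 fun j _ => h j (Nat.zero_le j)⟩
      | succ m ih =>
        intro a ha h
        obtain ⟨y, hy, hyj, hya⟩ := hK.independent m a ha
        have h1 : a = y * (y⁻¹ * a) := by group
        rw [h1]
        refine mul_mem (Subgroup.subset_closure ⟨hy, hL1 y hy m hyj⟩)
          (ih _ (mul_mem (inv_mem hy) ha) fun j hj => ?_)
        rcases hj.eq_or_lt with rfl | hj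
        · exact hya
        · exact mul_mem (inv_mem (hyj j hj.ne')) (h j hj)
    obtain ⟨m, hm⟩ := hK.eventually_mem a ha
    exact key m a ha hm
  · have key : ∀ m : ℕ, ∃ a ∈ A, (∀ j, m ≤ j → a ∈ K j) ∧ ∀ j, j < m → a ∉ K j := by
      intro m
      induction m with
      | zero => exact ⟨1, one_mem A, fun j _ => one_mem _, fun j hj => by omega⟩
      | succ m ih =>
        obtain ⟨a, ha, ha1, ha2⟩ := ih
        obtain ⟨y, hy, hym, hyj⟩ := hK.exists_mem m
        refine ⟨a * y, mul_mem ha hy, fun j hj => mul_mem (ha1 j (by omega)) (hyj j (by omega)),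
          fun j hj h => ?_⟩
        rcases Nat.lt_succ_iff_lt_or_eq.mp hj with h1 | rfl
        · exact ha2 j h1 (by simpa using mul_mem h (inv_mem (hyj j h1.ne)))
        · exact hym (by simpa using mul_mem (inv_mem (ha1 j le_rfl)) h)
    obtain ⟨a, ha, -, ha2⟩ := key (⌈c⌉₊ + 1)
    refine ⟨a, ha, ?_⟩
    have h1 : (Finset.range (⌈c⌉₊ + 1) : Set ℕ) ⊆ D a := fun j hj => ha2 j (by simpa using hj)
    have h2 := Set.ncard_le_ncard h1 (hD a ha)
    rw [Set.ncard_coe_finset, Finset.card_range] at h2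
    have h3 : (⌈c⌉₊ : ℝ) + 1 ≤ ((D a).ncard : ℝ) := by exact_mod_cast h2
    have h4 := Nat.le_ceil c
    linarith

end VirtuallyAbelian

/-! ### Virtually abelian groups with a rational functional -/

section RationalFunctional

variable {Γ : Type u} [Group Γ]

/-- A nonzero homomorphism from the abelian subgroup `A` to `ℚ` such that the elements of `A` are
divisible modulo the intersection of the kernels of its conjugates. -/
structure RationalFunctional (A : Subgroup Γ) (φ : Γ → ℚ) : Prop where
  comm : ∀ a ∈ A, ∀ b ∈ A, a * b = b * a
  map_mul : ∀ a ∈ A, ∀ b ∈ A, φ (a * b) = φ a + φ b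
  divisible : ∀ n : ℕ, 0 < n → ∀ a ∈ A, ∃ s ∈ A, ∀ g, φ (g * a * g⁻¹) = n * φ (g * s * g⁻¹)
  ne_zero : ∃ x ∈ A, φ x ≠ 0

variable {A : Subgroup Γ} {φ : Γ → ℚ}

namespace RationalFunctional

theorem map_one (h : RationalFunctional A φ) : φ 1 = 0 := by
  have := h.map_mul 1 (one_mem A) 1 (one_mem A)
  rw [mul_one] at this
  linarith

theorem map_inv (h : RationalFunctional A φ) {a : Γ} (ha : a ∈ A) : φ a⁻¹ = -φ a := by
  have := h.map_mul a ha a⁻¹ (inv_mem ha)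
  rw [mul_inv_cancel, h.map_one] at this
  linarith

theorem map_pow (h : RationalFunctional A φ) {a : Γ} (ha : a ∈ A) (n : ℕ) :
    φ (a ^ n) = n * φ a := by
  induction n with
  | zero => simp [h.map_one]
  | succ n ih =>
    rw [pow_succ, h.map_mul _ (pow_mem ha n) _ ha, ih]
    push_cast
    ring

theorem map_conj_eq (h : RationalFunctional A φ) {a : Γ} (ha : a ∈ A) {g k : Γ}
    (hgk : g⁻¹ * k ∈ A) : φ (g * a * g⁻¹) = φ (k * a * k⁻¹) := by
  have h1 : g⁻¹ * k * a = a * (g⁻¹ * k) := h.comm _ hgk _ ha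
  have h2 : k * a * k⁻¹ = g * (g⁻¹ * k * a) * k⁻¹ := by group
  rw [h2, h1]
  congr 1
  group

variable [hAn : A.Normal] [hAf : A.FiniteIndex]

/-- The `i`-th member of the chain consists of the elements at which `i!` times each conjugate of
`φ` is an integer. Dividing an element with `φ x ≠ 0` by a large integer leaves this subgroup. -/
theorem not_uncountableCofinality (h : RationalFunctional A φ) : ¬ UncountableCofinality Γ := by
  have : Finite (Γ ⧸ A) := Subgroup.finite_quotient_of_finiteIndex
  have := Fintype.ofFinite (Γ ⧸ A)
  let C : ℕ → Subgroup Γ := fun i =>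
    { carrier := {a | a ∈ A ∧ ∀ g, ∃ z : ℤ, (i.factorial : ℚ) * φ (g * a * g⁻¹) = z}
      one_mem' := ⟨one_mem A, fun g => ⟨0, by simp [h.map_one]⟩⟩
      mul_mem' := fun {a b} ha hb => ⟨mul_mem ha.1 hb.1, fun g => by
        obtain ⟨y, hy⟩ := ha.2 g
        obtain ⟨z, hz⟩ := hb.2 g
        refine ⟨y + z, ?_⟩
        rw [← conj_mul, h.map_mul _ (hAn.conj_mem _ ha.1 g) _ (hAn.conj_mem _ hb.1 g), mul_add,
          hy, hz]
        push_cast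
        rfl⟩
      inv_mem' := fun {a} ha => ⟨inv_mem ha.1, fun g => by
        obtain ⟨y, hy⟩ := ha.2 g
        refine ⟨-y, ?_⟩
        rw [← conj_inv, h.map_inv (hAn.conj_mem _ ha.1 g), mul_neg, hy]
        push_cast
        rfl⟩ }
  have hC : ∀ i a, a ∈ C i ↔ a ∈ A ∧ ∀ g, ∃ z : ℤ, (i.factorial : ℚ) * φ (g * a * g⁻¹) = z :=
    fun _ _ => Iff.rfl
  refine not_uncountableCofinality_of_chain A C (fun i j hij a ha => ⟨ha.1, fun g => ?_⟩)
    (fun i => ⟨fun a ha k => ⟨hAn.conj_mem _ ha.1 k, fun g => ?_⟩⟩) (fun i hi => ?_)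
    (fun i a ha => ha.1) (fun a ha => ?_)
  · obtain ⟨z, hz⟩ := ha.2 g
    obtain ⟨d, hd⟩ := Nat.factorial_dvd_factorial hij
    refine ⟨d * z, ?_⟩
    rw [hd]
    push_cast
    rw [← hz]
    ring
  · obtain ⟨z, hz⟩ := ha.2 (g * k)
    refine ⟨z, ?_⟩
    rw [← hz]
    congr 2
    group
  · obtain ⟨x, hx, hφ⟩ := h.ne_zero
    have hr : (i.factorial : ℚ) * φ x ≠ 0 :=
      mul_ne_zero (by exact_mod_cast i.factorial_ne_zero) hφ
    obtain ⟨n, hn⟩ := exists_nat_gt |(i.factorial : ℚ) * φ x|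
    have hn0 : 0 < n := by exact_mod_cast (abs_nonneg _).trans_lt hn
    obtain ⟨s, hs, hsn⟩ := h.divisible n hn0 x hx
    have h1 := hsn 1
    simp only [one_mul, inv_one, mul_one] at h1
    obtain ⟨z, hz⟩ := ((hC i s).mp (hi ▸ hs)).2 1
    simp only [one_mul, inv_one, mul_one] at hz
    have h2 : (i.factorial : ℚ) * φ x = n * z := by rw [h1, ← hz]; ring
    have hz0 : z ≠ 0 := by
      rintro rfl
      apply hr
      rw [h2]; simp
    have hz1 : (1 : ℚ) ≤ |(z : ℚ)| := by exact_mod_cast Int.one_le_abs hz0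
    rw [h2, abs_mul, Nat.abs_cast] at hn
    have : (n : ℚ) ≤ n * |(z : ℚ)| := le_mul_of_one_le_right (Nat.cast_nonneg n) hz1
    linarith
  · let q : Γ ⧸ A → ℚ := fun c => φ (Quotient.out c * a * (Quotient.out c)⁻¹)
    -- Only finitely many conjugates of `φ` are distinct on `A`, and the factorial of the sum of the
    -- denominators is divisible by each of them.
    refine ⟨∑ c, (q c).den, ha, fun g => ?_⟩
    have h1 : φ (g * a * g⁻¹) = q g :=
      h.map_conj_eq ha (QuotientGroup.eq.mp (QuotientGroup.out_eq' (g : Γ ⧸ A)).symm)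
    obtain ⟨d, hd⟩ := Nat.dvd_factorial (q g).den_pos
      (Finset.single_le_sum (f := fun c => (q c).den) (fun _ _ => Nat.zero_le _)
        (Finset.mem_univ (g : Γ ⧸ A)))
    refine ⟨d * (q g).num, ?_⟩
    rw [h1, hd]
    push_cast
    rw [mul_right_comm, Rat.den_mul_eq_num, mul_comm]

/-- The length is the sum of the absolute values of the finitely many conjugates of `φ`. By
divisibility `a` is a power of an element of length at most 1 times an element of length 0. -/
theorem not_cayleyBounded (h : RationalFunctional A φ) : ¬ CayleyBounded Γ := by
  have : Finite (Γ ⧸ A) := Subgroup.finite_quotient_of_finiteIndex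
  have := Fintype.ofFinite (Γ ⧸ A)
  let q : Γ ⧸ A → Γ → ℚ := fun c a => φ (Quotient.out c * a * (Quotient.out c)⁻¹)
  have hq : ∀ (g : Γ), ∀ a ∈ A, φ (g * a * g⁻¹) = q g a := fun g a ha =>
    h.map_conj_eq ha (QuotientGroup.eq.mp (QuotientGroup.out_eq' (g : Γ ⧸ A)).symm)
  have hqmul : ∀ c, ∀ a ∈ A, ∀ b ∈ A, q c (a * b) = q c a + q c b := fun c a ha b hb => by
    simp only [q]
    rw [← conj_mul, h.map_mul _ (hAn.conj_mem _ ha _) _ (hAn.conj_mem _ hb _)]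
  have hqinv : ∀ c, ∀ a ∈ A, q c a⁻¹ = - q c a := fun c a ha => by
    simp only [q]
    rw [← conj_inv, h.map_inv (hAn.conj_mem _ ha _)]
  have hqpow : ∀ c, ∀ a ∈ A, ∀ n : ℕ, q c (a ^ n) = n * q c a := fun c a ha n => by
    simp only [q]
    rw [← conj_pow, h.map_pow (hAn.conj_mem _ ha _)]
  let L : Γ → ℚ := fun a => ∑ c, |q c a|
  have hLnonneg : ∀ a, 0 ≤ L a := fun a => Finset.sum_nonneg fun _ _ => abs_nonneg _
  have hLpow : ∀ a ∈ A, ∀ n : ℕ, L (a ^ n) = n * L a := fun a ha n => by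
    simp only [L, Finset.mul_sum]
    exact Finset.sum_congr rfl fun c _ => by rw [hqpow c a ha, abs_mul, Nat.abs_cast]
  refine not_cayleyBounded_of_length A (fun a => (L a : ℝ)) (fun a ha b hb => ?_) (fun a ha => ?_)
    (fun g a ha => ?_) (fun a ha => ?_) (fun c => ?_)
  · have : L (a * b) ≤ L a + L b := by
      simp only [L, ← Finset.sum_add_distrib]
      exact Finset.sum_le_sum fun c _ => by rw [hqmul c a ha b hb]; exact abs_add_le _ _
    exact_mod_cast this
  · have : L a⁻¹ = L a := Finset.sum_congr rfl fun c _ => by rw [hqinv c a ha, abs_neg]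
    exact_mod_cast this
  · have : L (g * a * g⁻¹) = L a := by
      simp only [L]
      rw [← Equiv.sum_comp (Equiv.mulRight (g : Γ ⧸ A)) (fun c => |q c a|)]
      refine Finset.sum_congr rfl fun c _ => ?_
      congr 1
      have h1 : ((Quotient.out c * g : Γ) : Γ ⧸ A) = c * (g : Γ ⧸ A) := by
        rw [QuotientGroup.mk_mul, QuotientGroup.out_eq']
      change q c _ = q (c * (g : Γ ⧸ A)) a
      rw [← h1, ← hq _ a ha]
      simp only [q]
      congr 1
      group
    exact_mod_cast this
  · obtain ⟨n, hn⟩ := exists_nat_gt (L a)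
    have hn0 : 0 < n := by exact_mod_cast (hLnonneg a).trans_lt hn
    obtain ⟨s, hs, hsn⟩ := h.divisible n hn0 a ha
    have hqs : ∀ c, q c a = n * q c s := fun c => hsn _
    have e1 : L a = n * L s := by
      rw [← hLpow s hs n]
      exact Finset.sum_congr rfl fun c _ => by rw [hqpow c s hs, hqs]
    have e2 : L s ≤ 1 := by
      have hn' : (0 : ℚ) < n := by exact_mod_cast hn0
      rw [e1] at hn
      exact (lt_of_mul_lt_mul_left (by rwa [mul_one]) hn'.le).le
    have hsa : (s ^ n)⁻¹ * a ∈ A := mul_mem (inv_mem (pow_mem hs n)) ha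
    have e3 : L ((s ^ n)⁻¹ * a) = 0 := Finset.sum_eq_zero fun c _ => by
      rw [hqmul c _ (inv_mem (pow_mem hs n)) _ ha, hqinv c _ (pow_mem hs n), hqpow c s hs, hqs]
      simp
    have e4 : a = s ^ n * ((s ^ n)⁻¹ * a) := by group
    rw [e4]
    have e5 : s ∈ {a | a ∈ A ∧ (L a : ℝ) ≤ 1} := ⟨hs, by exact_mod_cast e2⟩
    have e6 : (s ^ n)⁻¹ * a ∈ {a | a ∈ A ∧ (L a : ℝ) ≤ 1} := ⟨hsa, by rw [e3]; simp⟩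
    exact mul_mem (pow_mem (Subgroup.subset_closure e5) n) (Subgroup.subset_closure e6)
  · obtain ⟨x, hx, hφ⟩ := h.ne_zero
    have hpos : 0 < L x := by
      have h1 : |q (1 : Γ) x| ≤ L x :=
        Finset.single_le_sum (f := fun c => |q c x|) (fun _ _ => abs_nonneg _) (Finset.mem_univ _)
      rw [← hq 1 x hx] at h1
      simp only [one_mul, inv_one, mul_one] at h1
      exact (abs_pos.mpr hφ).trans_le h1
    have hpos' : (0 : ℝ) < L x := by exact_mod_cast hpos
    obtain ⟨n, hn⟩ := exists_nat_gt (c / (L x : ℝ))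
    refine ⟨x ^ n, pow_mem hx n, ?_⟩
    rw [hLpow x hx]
    push_cast
    rwa [div_lt_iff₀ hpos'] at hn

end RationalFunctional

end RationalFunctional

/-! ### Countable quotients and the dichotomy on powers -/

section AbelianFiniteIndex

variable {Γ : Type u} [Group Γ] {A : Subgroup Γ}

theorem conj_eq_of_comm (hcomm : ∀ a ∈ A, ∀ b ∈ A, a * b = b * a) {a : Γ} (ha : a ∈ A) {g k : Γ}
    (hgk : g⁻¹ * k ∈ A) : g * a * g⁻¹ = k * a * k⁻¹ := by
  have h2 : k * a * k⁻¹ = g * (g⁻¹ * k * a) * k⁻¹ := by group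
  rw [h2, hcomm _ hgk _ ha]
  group

/-- The subgroup of `n`-th powers of elements of a commutative subgroup. -/
def powersSubgroup (hcomm : ∀ a ∈ A, ∀ b ∈ A, a * b = b * a) (n : ℕ) : Subgroup Γ where
  carrier := {y | ∃ a ∈ A, a ^ n = y}
  one_mem' := ⟨1, one_mem A, one_pow n⟩
  mul_mem' := by
    rintro _ _ ⟨a, ha, rfl⟩ ⟨b, hb, rfl⟩
    exact ⟨a * b, mul_mem ha hb, Commute.mul_pow (hcomm a ha b hb) n⟩
  inv_mem' := by
    rintro _ ⟨a, ha, rfl⟩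
    exact ⟨a⁻¹, inv_mem ha, inv_pow a n⟩

theorem powersSubgroup_le (hcomm : ∀ a ∈ A, ∀ b ∈ A, a * b = b * a) (n : ℕ) :
    powersSubgroup hcomm n ≤ A := by
  rintro _ ⟨a, ha, rfl⟩
  exact pow_mem ha n

theorem powersSubgroup_normal [hAn : A.Normal] (hcomm : ∀ a ∈ A, ∀ b ∈ A, a * b = b * a) (n : ℕ) :
    (powersSubgroup hcomm n).Normal := ⟨by
  rintro _ ⟨a, ha, rfl⟩ g
  exact ⟨g * a * g⁻¹, hAn.conj_mem a ha g, conj_pow⟩⟩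

variable [hAn : A.Normal] [hAf : A.FiniteIndex]

/-- On the abelian subgroup `A` only finitely many conjugations are distinct, so the normal core is
cut out by finitely many conjugates of `N`, and its quotient embeds in a finite power of `Γ ⧸ N`. -/
theorem countable_quotient_normalCore (hcomm : ∀ a ∈ A, ∀ b ∈ A, a * b = b * a)
    {N : Subgroup Γ} (hNA : N ≤ A) (hN : Countable (A ⧸ N.subgroupOf A)) :
    Countable (Γ ⧸ N.normalCore) := by
  have : Finite (Γ ⧸ A) := Subgroup.finite_quotient_of_finiteIndex
  have hΓN : Countable (Γ ⧸ N) := (Subgroup.quotientEquivProdOfLE hNA).injective.countable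
  let f : Γ ⧸ N.normalCore → (Γ ⧸ A → Γ ⧸ N) := fun x t =>
    Quotient.liftOn' x (fun x => ((x * Quotient.out t : Γ) : Γ ⧸ N)) fun x y hxy => by
      rw [QuotientGroup.leftRel_apply] at hxy
      refine QuotientGroup.eq.mpr ?_
      have := hxy (Quotient.out t)⁻¹
      simpa [mul_assoc] using this
  refine Function.Injective.countable (f := f) ?_
  intro x y hxy
  obtain ⟨x, rfl⟩ := QuotientGroup.mk_surjective x
  obtain ⟨y, rfl⟩ := QuotientGroup.mk_surjective y
  have h1 : ∀ t : Γ ⧸ A, (Quotient.out t)⁻¹ * (x⁻¹ * y) * Quotient.out t ∈ N := fun t => by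
    have := QuotientGroup.eq.mp (congrFun hxy t : ((x * Quotient.out t : Γ) : Γ ⧸ N) =
      ((y * Quotient.out t : Γ) : Γ ⧸ N))
    simpa [mul_assoc] using this
  have hA : x⁻¹ * y ∈ A := by
    have h2 := hAn.conj_mem _ (hNA (h1 1)) (Quotient.out (1 : Γ ⧸ A))
    simpa [mul_assoc] using h2
  refine QuotientGroup.eq.mpr fun g => ?_
  have h3 : (g⁻¹)⁻¹ * Quotient.out ((g⁻¹ : Γ) : Γ ⧸ A) ∈ A :=
    QuotientGroup.eq.mp (QuotientGroup.out_eq' _).symm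
  have h4 : g⁻¹⁻¹ * (Quotient.out ((g⁻¹ : Γ) : Γ ⧸ A))⁻¹⁻¹ ∈ A := by simpa using h3
  have h5 : g * (x⁻¹ * y) * g⁻¹ = (Quotient.out ((g⁻¹ : Γ) : Γ ⧸ A))⁻¹ * (x⁻¹ * y) *
      (Quotient.out ((g⁻¹ : Γ) : Γ ⧸ A))⁻¹⁻¹ := by
    refine conj_eq_of_comm hcomm hA ?_
    have h6 : g⁻¹ * (Quotient.out ((g⁻¹ : Γ) : Γ ⧸ A))⁻¹ =
        g⁻¹ * (g * Quotient.out ((g⁻¹ : Γ) : Γ ⧸ A))⁻¹ * g⁻¹⁻¹ := by group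
    rw [h6]
    rw [inv_inv] at h3
    exact hAn.conj_mem _ (inv_mem h3) _
  rw [h5, inv_inv]
  exact h1 _

theorem exists_normal_countable_index (hcomm : ∀ a ∈ A, ∀ b ∈ A, a * b = b * a)
    {M : Subgroup Γ} [hMn : M.Normal] (hMA : M ≤ A) (hM : M.index = 0) :
    ∃ N : Subgroup Γ, N.Normal ∧ M ≤ N ∧ N ≤ A ∧ Countable (Γ ⧸ N) ∧ N.index = 0 := by
  let _ : CommGroup A :=
    { (inferInstance : Group A) with
      mul_comm := fun a b => Subtype.ext (hcomm _ a.2 _ b.2) }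
  have hrel : M.relIndex A = 0 := by
    have := Subgroup.relIndex_mul_index hMA
    rw [hM] at this
    exact (mul_eq_zero.mp this).resolve_right hAf.index_ne_zero
  have hinf : Infinite (A ⧸ M.subgroupOf A) := by
    rw [← not_finite_iff_infinite]
    intro h
    exact Nat.card_ne_zero.mpr ⟨⟨1⟩, h⟩ hrel
  obtain ⟨S, hSc, hSi⟩ := exists_countable_infinite_quotient (Additive (A ⧸ M.subgroupOf A))
  let S' : Subgroup (A ⧸ M.subgroupOf A) := AddSubgroup.toSubgroup' S
  let π := QuotientGroup.mk' (M.subgroupOf A)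
  let N₀ : Subgroup A := S'.comap π
  have e : A ⧸ N₀ ≃ Additive (A ⧸ M.subgroupOf A) ⧸ S := by
    refine Equiv.ofBijective (Quotient.map' (fun a => Additive.ofMul (π a)) fun a b h => ?_)
      ⟨?_, ?_⟩
    · rw [QuotientGroup.leftRel_apply] at h
      rw [QuotientAddGroup.leftRel_apply]
      exact h
    · intro x y h
      obtain ⟨x, rfl⟩ := QuotientGroup.mk_surjective x
      obtain ⟨y, rfl⟩ := QuotientGroup.mk_surjective y
      have h1 : (QuotientAddGroup.mk (Additive.ofMul (π x)) :
        Additive (A ⧸ M.subgroupOf A) ⧸ S) = QuotientAddGroup.mk (Additive.ofMul (π y)) := h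
      exact QuotientGroup.eq.mpr (QuotientAddGroup.eq.mp h1)
    · intro y
      obtain ⟨y, rfl⟩ := QuotientAddGroup.mk_surjective y
      obtain ⟨a, ha⟩ := QuotientGroup.mk'_surjective (M.subgroupOf A) (Additive.toMul y)
      refine ⟨QuotientGroup.mk a, ?_⟩
      change QuotientAddGroup.mk (Additive.ofMul (π a)) = _
      rw [show π a = Additive.toMul y from ha]
      rfl
  have hN₀ : (N₀.map A.subtype).subgroupOf A = N₀ := by
    rw [← Subgroup.comap_subtype, Subgroup.comap_map_eq_self_of_injective A.subtype_injective]
  have hle : N₀.map A.subtype ≤ A := Subgroup.map_subtype_le _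
  refine ⟨(N₀.map A.subtype).normalCore, inferInstance, ?_, (Subgroup.normalCore_le _).trans hle,
    countable_quotient_normalCore hcomm hle ?_, ?_⟩
  · refine Subgroup.normal_le_normalCore.mpr fun m hm => ⟨⟨m, hMA hm⟩, ?_, rfl⟩
    change π ⟨m, hMA hm⟩ ∈ S'
    have h1 : π ⟨m, hMA hm⟩ = 1 := (QuotientGroup.eq_one_iff _).mpr hm
    rw [h1]
    exact one_mem S'
  · rw [hN₀]
    exact e.injective.countable
  · have h1 : N₀.index = 0 := by
      have : Infinite (A ⧸ N₀) := e.symm.infinite_iff.mp hSi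
      exact Nat.card_eq_zero_of_infinite
    have h2 : (N₀.map A.subtype).index = 0 := by
      rw [Subgroup.index_map_subtype, h1, zero_mul]
    have h3 := Subgroup.index_dvd_of_le (Subgroup.normalCore_le (N₀.map A.subtype))
    rw [h2] at h3
    exact Nat.eq_zero_of_zero_dvd h3

theorem exists_independentLayers_quotient (hcomm : ∀ a ∈ A, ∀ b ∈ A, a * b = b * a) {n : ℕ}
    (hn : 0 < n) (hidx : (powersSubgroup hcomm n).index = 0) :
    ∃ (N : Subgroup Γ) (_ : N.Normal) (K : ℕ → Subgroup (Γ ⧸ N)),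
      IndependentLayers (A.map (QuotientGroup.mk' N)) K := by
  have := powersSubgroup_normal hcomm n
  obtain ⟨N, hNn, hMN, hNA, hNc, hNi⟩ :=
    exists_normal_countable_index hcomm (powersSubgroup_le hcomm n) hidx
  let π := QuotientGroup.mk' N
  have hπ : Function.Surjective π := QuotientGroup.mk'_surjective N
  have hn1 : (A.map π).Normal := hAn.map π hπ
  have hf1 : (A.map π).FiniteIndex := ⟨fun h => hAf.index_ne_zero (by
    have := Subgroup.index_map_dvd A hπ
    rw [h] at this
    exact Nat.eq_zero_of_zero_dvd this)⟩
  refine ⟨N, hNn, exists_independentLayers (A.map π) ?_ hn ?_ inferInstance ?_⟩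
  · rintro _ ⟨a, ha, rfl⟩ _ ⟨b, hb, rfl⟩
    rw [← map_mul, hcomm a ha b hb, map_mul]
  · rintro _ ⟨a, ha, rfl⟩
    rw [← map_pow]
    exact (QuotientGroup.eq_one_iff _).mpr (hMN ⟨a, ha, rfl⟩)
  · rw [← not_finite_iff_infinite]
    intro hfin
    have h1 := Subgroup.index_mul_card (A.map π)
    have h2 : Nat.card (Γ ⧸ N) ≠ 0 := by
      rw [← h1]
      exact mul_ne_zero hf1.index_ne_zero (Nat.card_ne_zero.mpr ⟨⟨1⟩, hfin⟩)
    exact h2 hNi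

theorem countable_closure {S : Set Γ} (hS : S.Countable) : Countable (Subgroup.closure S) := by
  have : Countable S := hS
  have h1 := FreeGroup.range_lift_eq_closure (f := ((↑) : S → Γ))
  rw [Subtype.range_coe] at h1
  rw [← h1]
  exact (Set.countable_range (FreeGroup.lift ((↑) : S → Γ))).to_subtype

/-- As all `A/A^n` are finite, some countable normal subgroup `B` contains representatives of every
one of them, so `A ⧸ B` is divisible. By `htors` there is an element of infinite order modulo `B`,
and injectivity of ℚ gives a functional on `A ⧸ B` not vanishing on it. -/
theorem exists_rationalFunctional (hcomm : ∀ a ∈ A, ∀ b ∈ A, a * b = b * a)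
    (hfin : ∀ n, 0 < n → (powersSubgroup hcomm n).FiniteIndex)
    (htors : ∀ S : Set Γ, S.Countable → ∃ a ∈ A, ∀ n : ℕ, 0 < n → a ^ n ∉ S) :
    ∃ φ : Γ → ℚ, RationalFunctional A φ := by
  classical
  let _ : CommGroup A :=
    { (inferInstance : Group A) with
      mul_comm := fun a b => Subtype.ext (hcomm _ a.2 _ b.2) }
  have hrep : ∀ n, 0 < n → ∃ F : Set Γ, F.Finite ∧ F ⊆ A ∧
      ∀ a ∈ A, ∃ c ∈ F, c⁻¹ * a ∈ powersSubgroup hcomm n := fun n hn => by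
    have := hfin n hn
    let P := (powersSubgroup hcomm n).subgroupOf A
    have : Finite (A ⧸ P) := Subgroup.finite_quotient_of_finiteIndex
    refine ⟨Set.range fun c : A ⧸ P => ((Quotient.out c : A) : Γ), Set.finite_range _, ?_, ?_⟩
    · rintro _ ⟨c, rfl⟩
      exact (Quotient.out c : A).2
    · intro a ha
      refine ⟨_, ⟨QuotientGroup.mk ⟨a, ha⟩, rfl⟩, ?_⟩
      have h1 := QuotientGroup.eq.mp (QuotientGroup.out_eq' (QuotientGroup.mk ⟨a, ha⟩ : A ⧸ P))
      exact h1
  choose! F hFfin hFA hF using hrep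
  let S₀ : Set Γ := ⋃ n : {n : ℕ // 0 < n}, F n
  have hS₀ : S₀.Countable := Set.countable_iUnion fun n => (hFfin n n.2).countable
  have hS₀A : S₀ ⊆ A := Set.iUnion_subset fun n => hFA n n.2
  let B := Subgroup.normalClosure S₀
  have hBA : B ≤ A := Subgroup.normalClosure_le_normal hS₀A
  have hBc : Countable B := by
    refine countable_closure ?_
    refine ((finite_range_out A).countable.image2 hS₀ (fun t f => t * f * t⁻¹)).mono ?_
    intro x hx
    obtain ⟨f, hf, hc⟩ := Group.mem_conjugatesOfSet_iff.mp hx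
    obtain ⟨g, rfl⟩ := isConj_iff.mp hc
    refine ⟨_, ⟨(g : Γ ⧸ A), rfl⟩, f, hf, ?_⟩
    exact conj_eq_of_comm hcomm (hS₀A hf) (QuotientGroup.eq.mp (QuotientGroup.out_eq' _))
  obtain ⟨x, hx, hxB⟩ := htors B (Set.to_countable _)
  let Q := A ⧸ B.subgroupOf A
  let xq : Additive Q := Additive.ofMul (QuotientGroup.mk ⟨x, hx⟩)
  obtain ⟨φ₀, hφ₀⟩ := exists_hom_rat_eq_one xq fun n hn h => by
    have h1 : (QuotientGroup.mk (⟨x, hx⟩ ^ n : A) : Q) = 1 := h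
    have h2 := (QuotientGroup.eq_one_iff (N := B.subgroupOf A) (⟨x, hx⟩ ^ n : A)).mp h1
    exact hxB n hn h2
  let φ : Γ → ℚ := fun g =>
    if h : g ∈ A then φ₀ (Additive.ofMul (QuotientGroup.mk ⟨g, h⟩ : Q)) else 0
  have hφ : ∀ g (h : g ∈ A), φ g = φ₀ (Additive.ofMul (QuotientGroup.mk ⟨g, h⟩ : Q)) :=
    fun g h => by simp only [φ, dif_pos h]
  have hmul : ∀ a ∈ A, ∀ b ∈ A, φ (a * b) = φ a + φ b := fun a ha b hb => by
    rw [hφ a ha, hφ b hb, hφ _ (mul_mem ha hb), ← map_add]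
    rfl
  have hpow : ∀ a ∈ A, ∀ n : ℕ, φ (a ^ n) = n * φ a := fun a ha n => by
    rw [hφ a ha, hφ _ (pow_mem ha n), ← nsmul_eq_mul, ← map_nsmul]
    rfl
  have hφB : ∀ b ∈ B, φ b = 0 := fun b hb => by
    rw [hφ b (hBA hb)]
    have : (QuotientGroup.mk ⟨b, hBA hb⟩ : Q) = 1 := (QuotientGroup.eq_one_iff _).mpr hb
    rw [this]
    exact map_zero φ₀
  refine ⟨φ, hcomm, hmul, fun n hn a ha => ?_, x, hx, ?_⟩
  · obtain ⟨c, hc, s, hs, hsc⟩ := hF n hn a ha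
    refine ⟨s, hs, fun g => ?_⟩
    have hcB : c ∈ B := Subgroup.subset_normalClosure (Set.mem_iUnion.mpr ⟨⟨n, hn⟩, hc⟩)
    have hcg : g * c * g⁻¹ ∈ B := Subgroup.normalClosure_normal.conj_mem c hcB g
    have h1 : g * a * g⁻¹ = (g * c * g⁻¹) * (g * s * g⁻¹) ^ n := by
      rw [conj_pow, hsc]
      group
    rw [h1, hmul _ (hBA hcg) _ (pow_mem (hAn.conj_mem s hs g) n), hφB _ hcg,
      hpow _ (hAn.conj_mem s hs g), zero_add]
  · rw [hφ x hx]
    exact hφ₀.trans_ne one_ne_zero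

end AbelianFiniteIndex

/-! ### Products of commutators -/

section CommutatorSet

variable {G : Type u} [Group G]

theorem inv_commutatorSet : (commutatorSet G)⁻¹ = commutatorSet G := by
  ext g
  simp only [commutatorSet, Set.mem_inv, Set.mem_ofPred_eq]
  constructor
  · rintro ⟨a, b, h⟩
    exact ⟨b, a, by rw [← commutatorElement_inv, h, inv_inv]⟩
  · rintro ⟨a, b, h⟩
    exact ⟨b, a, by rw [← commutatorElement_inv, h]⟩

theorem exists_mem_commutatorSet_pow {g : G} (hg : g ∈ commutator G) :
    ∃ k : ℕ, g ∈ commutatorSet G ^ k := by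
  rw [commutator_eq_closure] at hg
  exact exists_mem_pow_of_mem_closure inv_commutatorSet hg

theorem commutatorSet_pow_subset (k : ℕ) :
    commutatorSet G ^ k ⊆ (commutator G : Set G) := by
  rw [commutator_eq_closure]
  exact Set.pow_subset_pow_left Subgroup.subset_closure |>.trans (by
    induction k with
    | zero => simp [one_mem]
    | succ k ih =>
      rw [pow_succ]
      rintro _ ⟨a, ha, b, hb, rfl⟩
      exact mul_mem (ih ha) hb)

end CommutatorSet

/-! ### Baire category in compact groups -/

section CompactGroups

variable {G : Type u} [Group G] [TopologicalSpace G] [IsTopologicalGroup G] [CompactSpace G]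

theorem finiteIndex_of_isOpen {K : Subgroup G} (hK : IsOpen (K : Set G)) : K.FiniteIndex := by
  have := Subgroup.quotient_finite_of_isOpen K hK
  exact Subgroup.finiteIndex_of_finite_quotient

theorem isOpen_topologicalClosure_of_countable (K : Subgroup G) [Countable (G ⧸ K)] :
    IsOpen (K.topologicalClosure : Set G) := by
  obtain ⟨c, x, hx⟩ := nonempty_interior_of_iUnion_of_closed
    (f := fun c : G ⧸ K => Quotient.out c • (K.topologicalClosure : Set G))
    (fun c => K.isClosed_topologicalClosure.smul _)
    (Set.eq_univ_of_forall fun g => Set.mem_iUnion.mpr ⟨(g : G ⧸ K), by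
      rw [Set.mem_smul_set_iff_inv_smul_mem, smul_eq_mul]
      exact K.le_topologicalClosure
        (QuotientGroup.eq.mp (QuotientGroup.out_eq' (g : G ⧸ K)))⟩)
  rw [interior_smul] at hx
  obtain ⟨y, hy, -⟩ := hx
  exact Subgroup.isOpen_of_mem_nhds _ (mem_interior_iff_mem_nhds.mp hy)

theorem isCompact_commutatorSet_pow (k : ℕ) : IsCompact (commutatorSet G ^ k) := by
  have h1 : IsCompact (commutatorSet G) := by
    have : commutatorSet G = Set.range fun p : G × G => ⁅p.1, p.2⁆ := by
      ext g
      simp [commutatorSet]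
    rw [this]
    refine isCompact_range ?_
    simp only [commutatorElement_def]
    fun_prop
  induction k with
  | zero => simp
  | succ k ih => rw [pow_succ]; exact ih.mul h1

variable [T2Space G]

/-- The group is a countable union of translates of the compact sets of products of `k` commutators.
-/
theorem exists_interior_commutatorSet_pow [Countable (G ⧸ commutator G)] :
    ∃ k : ℕ, (interior (commutatorSet G ^ k)).Nonempty := by
  obtain ⟨⟨c, k⟩, x, hx⟩ := nonempty_interior_of_iUnion_of_closed
    (f := fun p : (G ⧸ commutator G) × ℕ => Quotient.out p.1 • (commutatorSet G ^ p.2))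
    (fun p => (isCompact_commutatorSet_pow p.2).isClosed.smul _)
    (Set.eq_univ_of_forall fun g => by
      obtain ⟨k, hk⟩ := exists_mem_commutatorSet_pow
        (QuotientGroup.eq.mp (QuotientGroup.out_eq' (g : G ⧸ commutator G)))
      refine Set.mem_iUnion.mpr ⟨((g : G ⧸ commutator G), k), ?_⟩
      rwa [Set.mem_smul_set_iff_inv_smul_mem, smul_eq_mul])
  rw [interior_smul] at hx
  obtain ⟨y, hy, -⟩ := hx
  exact ⟨k, y, hy⟩

theorem isOpen_commutator [Countable (G ⧸ commutator G)] : IsOpen (commutator G : Set G) := by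
  obtain ⟨k, x, hx⟩ := exists_interior_commutatorSet_pow (G := G)
  exact Subgroup.isOpen_of_mem_nhds _
    (Filter.mem_of_superset (mem_interior_iff_mem_nhds.mp hx) (commutatorSet_pow_subset k))

/-- A compact group whose commutator subgroup has countable index has finite commutator width. -/
theorem exists_commutator_subset_pow [Countable (G ⧸ commutator G)] :
    ∃ k : ℕ, (commutator G : Set G) ⊆ commutatorSet G ^ k := by
  obtain ⟨k, x, hx⟩ := exists_interior_commutatorSet_pow (G := G)
  have hcpt : IsCompact (commutator G : Set G) :=
    (Subgroup.isClosed_of_isOpen _ isOpen_commutator).isCompact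
  have hone : (1 : G) ∈ commutatorSet G := one_mem_commutatorSet G
  have hxc : x ∈ commutator G := commutatorSet_pow_subset k (interior_subset hx)
  -- The open sets `commutatorSet G ^ m * interior (commutatorSet G ^ k)` increase with `m` and
  -- cover the compact commutator subgroup, so one of them suffices.
  obtain ⟨m, hm⟩ := hcpt.elim_directed_cover
    (fun m : ℕ => commutatorSet G ^ m * interior (commutatorSet G ^ k))
    (fun m => isOpen_interior.mul_left)
    (fun y hy => by
      obtain ⟨m, hm⟩ := exists_mem_commutatorSet_pow (mul_mem hy (inv_mem hxc))
      exact Set.mem_iUnion.mpr ⟨m, y * x⁻¹, hm, x, hx, by simp⟩)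
    (Monotone.directed_le fun m n hmn =>
      Set.mul_subset_mul_right (Set.pow_subset_pow_right hone hmn))
  refine ⟨m + k, hm.trans ?_⟩
  rw [pow_add]
  exact Set.mul_subset_mul_left interior_subset

/-- If the values of the powers of `f` meet a countable set everywhere, then some power map is
trivial on a finite index subgroup. -/
theorem exists_finiteIndex_pow_eq_one {Γ : Type v} [Group Γ] (f : G →* Γ)
    (hf : f.ker = commutator G) {S : Set Γ} (hS : S.Countable)
    (h : ∀ r, ∃ n : ℕ, 0 < n ∧ f r ^ n ∈ S) :
    ∃ n : ℕ, 0 < n ∧ ∃ T : Subgroup G, T.FiniteIndex ∧ ∀ r ∈ T, f r ^ n = 1 := by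
  classical
  have := hS.to_subtype
  let out : Γ → G := fun s => if h : ∃ g, f g = s then h.choose else 1
  have hout : ∀ g, f (out (f g)) = f g := fun g => by
    have h : ∃ g', f g' = f g := ⟨g, rfl⟩
    simp only [out, dif_pos h]
    exact h.choose_spec
  -- Membership of `f r ^ n` in `S` is not a closed condition on `r`; fixing its value and the
  -- number `k` of commutators needed makes it one, at the cost of countably many cases.
  obtain ⟨⟨⟨n, hn⟩, s, k⟩, x, hx⟩ := nonempty_interior_of_iUnion_of_closed
    (f := fun p : {n : ℕ // 0 < n} × S × ℕ =>
      (fun r : G => r ^ (p.1 : ℕ)) ⁻¹' (out p.2.1 • (commutatorSet G ^ p.2.2)))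
    (fun p => ((isCompact_commutatorSet_pow p.2.2).isClosed.smul _).preimage (continuous_pow _))
    (Set.eq_univ_of_forall fun r => by
      obtain ⟨n, hn, hs⟩ := h r
      have h1 : (out (f r ^ n))⁻¹ * r ^ n ∈ commutator G := by
        rw [← hf, MonoidHom.mem_ker, map_mul, map_inv, ← map_pow, hout, inv_mul_cancel]
      obtain ⟨k, hk⟩ := exists_mem_commutatorSet_pow h1
      refine Set.mem_iUnion.mpr ⟨(⟨n, hn⟩, ⟨_, hs⟩, k), ?_⟩
      rw [Set.mem_preimage, Set.mem_smul_set_iff_inv_smul_mem, smul_eq_mul]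
      exact hk)
  have hmem : ∀ y ∈ interior ((fun r : G => r ^ n) ⁻¹' (out s • (commutatorSet G ^ k))),
      f y ^ n = f (out s) := fun y hy => by
    have h1 := interior_subset hy
    rw [Set.mem_preimage, Set.mem_smul_set_iff_inv_smul_mem, smul_eq_mul] at h1
    have h2 := commutatorSet_pow_subset k h1
    rw [SetLike.mem_coe, ← hf, MonoidHom.mem_ker, map_mul, map_inv, map_pow, inv_mul_eq_one] at h2
    exact h2.symm
  have hcomm : ∀ a b : G, Commute (f a) (f b) := fun a b => by
    have h1 : ⁅a, b⁆ ∈ f.ker := by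
      rw [hf, commutator_eq_closure]
      exact Subgroup.subset_closure ⟨a, b, rfl⟩
    rw [MonoidHom.mem_ker, map_commutatorElement] at h1
    exact commutatorElement_eq_one_iff_commute.mp h1
  let T : Subgroup G :=
    { carrier := {r | f r ^ n = 1}
      one_mem' := by simp
      mul_mem' := fun {a b} ha hb => by
        simp only [Set.mem_ofPred_eq] at ha hb ⊢
        rw [map_mul, (hcomm a b).mul_pow, ha, hb, one_mul]
      inv_mem' := fun {a} ha => by
        simp only [Set.mem_ofPred_eq] at ha ⊢
        rw [map_inv, inv_pow, ha, inv_one] }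
  refine ⟨n, hn, T, finiteIndex_of_isOpen (Subgroup.isOpen_of_mem_nhds T (g := 1) ?_),
    fun r hr => hr⟩
  -- For `r` near `1` both `x` and `x * r` have the same `n`-th power under `f`, and the image of
  -- `f` is commutative, so `f r ^ n = 1`.
  have h1 : (fun r : G => x * r) ⁻¹' interior ((fun r : G => r ^ n) ⁻¹'
      (out s • (commutatorSet G ^ k))) ∈ 𝓝 (1 : G) :=
    (continuous_const_mul x).continuousAt.preimage_mem_nhds
      (by rw [mul_one]; exact isOpen_interior.mem_nhds hx)
  refine Filter.mem_of_superset h1 fun r hr => ?_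
  have h2 := hmem _ hr
  have h3 := hmem _ hx
  rw [map_mul, (hcomm x r).mul_pow, h3] at h2
  exact mul_eq_left.mp h2

end CompactGroups

/-! ### Finite index subgroups with infinite abelianization -/

section InfiniteAbelianization

variable {G : Type u} [Group G] (R : Subgroup G)

theorem finiteIndex_map_mk [hRf : R.FiniteIndex] (N : Subgroup G) [N.Normal] :
    (R.map (QuotientGroup.mk' N)).FiniteIndex := ⟨fun h => hRf.index_ne_zero (by
  have := Subgroup.index_map_dvd R (QuotientGroup.mk'_surjective N)
  rw [h] at this
  exact Nat.eq_zero_of_zero_dvd this)⟩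

variable [hRn : R.Normal]

theorem map_commutator_comm : ∀ a ∈ R.map (QuotientGroup.mk' ⁅R, R⁆),
    ∀ b ∈ R.map (QuotientGroup.mk' ⁅R, R⁆), a * b = b * a := by
  rintro _ ⟨a, ha, rfl⟩ _ ⟨b, hb, rfl⟩
  have h1 : QuotientGroup.mk' ⁅R, R⁆ ⁅a, b⁆ = 1 :=
    (QuotientGroup.eq_one_iff _).mpr (Subgroup.commutator_mem_commutator ha hb)
  rw [map_commutatorElement] at h1
  exact commutatorElement_eq_one_iff_mul_comm.mp h1

theorem exists_normal_countable_index_of_commutator [hRf : R.FiniteIndex]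
    (hD : ⁅R, R⁆.index = 0) :
    ∃ N : Subgroup G, N.Normal ∧ Countable (G ⧸ N) ∧ N.index = 0 := by
  let π := QuotientGroup.mk' ⁅R, R⁆
  have hπ : Function.Surjective π := QuotientGroup.mk'_surjective _
  have := finiteIndex_map_mk R ⁅R, R⁆
  have : (R.map π).Normal := hRn.map π hπ
  obtain ⟨N, hNn, -, -, hNc, hNi⟩ := exists_normal_countable_index (A := R.map π)
    (map_commutator_comm R) (M := ⊥) bot_le (by rw [Subgroup.index_bot]; exact hD)
  refine ⟨N.comap π, inferInstance, ?_, ?_⟩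
  · refine Function.Injective.countable (f := QuotientGroup.map (N.comap π) N π le_rfl) ?_
    rw [← MonoidHom.ker_eq_bot_iff, QuotientGroup.ker_map, QuotientGroup.map_mk'_self]
  · rw [Subgroup.index_comap_of_surjective _ hπ, hNi]

variable [TopologicalSpace G] [IsTopologicalGroup G] [CompactSpace G] [T2Space G]

/-- Otherwise Baire category gives an `n` for which the `n`-th power map is trivial on a finite
index subgroup of `R` modulo `⁅R, R⁆`. The group of `n`-th powers is then finite and of finite
index, against `hD`. -/
theorem exists_pow_notMem_of_commutator (hRc : IsClosed (R : Set G)) (hD : ⁅R, R⁆.index = 0)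
    (hfin : ∀ n, 0 < n → (powersSubgroup (map_commutator_comm R) n).FiniteIndex)
    {S : Set (G ⧸ ⁅R, R⁆)} (hS : S.Countable) :
    ∃ a ∈ R.map (QuotientGroup.mk' ⁅R, R⁆), ∀ n : ℕ, 0 < n → a ^ n ∉ S := by
  by_contra! hcon
  have : CompactSpace R := isCompact_iff_compactSpace.mp hRc.isCompact
  let f : R →* G ⧸ ⁅R, R⁆ := (QuotientGroup.mk' ⁅R, R⁆).comp R.subtype
  have hf : f.ker = commutator R := by
    rw [← MonoidHom.comap_ker, QuotientGroup.ker_mk', ← Subgroup.map_subtype_commutator,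
      Subgroup.comap_map_eq_self_of_injective R.subtype_injective]
  obtain ⟨n, hn, T, hT, hTn⟩ := exists_finiteIndex_pow_eq_one f hf hS
    fun r => hcon (f r) ⟨r, r.2, rfl⟩
  have hPf := hfin n hn
  have hfinP : Finite (powersSubgroup (map_commutator_comm R) n) := by
    have : Finite (R ⧸ T) := Subgroup.finite_quotient_of_finiteIndex
    refine (Set.finite_range fun c : R ⧸ T => f (Quotient.out c) ^ n).subset ?_
    rintro _ ⟨_, ⟨r, hr, rfl⟩, rfl⟩
    refine ⟨QuotientGroup.mk ⟨r, hr⟩, ?_⟩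
    have h1 := hTn _ (QuotientGroup.eq.mp (QuotientGroup.out_eq' (QuotientGroup.mk ⟨r, hr⟩ : R ⧸ T)))
    have hmem : ∀ x : R, f x ∈ R.map (QuotientGroup.mk' ⁅R, R⁆) := fun x => ⟨x, x.2, rfl⟩
    rw [map_mul, map_inv, (Commute.mul_pow (map_commutator_comm R _ (inv_mem (hmem _)) _ (hmem _))),
      inv_pow, inv_mul_eq_one] at h1
    exact h1
  have h1 := Subgroup.index_mul_card (powersSubgroup (map_commutator_comm R) n)
  exact mul_ne_zero hPf.index_ne_zero (Nat.card_ne_zero.mpr ⟨⟨1⟩, hfinP⟩) (h1.trans hD)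

theorem not_uncountableCofinality_and_not_cayleyBounded [hRf : R.FiniteIndex]
    (hRc : IsClosed (R : Set G)) (hD : ⁅R, R⁆.index = 0) : ¬ UncountableCofinality G ∧ ¬ CayleyBounded G := by
  let π := QuotientGroup.mk' ⁅R, R⁆
  have hπ : Function.Surjective π := QuotientGroup.mk'_surjective _
  have hf1 := finiteIndex_map_mk R ⁅R, R⁆
  have hn1 : (R.map π).Normal := hRn.map π hπ
  by_cases hfin : ∀ n, 0 < n → (powersSubgroup (map_commutator_comm R) n).FiniteIndex
  · obtain ⟨φ, hφ⟩ := exists_rationalFunctional (map_commutator_comm R) hfin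
      fun S hS => exists_pow_notMem_of_commutator R hRc hD hfin hS
    exact ⟨fun h => hφ.not_uncountableCofinality (h.of_surjective π hπ),
      fun h => hφ.not_cayleyBounded (h.of_surjective π hπ)⟩
  · push Not at hfin
    obtain ⟨n, hn, hidx⟩ := hfin
    obtain ⟨N, hN, K, hK⟩ := exists_independentLayers_quotient (map_commutator_comm R) hn
      (by rwa [Subgroup.not_finiteIndex_iff] at hidx)
    have hπ' := QuotientGroup.mk'_surjective N
    have hf2 := finiteIndex_map_mk (R.map π) N
    have hn2 : ((R.map π).map (QuotientGroup.mk' N)).Normal := hn1.map _ hπ'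
    exact ⟨fun h => hK.not_uncountableCofinality ((h.of_surjective π hπ).of_surjective _ hπ'),
      fun h => hK.not_cayleyBounded ((h.of_surjective π hπ).of_surjective _ hπ')⟩

end InfiniteAbelianization

/-! ### Vertices of the rooted tree -/

section Vertices

variable {α : ℕ → ℕ}

theorem Below.refl (v : Vertex α) : Below v v := ⟨le_rfl, fun _ => rfl⟩

theorem Below.level_le {v w : Vertex α} (h : Below v w) : level v ≤ level w := h.1

theorem Below.trans {u v w : Vertex α} (huv : Below u v) (hvw : Below v w) : Below u w := by
  obtain ⟨h1, h2⟩ := huv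
  obtain ⟨h3, h4⟩ := hvw
  exact ⟨h1.trans h3, fun i => (h4 (Fin.castLE h1 i)).trans (h2 i)⟩

theorem Below.eq_of_level_le {v w : Vertex α} (h : Below v w) (hl : level w ≤ level v) :
    v = w := by
  obtain ⟨n, f⟩ := v
  obtain ⟨m, g⟩ := w
  obtain ⟨h1, h2⟩ := h
  obtain rfl : n = m := le_antisymm h1 hl
  congr 1
  funext i
  exact (h2 i).symm

theorem Below.of_common {u v w : Vertex α} (hu : Below u w) (hv : Below v w)
    (h : level u ≤ level v) : Below u v := by
  obtain ⟨h1, h2⟩ := hu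
  obtain ⟨h3, h4⟩ := hv
  exact ⟨h, fun i => (h4 (Fin.castLE h i)).symm.trans (h2 i)⟩

theorem Below.comparable {u v w : Vertex α} (hu : Below u w) (hv : Below v w) :
    Below u v ∨ Below v u :=
  (le_total (level u) (level v)).imp (hu.of_common hv) (hv.of_common hu)

instance finite_level (n : ℕ) : Finite {v : Vertex α // level v = n} := by
  refine Finite.of_surjective (fun f : ∀ i : Fin n, Fin (α i) => ⟨⟨n, f⟩, rfl⟩) ?_
  rintro ⟨⟨m, f⟩, rfl⟩
  exact ⟨f, rfl⟩

/-- The vertex on level `n` of the ray `x`. -/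
def trunc (n : ℕ) (x : ∀ i : ℕ, Fin (α i)) : Vertex α := ⟨n, fun i => x i⟩

theorem below_trunc_iff {m n : ℕ} {x y : ∀ i : ℕ, Fin (α i)} :
    Below (trunc m x) (trunc n y) ↔ m ≤ n ∧ ∀ i < m, x i = y i := by
  constructor
  · rintro ⟨h1, h2⟩
    exact ⟨h1, fun i hi => (h2 ⟨i, hi⟩).symm⟩
  · rintro ⟨h1, h2⟩
    exact ⟨h1, fun i => (h2 i i.2).symm⟩

theorem exists_eq_trunc (hα : ∀ i, 2 ≤ α i) (v : Vertex α) :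
    ∃ x : ∀ i : ℕ, Fin (α i), v = trunc (level v) x := by
  refine ⟨fun i => if h : i < v.1 then v.2 ⟨i, h⟩ else ⟨0, by have := hα i; omega⟩, ?_⟩
  obtain ⟨n, f⟩ := v
  simp only [trunc, level]
  congr 1
  funext i
  simp

theorem exists_below_level (hα : ∀ i, 2 ≤ α i) (v : Vertex α) {m : ℕ} (hm : level v ≤ m) :
    ∃ w, Below v w ∧ level w = m := by
  obtain ⟨x, hx⟩ := exists_eq_trunc hα v
  refine ⟨trunc m x, ?_, rfl⟩
  rw [hx]
  exact below_trunc_iff.mpr ⟨hm, fun _ _ => rfl⟩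

theorem exists_above_level (hα : ∀ i, 2 ≤ α i) (v : Vertex α) {m : ℕ} (hm : m ≤ level v) :
    ∃ w, Below w v ∧ level w = m := by
  obtain ⟨x, hx⟩ := exists_eq_trunc hα v
  refine ⟨trunc m x, ?_, rfl⟩
  rw [hx]
  exact below_trunc_iff.mpr ⟨hm, fun _ _ => rfl⟩

/-- Below every vertex there is an infinite sequence of pairwise incomparable vertices. -/
theorem exists_incomparable_sequence (hα : ∀ i, 2 ≤ α i) (u : Vertex α) :
    ∃ w : ℕ → Vertex α, (∀ k, Below u (w k)) ∧ ∀ k l, k ≠ l → ¬ Below (w k) (w l) := by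
  obtain ⟨x, hx⟩ := exists_eq_trunc hα u
  have hex : ∀ i, ∃ b : Fin (α i), b ≠ x i := fun i =>
    have := Fin.nontrivial_iff_two_le.mpr (hα i)
    exists_ne (x i)
  choose y hy using hex
  -- Along a ray `x` through `u`, the vertex `w k` leaves the ray exactly at level `level u + k`.
  refine ⟨fun k => trunc (level u + k + 1) (Function.update x (level u + k) (y _)), fun k => ?_,
    fun k l hkl h => ?_⟩
  · conv_lhs => rw [hx]
    refine below_trunc_iff.mpr ⟨by omega, fun i hi => ?_⟩
    rw [Function.update_of_ne (by omega)]
  · obtain ⟨h1, h2⟩ := below_trunc_iff.mp h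
    have h3 := h2 (level u + k) (by omega)
    rw [Function.update_self, Function.update_of_ne (by omega)] at h3
    exact hy _ h3

end Vertices

/-! ### Rigid stabilizers and branch actions -/

section BranchActions

/-- The elements of `G` that fix every vertex outside the subtree hanging at `v`. -/
def rigid (G : Type u) [Group G] {α : ℕ → ℕ} [MulAction G (Vertex α)] (v : Vertex α) :
    Subgroup G where
  carrier := {g | ∀ w, ¬ Below v w → g • w = w}
  one_mem' := fun w _ => one_smul _ w
  mul_mem' := fun {a b} ha hb w hw => by rw [mul_smul, hb w hw, ha w hw]
  inv_mem' := fun {a} ha w hw => by rw [inv_smul_eq_iff, ha w hw]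

/-- The subgroup generated by the rigid stabilizers of the vertices on level `n`. -/
def rigidLevel (G : Type u) [Group G] (α : ℕ → ℕ) [MulAction G (Vertex α)] (n : ℕ) : Subgroup G :=
  ⨆ v : {v : Vertex α // level v = n}, rigid G v.1

/-- The action of a profinite branch group on its tree. -/
structure BranchAction (G : Type u) [Group G] [TopologicalSpace G] (α : ℕ → ℕ)
    [MulAction G (Vertex α)] : Prop where
  two_le : ∀ i, 2 ≤ α i
  faithful : ∀ g : G, (∀ v : Vertex α, g • v = v) → g = 1
  isOpen_fiber : ∀ v w : Vertex α, IsOpen {g : G | g • v = w}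
  level_smul : ∀ (g : G) (v : Vertex α), level (g • v) = level v
  below_smul : ∀ (g : G) (v w : Vertex α), Below v w → Below (g • v) (g • w)
  transitive : ∀ v w : Vertex α, level v = level w → ∃ g : G, g • v = w
  finiteIndex : ∀ n, (rigidLevel G α n).FiniteIndex

variable {G : Type u} [Group G] {α : ℕ → ℕ} [MulAction G (Vertex α)]

theorem below_smul_of_mem_rigid {l : G} {v w : Vertex α} (hl : l ∈ rigid G v) (h : Below v w) :
    Below v (l • w) := by
  by_contra hn
  have h1 : l • l • w = l • w := hl _ hn
  rw [smul_left_cancel_iff] at h1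
  rw [h1] at hn
  exact hn h

theorem rigid_mono {v w : Vertex α} (h : Below v w) : rigid G w ≤ rigid G v :=
  fun _ hg x hx => hg x fun hwx => hx (h.trans hwx)

/-- Products of elements of rigid stabilizers of pairwise incomparable vertices. -/
theorem prod_smul_of_incomparable {ι : Type*} {w : ι → Vertex α}
    (hw : ∀ i j, i ≠ j → ¬ Below (w i) (w j)) {z : ι → G} (hz : ∀ i, z i ∈ rigid G (w i))
    (L : List ι) (hL : L.Nodup) :
    (∀ i ∈ L, ∀ x, Below (w i) x → (L.map z).prod • x = z i • x) ∧
      ∀ x, (∀ i ∈ L, ¬ Below (w i) x) → (L.map z).prod • x = x := by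
  have hdisj : ∀ i j x, i ≠ j → Below (w i) x → ¬ Below (w j) x := fun i j x hij hi hj =>
    (hi.comparable hj).elim (hw i j hij) (hw j i hij.symm)
  induction L with
  | nil => simp
  | cons j L ih =>
    obtain ⟨hj, hL⟩ := List.nodup_cons.mp hL
    obtain ⟨ih1, ih2⟩ := ih hL
    refine ⟨fun i hi x hx => ?_, fun x hx => ?_⟩
    · rw [List.map_cons, List.prod_cons, mul_smul]
      rcases List.mem_cons.mp hi with rfl | hi
      · rw [ih2 x fun k hk => hdisj i k x (fun h => hj (h ▸ hk)) hx]
      · rw [ih1 i hi x hx]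
        exact hz j _ (hdisj i j _ (fun h => hj (h ▸ hi)) (below_smul_of_mem_rigid (hz i) hx))
    · rw [List.map_cons, List.prod_cons, mul_smul, ih2 x fun i hi => hx i (List.mem_cons_of_mem _ hi)]
      exact hz j _ (hx j List.mem_cons_self)

theorem list_prod_mem_pow {ι : Type*} {Y : Set G} {z : ι → G} (L : List ι)
    (h : ∀ i ∈ L, z i ∈ Y) : (L.map z).prod ∈ Y ^ L.length := by
  induction L with
  | nil => simp
  | cons j L ih =>
    rw [List.map_cons, List.prod_cons, List.length_cons, pow_succ']
    exact Set.mul_mem_mul (h j List.mem_cons_self) (ih fun i hi => h i (List.mem_cons_of_mem _ hi))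

theorem exists_agree_of_mem_rigidLevel {n : ℕ} {s : G} (hs : s ∈ rigidLevel G α n) :
    (∀ v : Vertex α, level v = n → ∃ l ∈ rigid G v, ∀ w, Below v w → s • w = l • w) ∧
      ∀ w : Vertex α, level w < n → s • w = w := by
  induction hs using Subgroup.iSup_induction' with
  | hp v x hx =>
    refine ⟨fun v' hv' => ?_, fun w hw => hx w fun h => ?_⟩
    · by_cases h : v.1 = v'
      · exact ⟨x, h ▸ hx, fun _ _ => rfl⟩
      · refine ⟨1, one_mem _, fun w hw => ?_⟩
        rw [one_smul]
        exact hx w fun h' => h ((h'.of_common hw (v.2.trans hv'.symm).le).eq_of_level_le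
          (hv'.trans v.2.symm).le)
    · have h1 := h.level_le
      have h2 := v.2
      omega
  | h1 => exact ⟨fun v _ => ⟨1, one_mem _, fun _ _ => rfl⟩, fun w _ => one_smul _ w⟩
  | hmul x y _ _ hx hy =>
    refine ⟨fun v hv => ?_, fun w hw => by rw [mul_smul, hy.2 w hw, hx.2 w hw]⟩
    obtain ⟨l, hl, hlx⟩ := hx.1 v hv
    obtain ⟨k, hk, hky⟩ := hy.1 v hv
    refine ⟨l * k, mul_mem hl hk, fun w hw => ?_⟩
    rw [mul_smul, mul_smul, hky w hw, hlx _ (below_smul_of_mem_rigid hk hw)]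

end BranchActions

/-! ### Commutators of rigid stabilizers and normal subgroups -/

namespace BranchAction

variable {G : Type u} [Group G] [TopologicalSpace G] {α : ℕ → ℕ} [MulAction G (Vertex α)]

theorem ext (h : BranchAction G α) {g k : G} (hgk : ∀ v : Vertex α, g • v = k • v) : g = k := by
  have := h.faithful (k⁻¹ * g) fun v => by rw [mul_smul, hgk, inv_smul_smul]
  exact (inv_mul_eq_one.mp this).symm

theorem conj_mem_rigid (h : BranchAction G α) {v : Vertex α} {l : G} (hl : l ∈ rigid G v) (g : G) :
    g * l * g⁻¹ ∈ rigid G (g • v) := by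
  intro w hw
  have h1 : ¬ Below v (g⁻¹ • w) := fun hb => hw (by simpa using h.below_smul g _ _ hb)
  rw [mul_smul, mul_smul, hl _ h1, smul_inv_smul]

theorem mem_rigid_of_smul (h : BranchAction G α) {v : Vertex α} (g : G) {l : G}
    (hl : l ∈ rigid G (g • v)) : ∃ k ∈ rigid G v, l = g * k * g⁻¹ := by
  refine ⟨g⁻¹ * l * g⁻¹⁻¹, ?_, by group⟩
  simpa using h.conj_mem_rigid hl g⁻¹

theorem rigidLevel_normal (h : BranchAction G α) (n : ℕ) : (rigidLevel G α n).Normal := by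
  refine ⟨fun s hs g => ?_⟩
  induction hs using Subgroup.iSup_induction' with
  | hp v x hx =>
    exact Subgroup.mem_iSup_of_mem (⟨g • v.1, (h.level_smul g v.1).trans v.2⟩ :
      {v : Vertex α // level v = n}) (h.conj_mem_rigid hx g)
  | h1 => simp [one_mem]
  | hmul x y _ _ hx hy => rw [← conj_mul]; exact mul_mem hx hy

/-- Below `v` the elements `a`, `b` act as `l`, `k`. Outside, no vertex is moved by both, so they
commute there and the commutator sees only the part below `v`. -/
theorem commutator_eq (h : BranchAction G α) {v : Vertex α} {a b l k : G} (hl : l ∈ rigid G v)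
    (hk : k ∈ rigid G v) (ha : ∀ w, Below v w → a • w = l • w)
    (hb : ∀ w, Below v w → b • w = k • w) (hout : ∀ w, ¬ Below v w → a • w = w ∨ b • w = w) :
    ⁅l, k⁆ = ⁅a, b⁆ := by
  have hstay : ∀ {c m : G}, m ∈ rigid G v → (∀ w, Below v w → c • w = m • w) → ∀ w,
      ¬ Below v w → ¬ Below v (c • w) := by
    intro c m hm hc w hw hcw
    have h1 := below_smul_of_mem_rigid (inv_mem hm) hcw
    have h2 := hc _ h1
    rw [smul_inv_smul, smul_left_cancel_iff] at h2
    rw [h2] at h1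
    exact hw h1
  have hc : ⁅l, k⁆ ∈ rigid G v := by
    rw [commutatorElement_def]
    exact mul_mem (mul_mem (mul_mem hl hk) (inv_mem hl)) (inv_mem hk)
  have key : a * b = ⁅l, k⁆ * (b * a) := by
    refine h.ext fun w => ?_
    by_cases hw : Below v w
    · have hlw := below_smul_of_mem_rigid hl hw
      have hkw := below_smul_of_mem_rigid hk hw
      rw [mul_smul, mul_smul ⁅l, k⁆, mul_smul, hb w hw, ha w hw, ha _ hkw, hb _ hlw,
        commutatorElement_def]
      simp only [mul_smul, inv_smul_smul]
    · have hab : a • b • w = b • a • w := by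
        rcases hout w hw with h1 | h1
        · rw [h1]
          by_cases h2 : b • w = w
          · rw [h2, h1]
          · refine (hout _ (hstay hk hb w hw)).resolve_right fun h3 => h2 ?_
            rwa [smul_left_cancel_iff] at h3
        · rw [h1]
          by_cases h2 : a • w = w
          · rw [h2, h1]
          · refine ((hout _ (hstay hl ha w hw)).resolve_left fun h3 => h2 ?_).symm
            rwa [smul_left_cancel_iff] at h3
      rw [mul_smul, mul_smul ⁅l, k⁆, mul_smul, hab]
      refine (hc _ ?_).symm
      exact hstay hk hb _ (hstay hl ha w hw)
  rw [commutatorElement_def a b, key]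
  group

/-- A commutator in `rigidLevel` is the product of its components. -/
theorem commutator_eq_list_prod (h : BranchAction G α) {n : ℕ} {s t : G}
    (hs : s ∈ rigidLevel G α n) (ht : t ∈ rigidLevel G α n)
    (L : List {v : Vertex α // level v = n}) (hL : L.Nodup) (hmem : ∀ v, v ∈ L) :
    ∃ z : {v : Vertex α // level v = n} → G,
      (∀ v, ∃ l ∈ rigid G v.1, ∃ k ∈ rigid G v.1, z v = ⁅l, k⁆) ∧ ⁅s, t⁆ = (L.map z).prod := by
  obtain ⟨hs1, hs2⟩ := exists_agree_of_mem_rigidLevel hs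
  obtain ⟨ht1, ht2⟩ := exists_agree_of_mem_rigidLevel ht
  choose a ha hsa using fun v : {v : Vertex α // level v = n} => hs1 v.1 v.2
  choose b hb htb using fun v : {v : Vertex α // level v = n} => ht1 v.1 v.2
  have hz : ∀ v, ⁅a v, b v⁆ ∈ rigid G v.1 := fun v => by
    rw [commutatorElement_def]
    exact mul_mem (mul_mem (mul_mem (ha v) (hb v)) (inv_mem (ha v))) (inv_mem (hb v))
  refine ⟨fun v => ⁅a v, b v⁆, fun v => ⟨a v, ha v, b v, hb v, rfl⟩, ?_⟩
  have hinc : ∀ i j : {v : Vertex α // level v = n}, i ≠ j → ¬ Below i.1 j.1 := fun i j hij hb =>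
    hij (Subtype.ext (hb.eq_of_level_le (j.2.trans i.2.symm).le))
  obtain ⟨hp1, hp2⟩ := prod_smul_of_incomparable hinc hz L hL
  have hinv : ∀ {c m : G} {v w : Vertex α}, m ∈ rigid G v →
      (∀ w, Below v w → c • w = m • w) → Below v w → c⁻¹ • w = m⁻¹ • w := by
    intro c m v w hm hc hw
    rw [inv_smul_eq_iff, hc _ (below_smul_of_mem_rigid (inv_mem hm) hw), smul_inv_smul]
  refine h.ext fun w => ?_
  by_cases hw : n ≤ level w
  · obtain ⟨v, hvw, hv⟩ := exists_above_level h.two_le w hw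
    have hav := ha ⟨v, hv⟩
    have hbv := hb ⟨v, hv⟩
    have h1 : Below v ((b ⟨v, hv⟩)⁻¹ • w) := below_smul_of_mem_rigid (inv_mem hbv) hvw
    have h2 := below_smul_of_mem_rigid (inv_mem hav) h1
    have h3 := below_smul_of_mem_rigid hbv h2
    rw [hp1 ⟨v, hv⟩ (hmem _) w hvw, commutatorElement_def, commutatorElement_def]
    simp only [mul_smul]
    rw [hinv hbv (htb ⟨v, hv⟩) hvw, hinv hav (hsa ⟨v, hv⟩) h1, htb ⟨v, hv⟩ _ h2, hsa ⟨v, hv⟩ _ h3]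
  · have hw' : level w < n := not_le.mp hw
    rw [hp2 w fun v _ hb => hw (v.2.symm.le.trans hb.level_le), commutatorElement_def]
    simp only [mul_smul]
    rw [inv_smul_eq_iff.mpr (ht2 w hw').symm, inv_smul_eq_iff.mpr (hs2 w hw').symm, ht2 w hw',
      hs2 w hw']

theorem commutator_le_of_forall (h : BranchAction G α) {n : ℕ} {N : Subgroup G}
    (hN : ∀ v : Vertex α, level v = n → ∀ l ∈ rigid G v, ∀ k ∈ rigid G v, ⁅l, k⁆ ∈ N) :
    ⁅rigidLevel G α n, rigidLevel G α n⁆ ≤ N := by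
  have := Fintype.ofFinite {v : Vertex α // level v = n}
  rw [Subgroup.commutator_le]
  intro s hs t ht
  obtain ⟨z, hz, hst⟩ := h.commutator_eq_list_prod hs ht Finset.univ.toList
    (Finset.nodup_toList _) (fun v => by simp)
  rw [hst]
  refine Subgroup.list_prod_mem _ fun x hx => ?_
  obtain ⟨v, -, rfl⟩ := List.mem_map.mp hx
  obtain ⟨l, hl, k, hk, he⟩ := hz v
  rw [he]
  exact hN v.1 v.2 l hl k hk

/-- A normal subgroup containing an element that moves `v` contains the commutators of the rigid
stabilizer of `v`. -/
theorem commutator_mem_of_normal {N : Subgroup G} (hN : N.Normal) {g : G} (hg : g ∈ N)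
    (h : BranchAction G α) {v : Vertex α} (hgv : g • v ≠ v) {a b : G} (ha : a ∈ rigid G v)
    (hb : b ∈ rigid G v) : ⁅a, b⁆ ∈ N := by
  have hinc : ∀ w, Below v w → ¬ Below (g • v) w := fun w h1 h2 =>
    hgv (h1.of_common h2 (h.level_smul g v).symm.le |>.eq_of_level_le (h.level_smul g v).le).symm
  have hc : ⁅a, g⁆ ∈ N := by
    rw [commutatorElement_def]
    exact mul_mem (hN.conj_mem g hg a) (inv_mem hg)
  have hconj : g * a⁻¹ * g⁻¹ ∈ rigid G (g • v) := h.conj_mem_rigid (inv_mem ha) g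
  -- The commutator of `a` and `g` is `a` times an element supported below `g • v`, which is
  -- disjoint from the subtree at `v`; so it acts as `a` where `b` lives.
  have heq : ⁅a, b⁆ = ⁅⁅a, g⁆, b⁆ := by
    refine h.commutator_eq ha hb (fun w hw => ?_) (fun w _ => rfl) (fun w hw => Or.inr (hb w hw))
    have h1 : ⁅a, g⁆ = a * (g * a⁻¹ * g⁻¹) := by rw [commutatorElement_def]; group
    rw [h1, mul_smul, hconj _ (hinc w hw)]
  rw [heq, commutatorElement_def ⁅a, g⁆ b]
  have h2 := hN.conj_mem _ (inv_mem hc) b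
  have h3 := mul_mem hc h2
  simpa only [mul_assoc] using h3

theorem exists_commutator_rigidLevel_le (h : BranchAction G α) {N : Subgroup G} (hN : N.Normal)
    (hne : N ≠ ⊥) : ∃ n, (∀ v : Vertex α, level v = n → ∀ l ∈ rigid G v, ∀ k ∈ rigid G v,
      ⁅l, k⁆ ∈ N) ∧ ⁅rigidLevel G α n, rigidLevel G α n⁆ ≤ N := by
  obtain ⟨⟨g, hg⟩, hg1⟩ := Subgroup.ne_bot_iff_exists_ne_one.mp hne
  obtain ⟨v, hv⟩ : ∃ v : Vertex α, g • v ≠ v := by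
    by_contra! hcon
    exact hg1 (Subtype.ext (h.faithful g hcon))
  have key : ∀ w : Vertex α, level w = level v → ∀ l ∈ rigid G w, ∀ k ∈ rigid G w, ⁅l, k⁆ ∈ N := by
    intro w hw l hl k hk
    obtain ⟨t, rfl⟩ := h.transitive v w hw.symm
    refine commutator_mem_of_normal hN (hN.conj_mem g hg t) h (fun h1 => hv ?_) hl hk
    rw [mul_smul, mul_smul, inv_smul_smul, smul_left_cancel_iff] at h1
    exact h1
  exact ⟨level v, key, h.commutator_le_of_forall key⟩

theorem infinite (h : BranchAction G α) : Infinite G := by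
  obtain ⟨w, -, hw⟩ := exists_incomparable_sequence h.two_le (root α)
  by_contra hfin
  rw [not_infinite_iff_finite] at hfin
  have hcard : ∀ n, Nat.card {v : Vertex α // level v = n} ≤ Nat.card G := fun n => by
    obtain ⟨v, -, hv⟩ := exists_below_level h.two_le (root α) (Nat.zero_le n)
    refine Nat.card_le_card_of_surjective
      (fun g : G => (⟨g • v, (h.level_smul g v).trans hv⟩ : {v : Vertex α // level v = n})) ?_
    rintro ⟨x, hx⟩
    obtain ⟨g, hg⟩ := h.transitive v x (hv.trans hx.symm)
    exact ⟨g, Subtype.ext hg⟩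
  let M := Nat.card G + 1
  obtain ⟨m, hm⟩ := ((Set.finite_range fun i : Fin M => level (w i))).bddAbove
  choose x hx1 hx2 using fun i : Fin M =>
    exists_below_level h.two_le (w i) (m := m) (hm ⟨i, rfl⟩)
  have hinj : Function.Injective fun i : Fin M => (⟨x i, hx2 i⟩ : {v : Vertex α // level v = m}) := by
    intro i j hij
    by_contra hne
    have h1 : x i = x j := congrArg Subtype.val hij
    have hne' : (i : ℕ) ≠ j := fun h => hne (Fin.ext h)
    rcases (hx1 i).comparable (h1 ▸ hx1 j) with h2 | h2
    · exact hw _ _ hne' h2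
    · exact hw _ _ hne'.symm h2
  have h2 := Nat.card_le_card_of_injective _ hinj
  rw [Nat.card_eq_fintype_card, Fintype.card_fin] at h2
  have h3 := hcard m
  omega

theorem rigid_ne_bot (h : BranchAction G α) (v : Vertex α) : rigid G v ≠ ⊥ := by
  intro hv
  have h1 : rigidLevel G α (level v) = ⊥ := by
    refine iSup_eq_bot.mpr fun w => ?_
    obtain ⟨g, hg⟩ := h.transitive v w.1 w.2.symm
    refine (Subgroup.eq_bot_iff_forall _).mpr fun l hl => ?_
    rw [← hg] at hl
    obtain ⟨k, hk, rfl⟩ := h.mem_rigid_of_smul g hl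
    rw [hv, Subgroup.mem_bot] at hk
    rw [hk]
    group
  have h2 := h.infinite
  have h3 := (h.finiteIndex (level v)).index_ne_zero
  rw [h1, Subgroup.index_bot] at h3
  exact h3 Nat.card_eq_zero_of_infinite

/-- If the rigid stabilizer of `v` were abelian, an element `g` of it moving `w` would centralize
the rigid stabilizer of `w` and also carry it into that of `g • w`. That makes it trivial,
contradicting `rigid_ne_bot`. -/
theorem exists_commutator_ne_one (h : BranchAction G α) (v : Vertex α) :
    ∃ l ∈ rigid G v, ∃ k ∈ rigid G v, ⁅l, k⁆ ≠ 1 := by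
  by_contra! hcon
  obtain ⟨⟨g, hg⟩, hg1⟩ := Subgroup.ne_bot_iff_exists_ne_one.mp (h.rigid_ne_bot v)
  obtain ⟨w, hw⟩ : ∃ w : Vertex α, g • w ≠ w := by
    by_contra! hall
    exact hg1 (Subtype.ext (h.faithful g hall))
  have hvw : Below v w := by
    by_contra hn
    exact hw (hg w hn)
  refine h.rigid_ne_bot w ((Subgroup.eq_bot_iff_forall _).mpr fun k hk => h.faithful k fun x => ?_)
  by_cases hx : Below w x
  · have h1 : ¬ Below (g • w) x := fun h2 =>
      hw (hx.of_common h2 (h.level_smul g w).symm.le |>.eq_of_level_le (h.level_smul g w).le).symm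
    have h3 := commutatorElement_eq_one_iff_mul_comm.mp (hcon g hg k (rigid_mono hvw hk))
    have h4 := h.conj_mem_rigid hk g x h1
    rwa [h3, mul_inv_cancel_right] at h4
  · exact hk x hx

theorem commutator_rigidLevel_ne_bot (h : BranchAction G α) (n : ℕ) :
    ⁅rigidLevel G α n, rigidLevel G α n⁆ ≠ ⊥ := by
  obtain ⟨v, -, hv⟩ := exists_below_level h.two_le (root α) (Nat.zero_le n)
  obtain ⟨l, hl, k, hk, hlk⟩ := h.exists_commutator_ne_one v
  intro hbot
  have hle : rigid G v ≤ rigidLevel G α n :=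
    le_iSup (fun v : {v : Vertex α // level v = n} => rigid G v.1) ⟨v, hv⟩
  have h1 := Subgroup.commutator_mem_commutator (hle hl) (hle hk)
  rw [hbot, Subgroup.mem_bot] at h1
  exact hlk h1

theorem infinite_of_normal (h : BranchAction G α) {N : Subgroup G} (hN : N.Normal) (hne : N ≠ ⊥) :
    Infinite N := by
  obtain ⟨n, hn, -⟩ := h.exists_commutator_rigidLevel_le hN hne
  obtain ⟨v, -, hv⟩ := exists_below_level h.two_le (root α) (Nat.zero_le n)
  obtain ⟨w, hvw, hw⟩ := exists_incomparable_sequence h.two_le v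
  choose l hl k hk hlk using fun i => h.exists_commutator_ne_one (w i)
  refine Infinite.of_injective (fun i : ℕ => (⟨⁅l i, k i⁆, hn v hv _ (rigid_mono (hvw i) (hl i)) _
    (rigid_mono (hvw i) (hk i))⟩ : N)) fun i j hij => ?_
  by_contra hne
  have hmem : ∀ i, ⁅l i, k i⁆ ∈ rigid G (w i) := fun i => by
    rw [commutatorElement_def]
    exact mul_mem (mul_mem (mul_mem (hl i) (hk i)) (inv_mem (hl i))) (inv_mem (hk i))
  have heq : ⁅l i, k i⁆ = ⁅l j, k j⁆ := congrArg Subtype.val hij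
  refine hlk i (h.faithful _ fun x => ?_)
  by_cases hx : Below (w i) x
  · rw [heq]
    refine hmem j x fun hx' => ?_
    exact (hx.comparable hx').elim (hw i j hne) (hw j i (Ne.symm hne))
  · exact hmem i x hx

end BranchAction

theorem countable_quotient_commutator {G : Type u} [Group G] {R : Subgroup G}
    (hR : (⁅R, R⁆ : Subgroup G).index ≠ 0) : Countable (R ⧸ commutator R) := by
  rw [← Subgroup.map_subtype_commutator, Subgroup.index_map_subtype] at hR
  have : (commutator R).FiniteIndex := ⟨left_ne_zero_of_mul hR⟩
  have := Subgroup.finite_quotient_of_finiteIndex (H := commutator R)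
  infer_instance

/-! ### Compactness, gluing and countable covers -/

namespace BranchAction

variable {G : Type u} [Group G] [TopologicalSpace G] {α : ℕ → ℕ} [MulAction G (Vertex α)]

theorem t2Space (h : BranchAction G α) : T2Space G := by
  refine ⟨fun g k hgk => ?_⟩
  obtain ⟨v, hv⟩ : ∃ v : Vertex α, g • v ≠ k • v := by
    by_contra! hcon
    exact hgk (h.ext hcon)
  refine ⟨_, _, h.isOpen_fiber v (g • v), h.isOpen_fiber v (k • v), rfl, rfl, ?_⟩
  rw [Set.disjoint_left]
  intro x hx hy
  exact hv (hx.symm.trans hy)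

theorem isClosed_fiber (h : BranchAction G α) (v w : Vertex α) : IsClosed {g : G | g • v = w} := by
  rw [← isOpen_compl_iff]
  have : {g : G | g • v = w}ᶜ = ⋃ x : {x : Vertex α // x ≠ w}, {g : G | g • v = x} := by
    ext g
    simp
  rw [this]
  exact isOpen_iUnion fun x => h.isOpen_fiber v x

theorem isClosed_rigid (h : BranchAction G α) (v : Vertex α) : IsClosed (rigid G v : Set G) := by
  have : (rigid G v : Set G) = ⋂ w : {w : Vertex α // ¬ Below v w}, {g : G | g • w.1 = w.1} := by
    ext g
    simp [rigid]
  rw [this]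
  exact isClosed_iInter fun w => h.isClosed_fiber _ _

variable [CompactSpace G]

/-- Infinite products of elements of rigid stabilizers of pairwise incomparable vertices. -/
theorem exists_infinite_product (h : BranchAction G α) {w : ℕ → Vertex α}
    (hw : ∀ i j, i ≠ j → ¬ Below (w i) (w j)) {z : ℕ → G} (hz : ∀ i, z i ∈ rigid G (w i)) :
    ∃ c : G, (∀ i x, Below (w i) x → c • x = z i • x) ∧
      ∀ x, (∀ i, ¬ Below (w i) x) → c • x = x := by
  let P : ℕ → G := fun n => ((List.range n).map z).prod
  -- On each vertex the finite partial products are eventually constant, and the sets with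
  -- prescribed image of a vertex are open, so any cluster point has the required action.
  obtain ⟨c, hc⟩ := exists_clusterPt_of_compactSpace (Filter.map P Filter.atTop)
  have hc' : MapClusterPt c Filter.atTop P := hc
  have key : ∀ x y : Vertex α, (∀ᶠ n in Filter.atTop, P n • x = y) → c • x = y := by
    intro x y hxy
    have h1 : {g : G | g • x = c • x} ∈ 𝓝 c := (h.isOpen_fiber x (c • x)).mem_nhds rfl
    obtain ⟨n, hn1, hn2⟩ := ((mapClusterPt_iff_frequently.mp hc' _ h1).and_eventually hxy).exists
    exact hn1.symm.trans hn2
  have hP : ∀ n, _ := fun n => prod_smul_of_incomparable hw hz (List.range n) List.nodup_range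
  refine ⟨c, fun i x hx => key _ _ ?_, fun x hx => key _ _ ?_⟩
  · filter_upwards [Filter.eventually_gt_atTop i] with n hn
    exact (hP n).1 i (List.mem_range.mpr hn) x hx
  · exact Filter.Eventually.of_forall fun n => (hP n).2 x fun i _ => hx i

/-- In every countable cover of `G`, some member contains elements with arbitrary components at
all vertices of one block of a sequence of pairwise incomparable vertices. -/
theorem exists_block_in_cover (h : BranchAction G α) {w : ℕ → Vertex α}
    (hw : ∀ i j, i ≠ j → ¬ Below (w i) (w j)) {C : ℕ → Set G} (hC : ⋃ n, C n = Set.univ)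
    (block : ℕ → ℕ) : ∃ n, ∀ z : ℕ → G, (∀ i, z i ∈ rigid G (w i)) → ∃ c ∈ C n,
      (∀ i, block i = n → ∀ x, Below (w i) x → c • x = z i • x) ∧
      ∀ x, (∀ i, ¬ Below (w i) x) → c • x = x := by
  by_contra! hcon
  choose z hz hbad using hcon
  -- If `C n` omits the pattern `z n` on block `n` for every `n`, the element following all these
  -- patterns at once lies in no `C n`.
  obtain ⟨c, hc1, hc2⟩ := h.exists_infinite_product hw (z := fun i => z (block i) i)
    fun i => hz _ i
  obtain ⟨n, hn⟩ := Set.mem_iUnion.mp (hC.symm.subset (Set.mem_univ c))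
  obtain ⟨x, hx, hne⟩ := hbad n c hn fun i hi x hx => by rw [hc1 i x hx, hi]
  exact hne (hc2 x hx)

/-- The vertices are indexed by pairs. The first application finds a row `n` on which elements of `C
n` have arbitrary components. The second, to the vertices of this row one at a time, finds `m` such
that `C m` realizes every component at vertex `(n, m)` by elements that are trivial off the row. The
quotients `a` and `b` have components `l` and `k` at that vertex; elsewhere `a` is trivial on the
row and `b` off it, so `commutator_eq` applies. -/
theorem exists_commutators_in_cover (h : BranchAction G α) (u : Vertex α) {C : ℕ → Set G}
    (hC : ⋃ n, C n = Set.univ) : ∃ w, Below u w ∧ ∃ n m, ∀ l ∈ rigid G w, ∀ k ∈ rigid G w,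
      ∃ a ∈ (C n)⁻¹ * C n, ∃ b ∈ (C m)⁻¹ * C m, ⁅l, k⁆ = ⁅a, b⁆ := by
  classical
  obtain ⟨w, huw, hw⟩ := exists_incomparable_sequence h.two_le u
  have hdisj : ∀ i j x, i ≠ j → Below (w i) x → ¬ Below (w j) x := fun i j x hij hi hj =>
    (hi.comparable hj).elim (hw i j hij) (hw j i hij.symm)
  obtain ⟨n, hn⟩ := h.exists_block_in_cover hw hC fun i => (Nat.unpair i).1
  have hpair : ∀ {i j}, i ≠ j → Nat.pair n i ≠ Nat.pair n j := fun {i j} hij he =>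
    hij (Nat.pair_eq_pair.mp he).2
  obtain ⟨m, hm⟩ := h.exists_block_in_cover (w := fun j => w (Nat.pair n j))
    (fun i j hij => hw _ _ (hpair hij)) hC id
  let i₀ := Nat.pair n m
  have hstay : ∀ {c z : G} {v x : Vertex α}, z ∈ rigid G v →
      (∀ x, Below v x → c • x = z • x) → Below v x → c⁻¹ • x = z⁻¹ • x := by
    intro c z v x hz hc hx
    rw [inv_smul_eq_iff, hc _ (below_smul_of_mem_rigid (inv_mem hz) hx), smul_inv_smul]
  refine ⟨w i₀, huw _, n, m, fun l hl k hk => ?_⟩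
  have hz : ∀ {x : G}, x ∈ rigid G (w i₀) → ∀ i, (if i = i₀ then x else 1) ∈ rigid G (w i) :=
    fun {x} hx i => by
      split_ifs with hi
      · rw [hi]; exact hx
      · exact one_mem _
  have hz' : ∀ {x : G}, x ∈ rigid G (w i₀) → ∀ j, (if j = m then x else 1) ∈
      rigid G (w (Nat.pair n j)) := fun {x} hx j => by
      split_ifs with hj
      · rw [hj]; exact hx
      · exact one_mem _
  obtain ⟨c, hcC, hc1, -⟩ := hn _ (hz hl)
  obtain ⟨c', hcC', hc1', -⟩ := hn (fun _ => 1) fun _ => one_mem _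
  obtain ⟨d, hdC, hd1, hd2⟩ := hm _ (hz' hk)
  obtain ⟨d', hdC', hd1', hd2'⟩ := hm (fun _ => 1) fun _ => one_mem _
  have hfix' : ∀ j x, Below (w (Nat.pair n j)) x → c'⁻¹ • x = x := fun j x hx => by
    rw [hstay (one_mem (rigid G (w (Nat.pair n j)))) (hc1' (Nat.pair n j) (by simp)) hx, inv_one,
      one_smul]
  have hfixd : ∀ x, Below (w i₀) x → d'⁻¹ • x = x := fun x hx => by
    rw [hstay (one_mem (rigid G (w i₀))) (hd1' m rfl) hx, inv_one, one_smul]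
  refine ⟨c'⁻¹ * c, Set.mul_mem_mul (Set.inv_mem_inv.mpr hcC') hcC, d'⁻¹ * d,
    Set.mul_mem_mul (Set.inv_mem_inv.mpr hdC') hdC, h.commutator_eq hl hk (fun x hx => ?_)
    (fun x hx => ?_) (fun x hx => ?_)⟩
  · rw [mul_smul, hc1 i₀ (by simp [i₀]) x hx, if_pos rfl,
      hfix' m _ (below_smul_of_mem_rigid hl hx)]
  · have h1 := hd1 m rfl x hx
    rw [if_pos rfl] at h1
    rw [mul_smul, h1, hfixd _ (below_smul_of_mem_rigid hk hx)]
  · by_cases hex : ∃ j, Below (w (Nat.pair n j)) x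
    · obtain ⟨j, hj⟩ := hex
      left
      have hjm : Nat.pair n j ≠ i₀ := fun he => hx (he ▸ hj)
      have h1 := hc1 (Nat.pair n j) (by simp) x hj
      rw [if_neg hjm, one_smul] at h1
      rw [mul_smul, h1, hfix' j x hj]
    · right
      push Not at hex
      rw [mul_smul, hd2 x hex, inv_smul_eq_iff, hd2' x hex]

variable [IsTopologicalGroup G]

/-- It is the product of the finitely many compact rigid stabilizers on level `n`. -/
theorem isClosed_rigidLevel (h : BranchAction G α) (n : ℕ) :
    IsClosed (rigidLevel G α n : Set G) := by
  have := h.t2Space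
  have := Fintype.ofFinite {v : Vertex α // level v = n}
  let L : List {v : Vertex α // level v = n} := Finset.univ.toList
  have hinc : ∀ i j : {v : Vertex α // level v = n}, i ≠ j → ¬ Below i.1 j.1 := fun i j hij hb =>
    hij (Subtype.ext (hb.eq_of_level_le (j.2.trans i.2.symm).le))
  have hcpt : ∀ L : List {v : Vertex α // level v = n},
      IsCompact (L.map fun v => (rigid G v.1 : Set G)).prod := by
    intro L
    induction L with
    | nil => simp
    | cons v L ih =>
      rw [List.map_cons, List.prod_cons]
      exact (h.isClosed_rigid v.1).isCompact.mul ih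
  have hsub : ∀ L : List {v : Vertex α // level v = n},
      (L.map fun v => (rigid G v.1 : Set G)).prod ⊆ rigidLevel G α n := by
    intro L
    induction L with
    | nil => simp [one_mem]
    | cons v L ih =>
      rw [List.map_cons, List.prod_cons]
      rintro _ ⟨a, ha, b, hb, rfl⟩
      exact mul_mem (le_iSup (fun v : {v : Vertex α // level v = n} => rigid G v.1) v ha) (ih hb)
  have hmem : ∀ (z : {v : Vertex α // level v = n} → G), (∀ v, z v ∈ rigid G v.1) →
      ∀ L : List {v : Vertex α // level v = n},
      (L.map z).prod ∈ (L.map fun v => (rigid G v.1 : Set G)).prod := by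
    intro z hz L
    induction L with
    | nil => simp
    | cons v L ih =>
      rw [List.map_cons, List.prod_cons, List.map_cons, List.prod_cons]
      exact Set.mul_mem_mul (hz v) ih
  have heq : (rigidLevel G α n : Set G) = (L.map fun v => (rigid G v.1 : Set G)).prod := by
    refine Set.Subset.antisymm (fun s hs => ?_) (hsub L)
    obtain ⟨hs1, hs2⟩ := exists_agree_of_mem_rigidLevel hs
    choose z hz hsz using fun v : {v : Vertex α // level v = n} => hs1 v.1 v.2
    obtain ⟨hp1, hp2⟩ := prod_smul_of_incomparable hinc hz L (Finset.nodup_toList _)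
    have : s = (L.map z).prod := h.ext fun w => by
      by_cases hw : n ≤ level w
      · obtain ⟨v, hvw, hv⟩ := exists_above_level h.two_le w hw
        rw [hp1 ⟨v, hv⟩ (by simp [L]) w hvw, hsz ⟨v, hv⟩ w hvw]
      · have hw' : level w < n := not_le.mp hw
        rw [hs2 w hw', hp2 w fun v _ hb => hw (v.2.symm.le.trans hb.level_le)]
    rw [this]
    exact hmem z hz L
  rw [heq]
  exact (hcpt L).isClosed

theorem isOpen_commutator_rigidLevel (h : BranchAction G α) {n : ℕ}
    (hn : (⁅rigidLevel G α n, rigidLevel G α n⁆ : Subgroup G).index ≠ 0) :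
    IsOpen ((⁅rigidLevel G α n, rigidLevel G α n⁆ : Subgroup G) : Set G) := by
  have := h.t2Space
  have := countable_quotient_commutator hn
  have : CompactSpace (rigidLevel G α n) :=
    isCompact_iff_compactSpace.mp (h.isClosed_rigidLevel n).isCompact
  have := h.finiteIndex n
  have ho := Subgroup.isOpen_of_isClosed_of_finiteIndex _ (h.isClosed_rigidLevel n)
  rw [← Subgroup.map_subtype_commutator]
  exact ho.isOpenMap_subtype_val _
    (isOpen_commutator (G := rigidLevel G α n))

/-- The commutators of the rigid stabilizers on level `n` boundedly generate the commutator
subgroup of `rigidLevel`. -/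
theorem exists_commutator_rigidLevel_subset_pow (h : BranchAction G α) {n : ℕ}
    (hn : (⁅rigidLevel G α n, rigidLevel G α n⁆ : Subgroup G).index ≠ 0)
    {Y : Set G}
    (hY : ∀ v : Vertex α, level v = n → ∀ l ∈ rigid G v, ∀ k ∈ rigid G v, ⁅l, k⁆ ∈ Y) :
    ∃ j : ℕ, ((⁅rigidLevel G α n, rigidLevel G α n⁆ : Subgroup G) : Set G) ⊆ Y ^ j := by
  have := h.t2Space
  have := countable_quotient_commutator hn
  have : CompactSpace (rigidLevel G α n) :=
    isCompact_iff_compactSpace.mp (h.isClosed_rigidLevel n).isCompact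
  have := Fintype.ofFinite {v : Vertex α // level v = n}
  obtain ⟨k, hk⟩ := exists_commutator_subset_pow (G := rigidLevel G α n)
  let L : List {v : Vertex α // level v = n} := Finset.univ.toList
  refine ⟨L.length * k, ?_⟩
  rw [← Subgroup.map_subtype_commutator, pow_mul]
  rintro _ ⟨s, hs, rfl⟩
  have h1 : (rigidLevel G α n).subtype s ∈
      (rigidLevel G α n).subtype '' (commutatorSet (rigidLevel G α n) ^ k) := ⟨s, hk hs, rfl⟩
  rw [Set.image_pow] at h1
  refine Set.pow_subset_pow_left ?_ h1
  rintro _ ⟨_, ⟨a, b, rfl⟩, rfl⟩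
  obtain ⟨z, hz, hab⟩ := h.commutator_eq_list_prod a.2 b.2 L (Finset.nodup_toList _)
    (fun v => by simp [L])
  rw [map_commutatorElement]
  change ⁅(a : G), (b : G)⁆ ∈ _
  rw [hab]
  refine list_prod_mem_pow L fun v _ => ?_
  obtain ⟨l, hl, k, hk, he⟩ := hz v
  rw [he]
  exact hY v.1 v.2 l hl k hk

end BranchAction

/-! ### Strong just infiniteness and the other properties -/

namespace BranchAction

variable {G : Type u} [Group G] [TopologicalSpace G] {α : ℕ → ℕ} [MulAction G (Vertex α)]

theorem index_commutator_ne_zero (h : BranchAction G α) (hG : StronglyJustInfinite G) (n : ℕ) :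
    (⁅rigidLevel G α n, rigidLevel G α n⁆ : Subgroup G).index ≠ 0 := by
  have := h.rigidLevel_normal n
  exact (hG _ inferInstance (h.commutator_rigidLevel_ne_bot n)).2.index_ne_zero

variable [IsTopologicalGroup G] [CompactSpace G]

theorem stronglyJustInfinite_of_forall (h : BranchAction G α)
    (hD : ∀ n, (⁅rigidLevel G α n, rigidLevel G α n⁆ : Subgroup G).index ≠ 0) :
    StronglyJustInfinite G := by
  intro N hN hne
  obtain ⟨n, -, hn⟩ := h.exists_commutator_rigidLevel_le hN hne
  have ho := Subgroup.isOpen_mono hn (h.isOpen_commutator_rigidLevel (hD n))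
  exact ⟨ho, finiteIndex_of_isOpen ho⟩

/-- The cover by balls bounds the commutators at one vertex, conjugation bounds them on its whole
level, and bounded generation bounds the finite index subgroup they generate. -/
theorem boundedLengths (h : BranchAction G α) (hG : StronglyJustInfinite G) :
    BoundedLengths G := by
  intro L hmul hinv
  have hC : ⋃ n : ℕ, {g | L g ≤ n} = Set.univ := Set.eq_univ_of_forall fun g => by
    obtain ⟨n, hn⟩ := exists_nat_ge (L g)
    exact Set.mem_iUnion.mpr ⟨n, hn⟩
  obtain ⟨w, -, n, m, hw⟩ := h.exists_commutators_in_cover (root α) hC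
  have hsq : ∀ (n : ℕ) (a : G), a ∈ ({g | L g ≤ n} : Set G)⁻¹ * {g | L g ≤ n} →
      L a ≤ n + n := by
    rintro n _ ⟨x, hx, y, hy, rfl⟩
    have hx' : L x ≤ n := by
      rw [← hinv x]
      exact hx
    exact (hmul x y).trans (add_le_add hx' hy)
  have hcom : ∀ a b, L ⁅a, b⁆ ≤ 2 * L a + 2 * L b := fun a b => by
    rw [commutatorElement_def]
    have h1 := hmul (a * b * a⁻¹) b⁻¹
    have h2 := hmul (a * b) a⁻¹
    have h3 := hmul a b
    rw [hinv] at h1 h2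
    linarith
  have := Fintype.ofFinite {v : Vertex α // level v = level w}
  choose t ht using fun v : {v : Vertex α // level v = level w} => h.transitive w v.1 v.2.symm
  -- The first summand bounds the commutators at `w`, the sum bounds the cost of conjugating by any
  -- `t v`; absolute values keep every summand nonnegative.
  let c : ℝ := (2 * (n + n) + 2 * (m + m)) + ∑ v, 2 * |L (t v)|
  obtain ⟨j, hj⟩ := h.exists_commutator_rigidLevel_subset_pow
    (h.index_commutator_ne_zero hG (level w)) (Y := {g | L g ≤ c}) (fun v hv l hl k hk => by
      have htv : t ⟨v, hv⟩ • w = v := ht ⟨v, hv⟩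
      set s := t ⟨v, hv⟩ with hs
      rw [← htv] at hl hk
      obtain ⟨l', hl', rfl⟩ := h.mem_rigid_of_smul s hl
      obtain ⟨k', hk', rfl⟩ := h.mem_rigid_of_smul s hk
      obtain ⟨a, ha, b, hb, hab⟩ := hw l' hl' k' hk'
      have e1 : ⁅s * l' * s⁻¹, s * k' * s⁻¹⁆ = s * ⁅l', k'⁆ * s⁻¹ := by
        simp only [commutatorElement_def]; group
      have h1 := hsq n a ha
      have h2 := hsq m b hb
      have h3 := hcom a b
      have h4 := hmul (s * ⁅a, b⁆) s⁻¹
      have h5 := hmul s ⁅a, b⁆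
      have h6 : 2 * |L s| ≤ ∑ v, 2 * |L (t v)| :=
        Finset.single_le_sum (f := fun v => 2 * |L (t v)|) (fun _ _ => by positivity)
          (Finset.mem_univ (⟨v, hv⟩ : {v : Vertex α // level v = level w}))
      have h7 := le_abs_self (L s)
      rw [hinv] at h4
      change L _ ≤ c
      rw [e1, hab]
      simp only [c]
      linarith)
  have hpow : ∀ j : ℕ, ∀ g ∈ ({g | L g ≤ c} : Set G) ^ j, L g ≤ L 1 + j * c := by
    intro j
    induction j with
    | zero => intro g hg; rw [show g = 1 by simpa using hg]; simp
    | succ j ih =>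
      intro g hg
      obtain ⟨a, ha, b, hb, rfl⟩ := Set.mem_mul.mp (pow_succ ({g | L g ≤ c} : Set G) j ▸ hg)
      have h1 := ih a ha
      have h2 : L b ≤ c := hb
      have h3 := hmul a b
      push_cast
      linarith
  let D : Subgroup G := ⁅rigidLevel G α (level w), rigidLevel G α (level w)⁆
  have : D.FiniteIndex := ⟨h.index_commutator_ne_zero hG (level w)⟩
  have : Finite (G ⧸ D) := Subgroup.finite_quotient_of_finiteIndex
  obtain ⟨d, hd⟩ := (Set.finite_range fun q : G ⧸ D => L (Quotient.out q)).bddAbove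
  refine ⟨d + (L 1 + j * c), fun g => ?_⟩
  have h1 : (Quotient.out (g : G ⧸ D))⁻¹ * g ∈ D :=
    QuotientGroup.eq.mp (QuotientGroup.out_eq' (g : G ⧸ D))
  have h2 := hmul (Quotient.out (g : G ⧸ D)) ((Quotient.out (g : G ⧸ D))⁻¹ * g)
  rw [mul_inv_cancel_left] at h2
  exact h2.trans (add_le_add (hd ⟨_, rfl⟩) (hpow j _ (hj h1)))

/-- By Baire category the closure of `K` is open, so it contains a normal subgroup `N` of finite
index, and on each vertex `K` realizes whatever `N` does. The stabilizers of the vertices of a ray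
decrease, so their images in the finite group `G ⧸ N` are constant from some level `n` on; below
level `n` the orbits on a subtree are already those of `N`. -/
theorem exists_level_orbit (h : BranchAction G α) (K : Subgroup G) [Countable (G ⧸ K)] :
    ∃ n, ∀ u y y' : Vertex α, level u = n → Below u y → Below u y' → level y = level y' →
      ∃ k ∈ K, k • y = y' := by
  have := h.t2Space
  let N := K.topologicalClosure.normalCore
  have hf : K.topologicalClosure.FiniteIndex :=
    finiteIndex_of_isOpen (isOpen_topologicalClosure_of_countable K)
  have : Finite (G ⧸ N) := Subgroup.finite_quotient_of_finiteIndex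
  have hNK : ∀ g ∈ N, ∀ v : Vertex α, ∃ k ∈ K, k • v = g • v := by
    intro g hg v
    have h1 : g ∈ closure (K : Set G) := Subgroup.normalCore_le _ hg
    obtain ⟨k, hk1, hk2⟩ := mem_closure_iff.mp h1 _ (h.isOpen_fiber v (g • v)) rfl
    exact ⟨k, hk2, hk1⟩
  let x : ∀ i : ℕ, Fin (α i) := fun i => ⟨0, by have := h.two_le i; omega⟩
  let P : ℕ → Subgroup G := fun m => MulAction.stabilizer G (trunc m x)
  have hbelow : ∀ {m n}, m ≤ n → Below (trunc m x) (trunc n x) := fun hmn =>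
    below_trunc_iff.mpr ⟨hmn, fun _ _ => rfl⟩
  have huniq : ∀ {u v y : Vertex α}, Below u y → Below v y → level u = level v → u = v :=
    fun hu hv he => (hu.of_common hv he.le).eq_of_level_le he.ge
  have hPanti : Antitone P := fun m n hmn g hg => by
    rw [MulAction.mem_stabilizer_iff] at hg ⊢
    refine huniq (y := trunc n x) ?_ (hbelow hmn) (h.level_smul g _)
    have := h.below_smul g _ _ (hbelow hmn)
    rwa [hg] at this
  obtain ⟨n, hn⟩ := WellFoundedGT.monotone_chain_condition
    (⟨fun m => OrderDual.toDual ((P m).map (QuotientGroup.mk' N)),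
      fun m n hmn => Subgroup.map_mono (hPanti hmn)⟩ : ℕ →o (Subgroup (G ⧸ N))ᵒᵈ)
  refine ⟨n, fun u y y' hu hy hy' hl => ?_⟩
  obtain ⟨g, hg⟩ := h.transitive (trunc (level y) x) y rfl
  obtain ⟨g', hg'⟩ := h.transitive (trunc (level y) x) y' hl
  have hny : n ≤ level y := hu ▸ hy.level_le
  have hgu : g • trunc n x = u := by
    refine huniq (y := y) ?_ hy ((h.level_smul _ _).trans hu.symm)
    have := h.below_smul g _ _ (hbelow hny)
    rwa [hg] at this
  have hgu' : g' • trunc n x = u := by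
    refine huniq (y := y') ?_ hy' ((h.level_smul _ _).trans hu.symm)
    have := h.below_smul g' _ _ (hbelow hny)
    rwa [hg'] at this
  have hp : g⁻¹ * g' ∈ P n := by
    rw [MulAction.mem_stabilizer_iff, mul_smul, hgu', ← hgu, inv_smul_smul]
  have hmap : (P n).map (QuotientGroup.mk' N) = (P (level y)).map (QuotientGroup.mk' N) :=
    hn (level y) hny
  have h1 : QuotientGroup.mk' N (g⁻¹ * g') ∈ (P (level y)).map (QuotientGroup.mk' N) :=
    hmap ▸ ⟨_, hp, rfl⟩
  obtain ⟨c, hc, hcp⟩ := h1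
  have hq : c⁻¹ * (g⁻¹ * g') ∈ N := QuotientGroup.eq.mp hcp
  have hNn : N.Normal := Subgroup.normalCore_normal _
  have hq' : g * (c * (c⁻¹ * (g⁻¹ * g')) * c⁻¹) * g⁻¹ ∈ N :=
    hNn.conj_mem _ (hNn.conj_mem _ hq c) g
  obtain ⟨k, hk, hky⟩ := hNK _ hq' y
  refine ⟨k, hk, ?_⟩
  have hc' : c⁻¹ • trunc (level y) x = trunc (level y) x := inv_mem hc
  calc k • y = (g * (c * (c⁻¹ * (g⁻¹ * g')) * c⁻¹) * g⁻¹) • y := hky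
    _ = (g' * c⁻¹ * g⁻¹) • y := by congr 1; group
    _ = y' := by
      conv_lhs => rw [← hg]
      rw [mul_smul, inv_smul_smul, mul_smul, hc', hg']

theorem exists_pow_mem_nhds_of_one_mem (h : BranchAction G α) (hG : StronglyJustInfinite G)
    {A : Set G} (hA : A⁻¹ = A) (hone : 1 ∈ A) (hS : SigmaSyndetic A) :
    ∃ n : ℕ, A ^ n ∈ 𝓝 (1 : G) := by
  obtain ⟨g, hg⟩ := hS
  let K := Subgroup.closure A
  have hK : Countable (G ⧸ K) := by
    refine Function.Surjective.countable (f := fun n : ℕ => (g n : G ⧸ K)) fun q => ?_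
    obtain ⟨x, rfl⟩ := QuotientGroup.mk_surjective q
    obtain ⟨n, hn⟩ := Set.mem_iUnion.mp (hg.symm.subset (Set.mem_univ x))
    refine ⟨n, QuotientGroup.eq.mpr (Subgroup.subset_closure ?_)⟩
    rwa [Set.mem_smul_set_iff_inv_smul_mem] at hn
  obtain ⟨n, hn⟩ := h.exists_level_orbit K
  let Good : Vertex α → ℕ → Prop := fun v j => ∀ l ∈ rigid G v, ∀ k ∈ rigid G v, ⁅l, k⁆ ∈ A ^ j
  have hmono : ∀ {i j : ℕ}, i ≤ j → A ^ i ⊆ A ^ j := fun hij => Set.pow_subset_pow_right hone hij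
  have hexists : ∀ u : Vertex α, ∃ w, Below u w ∧ ∃ j, Good w j := by
    intro u
    obtain ⟨w, huw, i, j, hw⟩ := h.exists_commutators_in_cover u hg
    -- Quotients of elements of one translate of `A` lie in `A ^ 2`, and a commutator has four such
    -- factors.
    refine ⟨w, huw, 8, fun l hl k hk => ?_⟩
    obtain ⟨a, ha, b, hb, hab⟩ := hw l hl k hk
    have hsq : ∀ i, (g i • A)⁻¹ * (g i • A) ⊆ A ^ 2 := by
      rintro i _ ⟨x, hx, y, hy, rfl⟩
      rw [Set.mem_inv, Set.mem_smul_set_iff_inv_smul_mem, smul_eq_mul] at hx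
      rw [Set.mem_smul_set_iff_inv_smul_mem, smul_eq_mul] at hy
      rw [pow_two]
      refine ⟨x * g i, ?_, (g i)⁻¹ * y, hy, by group⟩
      rw [← hA, Set.mem_inv]
      simpa using hx
    have hinv2 : ∀ x ∈ A ^ 2, x⁻¹ ∈ A ^ 2 := fun x hx => by
      rw [← hA, inv_pow]; simpa using hx
    have ha' := hsq i ha
    have hb' := hsq j hb
    rw [hab, commutatorElement_def, show 8 = 2 + 2 + 2 + 2 from rfl, pow_add, pow_add, pow_add]
    exact Set.mul_mem_mul (Set.mul_mem_mul (Set.mul_mem_mul ha' hb') (hinv2 a ha')) (hinv2 b hb')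
  have hconj : ∀ k ∈ K, ∀ v j, Good v j → ∃ j', Good (k • v) j' := by
    intro k hk v j hv
    obtain ⟨i, hi⟩ := exists_mem_pow_of_mem_closure hA hk
    refine ⟨i + j + i, fun l hl m hm => ?_⟩
    obtain ⟨l', hl', rfl⟩ := h.mem_rigid_of_smul k hl
    obtain ⟨m', hm', rfl⟩ := h.mem_rigid_of_smul k hm
    have e1 : ⁅k * l' * k⁻¹, k * m' * k⁻¹⁆ = k * ⁅l', m'⁆ * k⁻¹ := by
      simp only [commutatorElement_def]; group
    rw [e1, pow_add, pow_add]
    refine Set.mul_mem_mul (Set.mul_mem_mul hi (hv l' hl' m' hm')) ?_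
    rw [← hA, inv_pow]
    simpa using hi
  choose w huw hw using hexists
  -- Every vertex `v` on level `M` has an ancestor `v'` on the level of the good vertex `w u`, where
  -- `u` is its ancestor on level `n`. An element of `K` moves `w u` to `v'`, and the rigid
  -- stabilizer of `v` is smaller than that of `v'`.
  obtain ⟨M, hM⟩ := (Set.finite_range fun u : {u : Vertex α // level u = n} =>
    level (w u.1)).bddAbove
  obtain ⟨v₀, -, hv₀⟩ := exists_below_level h.two_le (root α) (Nat.zero_le n)
  have hnM : n ≤ M := by
    have h1 := (huw v₀).level_le
    rw [hv₀] at h1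
    exact h1.trans (hM ⟨⟨v₀, hv₀⟩, rfl⟩)
  have hall : ∀ v : {v : Vertex α // level v = M}, ∃ j, Good v.1 j := by
    rintro ⟨v, hv⟩
    obtain ⟨u, huv, hu⟩ := exists_above_level h.two_le v (hnM.trans hv.ge)
    have hwM : level (w u) ≤ M := hM ⟨⟨u, hu⟩, rfl⟩
    obtain ⟨v', hv'v, hv'⟩ := exists_above_level h.two_le v (hwM.trans hv.ge)
    have huv' : Below u v' := huv.of_common hv'v (by rw [hv']; exact (huw u).level_le)
    obtain ⟨k, hk, hkv⟩ := hn u (w u) v' hu (huw u) huv' hv'.symm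
    obtain ⟨j, hj⟩ := hw u
    obtain ⟨j', hj'⟩ := hconj k hk _ j hj
    rw [hkv] at hj'
    exact ⟨j', fun l hl k hk => hj' l (rigid_mono hv'v hl) k (rigid_mono hv'v hk)⟩
  choose j hj using hall
  obtain ⟨J, hJ⟩ := (Set.finite_range j).bddAbove
  obtain ⟨i, hi⟩ := h.exists_commutator_rigidLevel_subset_pow
    (h.index_commutator_ne_zero hG M) (Y := A ^ J)
    (fun v hv l hl k hk => hmono (hJ ⟨⟨v, hv⟩, rfl⟩) (hj ⟨v, hv⟩ l hl k hk))
  rw [← pow_mul] at hi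
  exact ⟨J * i, Filter.mem_of_superset ((h.isOpen_commutator_rigidLevel
    (h.index_commutator_ne_zero hG M)).mem_nhds (one_mem _)) hi⟩

/-- Replacing `A` by `A ^ 2` makes `1` a member. -/
theorem weakSteinhaus (h : BranchAction G α) (hG : StronglyJustInfinite G) :
    WeakSteinhausProperty G := by
  rintro A hA ⟨g, hg⟩
  obtain ⟨a, ha⟩ : A.Nonempty := by
    by_contra hne
    rw [Set.not_nonempty_iff_eq_empty] at hne
    simp [hne] at hg
    exact Set.empty_ne_univ hg
  have hmem : ∀ x ∈ A, ∀ y ∈ A, x⁻¹ * y ∈ A ^ 2 := fun x hx y hy => by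
    rw [pow_two]
    exact Set.mul_mem_mul (by rw [← hA]; simpa using hx) hy
  obtain ⟨n, hn⟩ := h.exists_pow_mem_nhds_of_one_mem hG (A := A ^ 2) (by rw [← inv_pow, hA])
    (by simpa using hmem a ha a ha) ⟨fun n => g n * a, Set.eq_univ_of_forall fun x => by
      obtain ⟨n, y, hy, hx⟩ := Set.mem_iUnion.mp (hg.symm.subset (Set.mem_univ x))
      refine Set.mem_iUnion.mpr ⟨n, a⁻¹ * y, hmem a ha y hy, ?_⟩
      rw [← hx]
      simp [mul_assoc]⟩
  exact ⟨2 * n, by rwa [pow_mul]⟩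

theorem commensuratedFiniteOrOpen (h : BranchAction G α) (hG : StronglyJustInfinite G) :
    CommensuratedFiniteOrOpen G := by
  intro C hC
  obtain ⟨N, hN, hNC⟩ := (h.boundedLengths hG).exists_normal_commensurable C hC
  by_cases hbot : N = ⊥
  · left
    have h1 := hNC.1
    rw [hbot, Subgroup.relIndex_bot_left] at h1
    have := Nat.finite_of_card_ne_zero h1
    exact Set.toFinite _
  · right
    have h1 := (hG N hN hbot).2.index_ne_zero
    have h2 : C.index ≠ 0 := by
      have := Subgroup.relIndex_ne_zero_trans hNC.2 (by rwa [Subgroup.relIndex_top_right] : N.relIndex ⊤ ≠ 0)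
      rwa [Subgroup.relIndex_top_right] at this
    have hf : C.FiniteIndex := ⟨h2⟩
    -- A finite index subgroup of the infinite group `G` has a nontrivial normal core, which is open
    -- by (1).
    have hcore : C.normalCore ≠ ⊥ := fun hb => by
      have h3 := (Subgroup.finiteIndex_normalCore C).index_ne_zero
      rw [hb, Subgroup.index_bot] at h3
      have := h.infinite
      exact h3 Nat.card_eq_zero_of_infinite
    exact Subgroup.isOpen_mono (Subgroup.normalCore_le C)
      (hG _ (Subgroup.normalCore_normal C) hcore).1

theorem stronglyJustInfinite_of_commensurated (h : BranchAction G α)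
    (hG : CommensuratedFiniteOrOpen G) : StronglyJustInfinite G := by
  intro N hN hne
  have hinf := h.infinite_of_normal hN hne
  have hcom : IsCommensurated N := by
    refine (Subgroup.eq_top_iff' _).mpr fun g => ?_
    rw [Subgroup.Commensurable.commensurator_mem_iff, Subgroup.Normal.conjAct hN]
  have ho := (hG N hcom).resolve_left fun hf => hinf.not_finite hf
  exact ⟨ho, finiteIndex_of_isOpen ho⟩

theorem stronglyJustInfinite_of_normalCountableIndex (h : BranchAction G α)
    (hG : NormalCountableIndexProperty G) : StronglyJustInfinite G := by
  refine h.stronglyJustInfinite_of_forall fun n hn => ?_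
  have := h.rigidLevel_normal n
  have := h.finiteIndex n
  obtain ⟨N, hN, hNc, hNi⟩ := exists_normal_countable_index_of_commutator _ hn
  exact (finiteIndex_of_isOpen (hG N hN hNc)).index_ne_zero hNi

theorem stronglyJustInfinite_of_uncountableCofinality_or_cayleyBounded (h : BranchAction G α)
    (hG : UncountableCofinality G ∨ CayleyBounded G) : StronglyJustInfinite G := by
  refine h.stronglyJustInfinite_of_forall fun n hn => ?_
  have := h.rigidLevel_normal n
  have := h.finiteIndex n
  have := h.t2Space
  obtain ⟨h1, h2⟩ := not_uncountableCofinality_and_not_cayleyBounded _ (h.isClosed_rigidLevel n) hn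
  exact hG.elim h1 h2

end BranchAction

theorem WeakSteinhausProperty.countableIndexProperty {G : Type u} [Group G] [TopologicalSpace G]
    [IsTopologicalGroup G] (h : WeakSteinhausProperty G) : CountableIndexProperty G := by
  intro K hK
  obtain ⟨f, hf⟩ := exists_surjective_nat (G ⧸ K)
  obtain ⟨n, hn⟩ := h K (by simp) ⟨fun n => Quotient.out (f n), Set.eq_univ_of_forall fun x => by
    obtain ⟨n, hn⟩ := hf x
    refine Set.mem_iUnion.mpr ⟨n, ?_⟩
    rw [Set.mem_smul_set_iff_inv_smul_mem]
    change (Quotient.out (f n))⁻¹ * x ∈ K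
    rw [hn]
    exact QuotientGroup.eq.mp (QuotientGroup.out_eq' (x : G ⧸ K))⟩
  have hsub : ∀ n : ℕ, ((K : Set G) ^ n) ⊆ K := by
    intro n
    induction n with
    | zero => simp [one_mem]
    | succ n ih =>
      rw [pow_succ]
      rintro _ ⟨a, ha, b, hb, rfl⟩
      exact mul_mem (ih ha) hb
  exact Subgroup.isOpen_of_mem_nhds K (Filter.mem_of_superset hn (hsub n))

/-! ### From tree automorphisms to branch actions -/

section TreeAutomorphisms

variable {α : ℕ → ℕ}

theorem TreeAut.smul_root (g : TreeAut α) : g • root α = root α := g.2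

theorem TreeAut.adj_smul (g : TreeAut α) {v w : Vertex α} (h : (treeGraph α).Adj v w) :
    (treeGraph α).Adj (g • v) (g • w) :=
  g.1.map_rel_iff.mpr h

theorem eq_root_of_level {v : Vertex α} (h : level v = 0) : v = root α := by
  refine (Below.eq_of_level_le (v := root α) ⟨Nat.zero_le _, fun i => i.elim0⟩ ?_).symm
  rw [h]
  exact Nat.zero_le _

theorem exists_parent (hα : ∀ i, 2 ≤ α i) {w : Vertex α} {n : ℕ} (hw : level w = n + 1) :
    ∃ v, IsChild v w ∧ level v = n := by
  obtain ⟨v, hvw, hv⟩ := exists_above_level hα w (m := n) (by omega)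
  exact ⟨v, ⟨hvw, by omega⟩, hv⟩

theorem TreeAut.level_smul (hα : ∀ i, 2 ≤ α i) (g : TreeAut α) (w : Vertex α) :
    level (g • w) = level w := by
  suffices H : ∀ n, ∀ (g : TreeAut α) (w : Vertex α), level w = n → level (g • w) = n from
    H _ g w rfl
  intro n
  induction n using Nat.strong_induction_on with
  | _ n ih =>
    intro g w hw
    obtain _ | n := n
    · rw [eq_root_of_level hw, g.smul_root]
      rfl
    obtain ⟨v, hvw, hv⟩ := exists_parent hα hw
    -- The image of `w` is adjacent to that of its parent. Were it nearer the root, the induction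
    -- hypothesis for `g⁻¹` would put `w` itself on that smaller level.
    have h1 := ih n n.lt_succ_self g v hv
    rcases g.adj_smul (Or.inl hvw) with h | h
    · rw [h.2, h1]
    · have h2 := h.2
      have h3 := ih (level (g • w)) (by omega) g⁻¹ (g • w) rfl
      rw [inv_smul_smul] at h3
      omega

theorem TreeAut.below_smul (hα : ∀ i, 2 ≤ α i) (g : TreeAut α) {v w : Vertex α}
    (h : Below v w) : Below (g • v) (g • w) := by
  induction hd : level w - level v generalizing w with
  | zero => rw [h.eq_of_level_le (by omega)]; exact Below.refl _
  | succ d ih =>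
    obtain ⟨x, hxw, hx⟩ := exists_parent hα (w := w) (n := level v + d) (by omega)
    refine (ih (h.of_common hxw.1 (by omega)) (by omega)).trans ?_
    rcases g.adj_smul (Or.inl hxw) with h' | h'
    · exact h'.1
    · have h1 := h'.2
      have h2 := hxw.2
      rw [g.level_smul hα, g.level_smul hα] at h1
      omega

theorem TreeAut.isOpen_fiber (v w : Vertex α) : IsOpen {g : TreeAut α | g • v = w} := by
  have h : Continuous fun (g : TreeAut α) (v : Vertex α) => g • v := continuous_induced_dom
  exact (isOpen_discrete {w}).preimage ((continuous_apply v).comp h)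

end TreeAutomorphisms

theorem IsProfiniteBranchGroup.exists_branchAction {G : Type u} [Group G] [TopologicalSpace G]
    (hG : IsProfiniteBranchGroup G) :
    ∃ (α : ℕ → ℕ) (_ : MulAction G (Vertex α)), BranchAction G α := by
  obtain ⟨α, hα, H, -, ⟨e⟩, htr, hfin⟩ := hG
  let : MulAction G (Vertex α) := MulAction.compHom (Vertex α) (e : G ≃* H).toMonoidHom
  have hsm : ∀ (g : G) (v : Vertex α), g • v = (e g : TreeAut α) • v := fun _ _ => rfl
  refine ⟨α, inferInstance, hα, fun g hg => ?_, fun v w => ?_, fun g v => ?_, fun g v w h => ?_,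
    fun v w h => ?_, fun n => ?_⟩
  · have h1 : e g = 1 := by
      refine Subtype.ext (Subtype.ext (RelIso.ext fun v => ?_))
      exact hg v
    rw [← map_one e] at h1
    exact e.injective h1
  · exact (TreeAut.isOpen_fiber v w).preimage (continuous_subtype_val.comp e.continuous)
  · exact (e g : TreeAut α).level_smul hα v
  · exact (e g : TreeAut α).below_smul hα h
  · obtain ⟨g, hg⟩ := htr v w h
    refine ⟨e.symm g, ?_⟩
    rw [hsm, e.apply_symm_apply]
    exact hg
  · have hle : (ristLevel H n).map (e : G ≃* H).symm.toMonoidHom ≤ rigidLevel G α n := by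
      rw [ristLevel, Subgroup.map_iSup]
      refine iSup_le fun v => le_trans ?_ (le_iSup (fun v : {v : Vertex α // level v = n} =>
        rigid G v.1) v)
      rintro _ ⟨g, hg, rfl⟩ w hw
      have h1 : g • w = w := hg w hw
      rw [hsm]
      refine Eq.trans ?_ h1
      exact congrArg (fun k : H => k • w) (e.apply_symm_apply g)
    have : ((ristLevel H n).map (e : G ≃* H).symm.toMonoidHom).FiniteIndex := by
      refine ⟨?_⟩
      have h1 := Subgroup.index_map_equiv (ristLevel H n) (e : G ≃* H).symm
      have h2 := (hfin n).index_ne_zero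
      rw [← h1] at h2
      exact h2
    exact Subgroup.finiteIndex_of_le hle

end ProfiniteBranch

/-! ### The equivalences -/

theorem mainTheorem1 (G : Type u) [Group G] [TopologicalSpace G] [IsTopologicalGroup G]
    [CompactSpace G] [TotallyDisconnectedSpace G] (hG : IsProfiniteBranchGroup G) :
    List.TFAE [
      StronglyJustInfinite G,
      CommensuratedFiniteOrOpen G,
      NormalCountableIndexProperty G,
      CountableIndexProperty G,
      WeakSteinhausProperty G,
      UncountableCofinality G,
      CayleyBounded G,
      PropertyFA.{u, v} G,
      BergmanProperty.{u, w} G] := by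
  obtain ⟨α, _, h⟩ := hG.exists_branchAction
  -- The isomorphic copy `H` lives in `Type`, so its coset tree and its lifted metric space fit into
  -- the universes of (8) and (9).
  obtain ⟨_, _, H, _, ⟨e⟩, _⟩ := hG
  tfae_have 1 → 5 := h.weakSteinhaus
  tfae_have 5 → 4 := WeakSteinhausProperty.countableIndexProperty
  tfae_have 4 → 3 := fun hG N _ hN => hG N hN
  tfae_have 3 → 1 := h.stronglyJustInfinite_of_normalCountableIndex
  tfae_have 1 → 2 := h.commensuratedFiniteOrOpen
  tfae_have 2 → 1 := h.stronglyJustInfinite_of_commensurated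
  tfae_have 1 → 7 := fun hG => (h.boundedLengths hG).cayleyBounded
  tfae_have 1 → 8 := fun hG => (h.boundedLengths hG).propertyFA
  tfae_have 1 → 9 := fun hG => (h.boundedLengths hG).bergmanProperty
  tfae_have 6 → 1 := fun hG =>
    h.stronglyJustInfinite_of_uncountableCofinality_or_cayleyBounded (Or.inl hG)
  tfae_have 7 → 1 := fun hG =>
    h.stronglyJustInfinite_of_uncountableCofinality_or_cayleyBounded (Or.inr hG)
  tfae_have 8 → 6 := fun hG =>
    (uncountableCofinality_of_propertyFA (PropertyFA.of_mulEquiv (e : G ≃* H) hG)).of_surjective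
      (e : G ≃* H).symm.toMonoidHom (e : G ≃* H).symm.surjective
  tfae_have 9 → 6 := fun hG =>
    (boundedLengths_of_bergmanProperty
      (BergmanProperty.of_mulEquiv (e : G ≃* H) hG)).uncountableCofinality.of_surjective
        (e : G ≃* H).symm.toMonoidHom (e : G ≃* H).symm.surjective
  tfae_finish
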